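/- Trees are finite, ordered, unranked and node-labelled, with labels from a finite alphabet $\Sigma$. A cluster of rank $0$ is a tree; a cluster of rank $1$ is a tree with a distinguished leaf, its bottom boundary node. The vertical merge of $s$ and $t$ is defined if $s$ has rank $1$ and its bottom boundary node has the same label as the root of $t$; it identifies these two nodes, and the bottom boundary node of $t$ (if any) becomes that of the result. The horizontal merge of $s$ and $t$ is defined if at most one of them has rank $1$ and their roots have the same label; it identifies the two roots, the children of the root of $s$ preceding those of the root of $t$, and keeps the bottom boundary node (if any). A top tree for a tree $t$ is a binary tree whose inner nodes are labelled with vertical or horizontal merge, whose leaves are labelled with triples $(a,b,i)$, $a,b\in\Sigma$, $i\in\{0,1\}$ (a single edge from an $a$-labelled to a $b$-labelled node, seen as a cluster of rank $i$, where for $i=1$ the lower node is the bottom boundary node), and which evaluates to $t$ (as a cluster of rank $0$). The minimal dag $\mathrm{dag}(t)$ of an ordered tree $t$ has one node for each different subtree rooted in a node of $t$, and from each of its nodes one outgoing edge for each child of the root of the corresponding subtree. A top dag for $t$ is $\mathrm{dag}(T)$ for a top tree $T$ for $t$; its height is the height of $T$. The size of a dag is its number of nodes plus its number of edges, counted with multiplicity;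 in particular $|\mathrm{dag}(t)|$ denotes the size of $\mathrm{dag}(t)$. **Theorem 1.** Let $\sigma=\max\{|\Sigma|,2\}$. There is a linear-time algorithm (on a unit-cost word RAM with words of $O(\log(n+|\Sigma|))$ bits) that computes from a given tree $t$ with labels from $\Sigma$ and $n\ge 1$ edges a top dag for $t$ of height $O(\log n)$ whose size is bounded, for $n\ge 2$, both by $O(n/\log_\sigma n)$ and by $O(|\mathrm{dag}(t)|\cdot\log n)$. The algorithm (which gets $|\Sigma|$ as part of its input) and all $O$-constants are independent of $\Sigma$ and $t$. -/

import Mathlib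

namespace TopDag

/-! ## Ordered, unranked, node-labelled trees and their minimal dags -/

/-- Ordered unranked trees whose nodes carry labels from `α`: a root label and the list of the
subtrees rooted in the children. Equality of terms is isomorphism of ordered labelled trees. -/
inductive LTree (α : Type) : Type
  | node (a : α) (children : List (LTree α)) : LTree α

namespace LTree

variable {α : Type}

/-- The label of the root. -/
def label : LTree α → α
  | node a _ => a

/-- The number of children of the root. -/
def degree : LTree α → ℕ
  | node _ ts => ts.length

/-- The number of edges of the tree. -/
def numEdges : LTree α → ℕ
  | node _ ts => (ts.map fun c => c.numEdges + 1).sum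

/-- The subtrees `t(v)` for all nodes `v` of the tree, in preorder. -/
def subtrees : LTree α → List (LTree α)
  | node a ts => node a ts :: ts.flatMap fun c => c.subtrees

open Classical in
/-- The size (number of nodes plus number of edges) of the minimal dag of a tree. The nodes of the
dag are the different subtrees; the node that represents a subtree has one outgoing edge for every
child of the root of this subtree. -/
noncomputable def dagSize (t : LTree α) : ℕ :=
  ∑ s ∈ t.subtrees.toFinset, (1 + s.degree)

end LTree

/-! ## Clusters and the two merge operations -/

/-- Clusters of rank one: trees with a distinguished leaf, the bottom boundary node.
`bottom a` is the tree that consists only of the bottom boundary node, with label `a`;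
`node a l c r` is the tree whose root has label `a` and the children
`l` (in order), then the root of `c`, then `r`, and whose bottom boundary node is the one of `c`. -/
inductive Cluster1 (α : Type) : Type
  | bottom (a : α) : Cluster1 α
  | node (a : α) (l : List (LTree α)) (c : Cluster1 α) (r : List (LTree α)) : Cluster1 α

namespace Cluster1

variable {α : Type}

/-- The label of the root (the top boundary node). -/
def topLabel : Cluster1 α → α
  | bottom a => a
  | node a _ _ _ => a

/-- The label of the bottom boundary node. -/
def bottomLabel : Cluster1 α → α
  | bottom a => a
  | node _ _ c _ => c.bottomLabel

/-- Replace the bottom boundary node by a tree. -/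
def fill : Cluster1 α → LTree α → LTree α
  | bottom _, t => t
  | node a l c r, t => LTree.node a (l ++ c.fill t :: r)

/-- Replace the bottom boundary node by a cluster of rank one. -/
def comp : Cluster1 α → Cluster1 α → Cluster1 α
  | bottom _, d => d
  | node a l c r, d => node a l (c.comp d) r

end Cluster1

/-- Clusters of rank zero (trees) and of rank one (trees with a bottom boundary node). -/
inductive Cluster (α : Type) : Type
  | rank0 (t : LTree α) : Cluster α
  | rank1 (c : Cluster1 α) : Cluster α

namespace Cluster

variable {α : Type} [DecidableEq α]

/-- The vertical merge; `none` means that it is undefined. -/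
def vmerge : Cluster α → Cluster α → Option (Cluster α)
  | rank1 c, rank0 t => if c.bottomLabel = t.label then some (rank0 (c.fill t)) else none
  | rank1 c, rank1 d => if c.bottomLabel = d.topLabel then some (rank1 (c.comp d)) else none
  | rank0 _, _ => none

/-- The horizontal merge; `none` means that it is undefined. (A cluster of rank one that consists
of a single node is not merged horizontally: its bottom boundary node would not stay a leaf. No
such cluster can be built from edges.) -/
def hmerge : Cluster α → Cluster α → Option (Cluster α)
  | rank0 (.node a xs), rank0 (.node b ys) =>
      if a = b then some (rank0 (.node a (xs ++ ys))) else none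
  | rank0 (.node a xs), rank1 (.node b l c r) =>
      if a = b then some (rank1 (.node a (xs ++ l) c r)) else none
  | rank1 (.node a l c r), rank0 (.node b ys) =>
      if a = b then some (rank1 (.node a l c (r ++ ys))) else none
  | _, _ => none

/-- The atomic cluster that consists of a single edge from a node with label `a` to a node with
label `b`; it has rank one if `r` is `true` (then the lower node is the bottom boundary node), and
rank zero otherwise. -/
def atomic {α : Type} (a b : α) (r : Bool) : Cluster α :=
  if r then rank1 (.node a [] (.bottom b) []) else rank0 (.node a [.node b []])

end Cluster

/-! ## Top trees and top dags -/

/-- Top trees over the label alphabet `α`: the leaves are atomic clusters `(a, b, r)` with the bit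
`r` for the rank, the inner nodes are vertical and horizontal merges. -/
inductive TopTree (α : Type) : Type
  | leaf (a b : α) (r : Bool) : TopTree α
  | vert (x y : TopTree α) : TopTree α
  | horiz (x y : TopTree α) : TopTree α

namespace TopTree

variable {α : Type}

/-- The evaluation of a top tree; `none` means undefined. -/
def eval [DecidableEq α] : TopTree α → Option (Cluster α)
  | leaf a b r => some (Cluster.atomic a b r)
  | vert x y => x.eval.bind fun c => y.eval.bind fun d => c.vmerge d
  | horiz x y => x.eval.bind fun c => y.eval.bind fun d => c.hmerge d

/-- `T` is a top tree for the tree `t`. -/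
def IsTopTreeFor [DecidableEq α] (T : TopTree α) (t : LTree α) : Prop :=
  T.eval = some (Cluster.rank0 t)

/-- The height: the number of edges on a longest path from the root to a leaf. This is also the
height of the dag of the top tree. -/
def height : TopTree α → ℕ
  | leaf _ _ _ => 0
  | vert x y => max x.height y.height + 1
  | horiz x y => max x.height y.height + 1

/-- The number of children of the root. -/
def degree : TopTree α → ℕ
  | leaf _ _ _ => 0
  | vert _ _ => 2
  | horiz _ _ => 2

/-- The subtrees rooted in all the nodes of the top tree, in preorder. -/
def subtrees : TopTree α → List (TopTree α)
  | leaf a b r => [leaf a b r]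
  | vert x y => vert x y :: (x.subtrees ++ y.subtrees)
  | horiz x y => horiz x y :: (x.subtrees ++ y.subtrees)

open Classical in
/-- The size (number of nodes plus number of edges) of the minimal dag of a top tree. -/
noncomputable def dagSize (T : TopTree α) : ℕ :=
  ∑ S ∈ T.subtrees.toFinset, (1 + S.degree)

end TopTree

/-! ## Word RAM programs -/

/-- The configuration of the store of a random access machine: registers and memory cells, all of
them holding natural numbers. -/
structure Store : Type where
  /-- the contents of the registers -/
  reg : ℕ → ℕ
  /-- the contents of the memory cells -/
  mem : ℕ → ℕ

/-- Arithmetic operations on words (truncated subtraction, integer division). -/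
inductive ArithOp : Type
  | add | sub | mul | div

/-- The value of an arithmetic operation. -/
def ArithOp.eval : ArithOp → ℕ → ℕ → ℕ
  | add, x, y => x + y
  | sub, x, y => x - y
  | mul, x, y => x * y
  | div, x, y => x / y

/-- Tests: comparisons of two registers. -/
inductive Test : Type
  | lt (a b : ℕ) | eq (a b : ℕ) | ne (a b : ℕ)

/-- The truth of a test in a store. -/
def Test.Holds : Test → Store → Prop
  | lt a b, σ => σ.reg a < σ.reg b
  | eq a b, σ => σ.reg a = σ.reg b
  | ne a b, σ => σ.reg a ≠ σ.reg b

/-- Programs of the random access machine, in structured form. -/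
inductive Prog : Type
  /-- do nothing -/
  | skip : Prog
  /-- `reg r := c` -/
  | const (r c : ℕ) : Prog
  /-- `reg r := op (reg a) (reg b)` -/
  | arith (op : ArithOp) (r a b : ℕ) : Prog
  /-- `reg r := mem (reg a)` -/
  | load (r a : ℕ) : Prog
  /-- `mem (reg a) := reg b` -/
  | store (a b : ℕ) : Prog
  /-- run `p`, then `q` -/
  | seq (p q : Prog) : Prog
  /-- if `c` then `p` else `q` -/
  | ite (c : Test) (p q : Prog) : Prog
  /-- while `c` do `p` -/
  | loop (c : Test) (p : Prog) : Prog

/-- `Exec W p σ τ k`: started in the store `σ`, the program `p` halts in the store `τ` after exactly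
`k` steps, and all words that it computes are smaller than `W`. Every elementary instruction and
every evaluation of a test is one step. A program that computes a word that is not smaller than `W`
does not halt properly; memory addresses are contents of registers, so they obey the bound too. -/
inductive Exec (W : ℕ) : Prog → Store → Store → ℕ → Prop
  | skip (σ : Store) : Exec W .skip σ σ 1
  | const (σ : Store) (r c : ℕ) (h : c < W) :
      Exec W (.const r c) σ ⟨Function.update σ.reg r c, σ.mem⟩ 1
  | arith (σ : Store) (op : ArithOp) (r a b : ℕ) (h : op.eval (σ.reg a) (σ.reg b) < W) :
      Exec W (.arith op r a b) σ
        ⟨Function.update σ.reg r (op.eval (σ.reg a) (σ.reg b)), σ.mem⟩ 1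
  | load (σ : Store) (r a : ℕ) (h : σ.mem (σ.reg a) < W) :
      Exec W (.load r a) σ ⟨Function.update σ.reg r (σ.mem (σ.reg a)), σ.mem⟩ 1
  | store (σ : Store) (a b : ℕ) :
      Exec W (.store a b) σ ⟨σ.reg, Function.update σ.mem (σ.reg a) (σ.reg b)⟩ 1
  | seq {σ τ υ : Store} {p q : Prog} {k l : ℕ} (hp : Exec W p σ τ k) (hq : Exec W q τ υ l) :
      Exec W (.seq p q) σ υ (k + l)
  | ite_true {σ τ : Store} {c : Test} {p : Prog} (q : Prog) {k : ℕ} (hc : c.Holds σ)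
      (hp : Exec W p σ τ k) : Exec W (.ite c p q) σ τ (k + 1)
  | ite_false {σ τ : Store} {c : Test} (p : Prog) {q : Prog} {k : ℕ} (hc : ¬ c.Holds σ)
      (hq : Exec W q σ τ k) : Exec W (.ite c p q) σ τ (k + 1)
  | loop_true {σ τ υ : Store} {c : Test} {p : Prog} {k l : ℕ} (hc : c.Holds σ)
      (hp : Exec W p σ τ k) (hl : Exec W (.loop c p) τ υ l) :
      Exec W (.loop c p) σ υ (k + l + 1)
  | loop_false {σ : Store} {c : Test} (p : Prog) (hc : ¬ c.Holds σ) :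
      Exec W (.loop c p) σ σ 1

/-! ## Input and output of the algorithm -/

/-- The input for a tree `t` over the alphabet `{0, …, s - 1}`: the alphabet size, the number of
nodes, and then for every node, in preorder, its label and its number of children. -/
def inputWords {s : ℕ} (t : LTree (Fin s)) : List ℕ :=
  s :: t.subtrees.length :: t.subtrees.flatMap fun u => [(u.label : ℕ), u.degree]

/-- The initial store for the input tree `t`: the input is in the memory from address `0` on, and
all other cells and all registers are `0`. -/
def initStore {s : ℕ} (t : LTree (Fin s)) : Store where
  reg := fun _ => 0
  mem := fun i => (inputWords t).getD i 0

/-- The memory `mem` holds, from address `p` on, the minimal dag of the top tree `T`, that is, the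
number of nodes of the dag, the number of its root, and for the nodes number `0, 1, 2, …` one record
of four words each. Here `L` lists, in the order of the node numbers, the subtrees of `T` that the
nodes represent; every subtree of `T` is represented by exactly one node. The record of a node is
`(0, a, b, r)` for the atomic cluster `(a, b, r)`, it is `(1, i, j, _)` for a vertical merge and
`(2, i, j, _)` for a horizontal merge with left child `i` and right child `j`. -/
def HoldsTopDag {s : ℕ} (mem : ℕ → ℕ) (p : ℕ) (T : TopTree (Fin s)) : Prop :=
  ∃ L : List (TopTree (Fin s)),
    L.Nodup ∧ (∀ S, S ∈ L ↔ S ∈ T.subtrees) ∧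
    mem p = L.length ∧ L[mem (p + 1)]? = some T ∧
    ∀ (i : ℕ) (S : TopTree (Fin s)), L[i]? = some S →
      match S with
      | .leaf a b r =>
          mem (p + 2 + 4 * i) = 0 ∧ mem (p + 2 + 4 * i + 1) = (a : ℕ) ∧
            mem (p + 2 + 4 * i + 2) = (b : ℕ) ∧ mem (p + 2 + 4 * i + 3) = r.toNat
      | .vert x y =>
          mem (p + 2 + 4 * i) = 1 ∧ L[mem (p + 2 + 4 * i + 1)]? = some x ∧
            L[mem (p + 2 + 4 * i + 2)]? = some y
      | .horiz x y =>
          mem (p + 2 + 4 * i) = 2 ∧ L[mem (p + 2 + 4 * i + 1)]? = some x ∧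
            L[mem (p + 2 + 4 * i + 2)]? = some y

end TopDag

/-!
# Top dags of optimal size in linear time

The algorithm merges along heavy paths. For every subtree `t` it computes a stack of clusters whose
vertical merge is `t` (`LTree.entry`). The edge to a light child is merged with the whole subtree of
that child; the heavy child, one of maximal size, contributes only the edge that leads to it. These
items are merged horizontally from the right to the left, and the result is pushed on the stack of
the heavy child. All merging uses one discipline, `TopTree.push`: a stack holds clusters whose size
classes (the binary logarithms of the sizes) strictly increase, and pushing a cluster merges it with
the clusters at the front of the stack until its class is smaller than all that remain. The merges
depend only on the subtree itself, so that equal subtrees yield equal stacks. Since both merges are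
associative, the result evaluates to `t` (`LTree.topTree_isTopTreeFor`).

*Height.* Along a stack, heights grow by at most two for each size class, and the size at least
halves when a light edge is passed; the sum telescopes to `O(log n)` (`LTree.topTree_height_le_log`).

*Comparison with the dag of `t`.* A stack has at most one element for each size class, so that
processing a node creates only `O(log n)` new clusters for each of its children. Equal subtrees
create the same clusters, so that only the different subtrees count:
`LTree.topTree_dagSize_le_dagSize`.

*The bound `O(n / log n)`.* Fix a threshold `2 ^ κ`. There are at most `σ ^ O(2 ^ κ)` clusters below
it (`TopTree.card_small_le`). A large cluster is fresh (both children small), or has exactly one large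
child, or two. A fresh one has at least `2 ^ κ` leaves of its own, so there are `O(n / 2 ^ κ)` of
them, and they outnumber those with two large children. Clusters with one large child are
controlled by a potential, `unary - 5 * fresh`, whose growth is paid for by the sizes
(`LTree.pot_entry`). With `2 ^ κ` about `log_σ n` this is `LTree.topTree_dagSize_le_logb`.

*Time.* The memory is zero at the start, so that a table indexed by the four words of a record serves
as a perfect dictionary for finding existing nodes of the dag in constant time, without hashing or
initialization (`Ram.getNode`). The nodes of the input are processed in reverse preorder, with an
array of pending entries. The length of the stacks is the potential of an amortized analysis: each
merge removes one element from a stack (`Ram.pushProg_spec`, `Ram.collapseProg_spec`), and the stack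
of a heavy child is not touched by the construction of its item, so that the cost of a node is linear
in its degree (`Ram.nodeProg_spec`, `Ram.tree_spec`). Programs are verified by weakest
preconditions over an abstract state with named variables, arrays, and a clock (`Ram.WP`). The clock
bounds the number of nodes and cells too, which keeps all addresses within the word size.
-/

namespace TopDag

/-! ### Trees: induction and counting -/

namespace LTree

variable {α : Type}

theorem induct {P : LTree α → Prop} (h : ∀ a ts, (∀ t ∈ ts, P t) → P (.node a ts)) :
    ∀ t, P t
  | node a ts => h a ts fun t _ => induct h t

theorem numEdges_node (a : α) (ts : List (LTree α)) :
    (node a ts).numEdges = (ts.map fun c => c.numEdges + 1).sum := by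
  rw [numEdges]

theorem subtrees_node (a : α) (ts : List (LTree α)) :
    (node a ts).subtrees = node a ts :: ts.flatMap fun c => c.subtrees := by
  rw [subtrees]

theorem length_subtrees (t : LTree α) : t.subtrees.length = t.numEdges + 1 := by
  induction t using induct with
  | h a ts ih =>
    rw [subtrees_node, numEdges_node, List.length_cons, List.length_flatMap]
    congr 2
    exact List.map_congr_left fun t ht => ih t ht

theorem self_mem_subtrees (t : LTree α) : t ∈ t.subtrees := by
  cases t with
  | node a ts => rw [subtrees_node]; exact List.mem_cons_self

end LTree

/-! ### Stacks of top trees -/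

namespace TopTree

variable {α : Type}

/-- The number of leaves, that is, the number of edges of the cluster that the top tree
evaluates to. -/
def size : TopTree α → ℕ
  | leaf _ _ _ => 1
  | vert x y => x.size + y.size
  | horiz x y => x.size + y.size

/-- A merge with a selectable operation: vertical for `true`, horizontal for `false`. -/
def merge (o : Bool) (x y : TopTree α) : TopTree α :=
  if o then vert x y else horiz x y

/-- The size class of a top tree: the integer part of the binary logarithm of its size. -/
def cls (x : TopTree α) : ℕ := Nat.log 2 x.size

/-- The largest power of two that is at most the size. The program stores it instead of the
size class, because it can be computed from those of the children by a comparison. -/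
def pw (x : TopTree α) : ℕ := 2 ^ x.cls

/-- Starting with `acc`, merge with the elements of a stack, from the top on, as long as they are
smaller (in terms of size classes) than the bound `b`. Returns the merged top tree and the rest of
the stack. -/
def absorb (o : Bool) (b : ℕ) : TopTree α → List (TopTree α) → TopTree α × List (TopTree α)
  | acc, [] => (acc, [])
  | acc, c :: S => if c.pw < b then absorb o b (merge o acc c) S else (acc, c :: S)

/-- Merge `x` with the elements on the top of a stack as long as the size class of the top element
does not exceed that of the merged top tree, and put the result on the stack. -/
def carry (o : Bool) : TopTree α → List (TopTree α) → List (TopTree α)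
  | x, [] => [x]
  | x, c :: S => if c.pw ≤ x.pw then carry o (merge o x c) S else x :: c :: S

/-- Put `x` on a stack whose size classes increase strictly from the top to the bottom, and restore
this invariant. The elements of smaller class than `x` are merged with each other before they are
merged with `x`, so that `x` becomes deeper by one level only. -/
def push (o : Bool) (x : TopTree α) : List (TopTree α) → List (TopTree α)
  | [] => [x]
  | c :: S =>
    if c.pw < x.pw then carry o (merge o x (absorb o x.pw c S).1) (absorb o x.pw c S).2
    else carry o x (c :: S)

/-- Merge all elements of a nonempty stack, given by its top and the rest, from the top on. -/
def collapse (o : Bool) : TopTree α → List (TopTree α) → TopTree α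
  | acc, [] => acc
  | acc, c :: S => collapse o (merge o acc c) S

/-- The size classes increase strictly from the top to the bottom. -/
def Sorted (S : List (TopTree α)) : Prop := S.Pairwise fun x y => x.cls < y.cls

/-- The total size of the elements of a stack. -/
def total (S : List (TopTree α)) : ℕ := (S.map size).sum

@[simp] theorem total_nil : total ([] : List (TopTree α)) = 0 := rfl
@[simp] theorem total_cons (x : TopTree α) (S) : total (x :: S) = x.size + total S := rfl

theorem total_append (S R : List (TopTree α)) : total (S ++ R) = total S + total R := by
  simp [total]

theorem size_pos (x : TopTree α) : 0 < x.size := by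
  induction x <;> simp_all [size]

@[simp] theorem size_merge (o : Bool) (x y : TopTree α) :
    (merge o x y).size = x.size + y.size := by
  cases o <;> rfl

theorem height_merge (o : Bool) (x y : TopTree α) :
    (merge o x y).height = max x.height y.height + 1 := by
  cases o <;> rfl

theorem height_lt_size (x : TopTree α) : x.height < x.size := by
  induction x with
  | leaf => simp [height, size]
  | vert x y hx hy | horiz x y hx hy =>
    have := x.size_pos; have := y.size_pos
    simp only [height, size]; omega

theorem subtrees_merge (o : Bool) (x y : TopTree α) :
    (merge o x y).subtrees = merge o x y :: (x.subtrees ++ y.subtrees) := by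
  cases o <;> rfl

theorem self_mem_subtrees (x : TopTree α) : x ∈ x.subtrees := by
  cases x <;> simp [subtrees]

theorem length_subtrees (x : TopTree α) : x.subtrees.length + 1 = 2 * x.size := by
  induction x with
  | leaf => simp [subtrees, size]
  | vert x y hx hy | horiz x y hx hy =>
    simp only [subtrees, size, List.length_cons, List.length_append]; omega

theorem pw_le_size (x : TopTree α) : x.pw ≤ x.size :=
  Nat.pow_log_le_self 2 x.size_pos.ne'

theorem size_lt (x : TopTree α) : x.size < 2 ^ (x.cls + 1) :=
  Nat.lt_pow_succ_log_self (by norm_num) _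

theorem pow_cls_le (x : TopTree α) : 2 ^ x.cls ≤ x.size := x.pw_le_size

theorem le_cls_iff (x : TopTree α) (k : ℕ) : k ≤ x.cls ↔ 2 ^ k ≤ x.size :=
  Nat.le_log_iff_pow_le (by norm_num) x.size_pos.ne'

theorem pw_lt_pw {x y : TopTree α} : x.pw < y.pw ↔ x.cls < y.cls :=
  Nat.pow_lt_pow_iff_right (by norm_num)

theorem pw_le_pw {x y : TopTree α} : x.pw ≤ y.pw ↔ x.cls ≤ y.cls :=
  Nat.pow_le_pow_iff_right (by norm_num)

theorem cls_le_merge_left (o : Bool) (x y : TopTree α) : x.cls ≤ (merge o x y).cls :=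
  Nat.log_mono_right (by simp)

theorem cls_le_merge_right (o : Bool) (x y : TopTree α) : y.cls ≤ (merge o x y).cls :=
  Nat.log_mono_right (by simp)

theorem cls_lt_merge {o : Bool} {x y : TopTree α} {g : ℕ} (hx : g ≤ x.cls) (hy : g ≤ y.cls) :
    g + 1 ≤ (merge o x y).cls := by
  rw [le_cls_iff] at *
  rw [size_merge, pow_succ]; omega

theorem pw_merge (o : Bool) (x y : TopTree α) :
    (merge o x y).pw = if x.size + y.size < 2 * max x.pw y.pw then max x.pw y.pw
      else 2 * max x.pw y.pw := by
  have hx := x.size_lt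
  have hy := y.size_lt
  have hx' := x.pow_cls_le
  have hy' := y.pow_cls_le
  have hm : max x.pw y.pw = 2 ^ max x.cls y.cls := by
    rcases le_total x.cls y.cls with h | h
    · rw [max_eq_right h, max_eq_right (pw_le_pw.2 h), pw]
    · rw [max_eq_left h, max_eq_left (pw_le_pw.2 h), pw]
  have h1 : x.size < 2 ^ (max x.cls y.cls + 1) :=
    hx.trans_le (Nat.pow_le_pow_right (by norm_num) (by omega))
  have h2 : y.size < 2 ^ (max x.cls y.cls + 1) :=
    hy.trans_le (Nat.pow_le_pow_right (by norm_num) (by omega))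
  have h3 : 2 ^ max x.cls y.cls ≤ x.size + y.size := by
    rcases le_total x.cls y.cls with h | h
    · rw [max_eq_right h]; omega
    · rw [max_eq_left h]; omega
  rw [hm, pw]
  split_ifs with h
  · congr 1
    exact (Nat.log_eq_iff (Or.inr ⟨by norm_num, by rw [size_merge]; have := x.size_pos; omega⟩)).2
      ⟨by rwa [size_merge], by rw [size_merge, pow_succ]; omega⟩
  · rw [mul_comm, ← pow_succ]
    congr 1
    refine (Nat.log_eq_iff (Or.inl (by omega))).2 ⟨?_, ?_⟩
    · rw [size_merge, pow_succ]; omega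
    · rw [size_merge, pow_succ]; omega

/-! ### Invariants of the stack operations -/

theorem absorb_total (o : Bool) (b : ℕ) (acc : TopTree α) (S : List (TopTree α)) :
    (absorb o b acc S).1.size + total (absorb o b acc S).2 = acc.size + total S := by
  induction S generalizing acc with
  | nil => simp [absorb]
  | cons c S ih =>
    rw [absorb]; split_ifs
    · rw [ih]; simp [add_assoc]
    · simp

theorem carry_total (o : Bool) (x : TopTree α) (S : List (TopTree α)) :
    total (carry o x S) = x.size + total S := by
  induction S generalizing x with
  | nil => simp [carry]
  | cons c S ih =>
    rw [carry]; split_ifs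
    · rw [ih]; simp [add_assoc]
    · simp

theorem push_total (o : Bool) (x : TopTree α) (S : List (TopTree α)) :
    total (push o x S) = x.size + total S := by
  cases S with
  | nil => simp [push]
  | cons c S =>
    rw [push]; split_ifs
    · rw [carry_total, size_merge, add_assoc, absorb_total, total_cons]
    · rw [carry_total]

theorem collapse_size (o : Bool) (x : TopTree α) (S : List (TopTree α)) :
    (collapse o x S).size = x.size + total S := by
  induction S generalizing x with
  | nil => simp [collapse]
  | cons c S ih => rw [collapse, ih]; simp [add_assoc]

/-- Collapsing a stack is absorbing with a bound that exceeds everything on the stack. -/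
theorem absorb_eq_collapse {o : Bool} {b : ℕ} {x : TopTree α} {S : List (TopTree α)}
    (h : ∀ c ∈ S, c.pw < b) : absorb o b x S = (collapse o x S, []) := by
  induction S generalizing x with
  | nil => rfl
  | cons c S ih =>
    rw [absorb, if_pos (h c (by simp)), ih (fun d hd => h d (by simp [hd]))]; rfl

theorem exists_bound (S : List (TopTree α)) : ∃ k, ∀ c ∈ S, c.pw < 2 ^ k :=
  ⟨total S, fun c hc => c.pw_le_size.trans_lt
    ((List.single_le_sum (by simp) _ (List.mem_map_of_mem hc)).trans_lt Nat.lt_two_pow_self)⟩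

theorem absorb_suffix (o : Bool) (b : ℕ) (acc : TopTree α) (S : List (TopTree α)) :
    (absorb o b acc S).2 <:+ S := by
  induction S generalizing acc with
  | nil => simp [absorb]
  | cons c S ih =>
    rw [absorb]; split_ifs
    · exact (ih _).trans (List.suffix_cons _ _)
    · exact List.suffix_rfl

theorem Sorted.tail {x : TopTree α} {S : List (TopTree α)} (h : Sorted (x :: S)) : Sorted S :=
  List.Pairwise.of_cons h

theorem Sorted.of_suffix {S S' : List (TopTree α)} (h : Sorted S) (hs : S' <:+ S) : Sorted S' :=
  h.sublist hs.sublist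

/-- What absorbing leaves on a sorted stack is at least as large as the bound. -/
theorem Sorted.absorb_ge {o : Bool} {b : ℕ} {acc : TopTree α} {S : List (TopTree α)}
    (h : Sorted S) : ∀ c ∈ (absorb o b acc S).2, b ≤ c.pw := by
  induction S generalizing acc with
  | nil => simp [absorb]
  | cons d S ih =>
    rw [absorb]; split_ifs with hd
    · exact ih h.tail
    · intro c hc
      rcases List.mem_cons.1 hc with rfl | hc
      · omega
      · have := pw_lt_pw.2 (List.rel_of_pairwise_cons h hc); omega

theorem Sorted.carry {o : Bool} {x : TopTree α} {S : List (TopTree α)} (h : Sorted S) :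
    Sorted (carry o x S) := by
  induction S generalizing x with
  | nil => simp [TopTree.carry, Sorted]
  | cons c S ih =>
    rw [TopTree.carry]; split_ifs with hc
    · exact ih h.tail
    · refine List.pairwise_cons.2 ⟨fun d hd => ?_, h⟩
      have h1 : x.cls < c.cls := pw_lt_pw.1 (not_le.1 hc)
      rcases List.mem_cons.1 hd with rfl | hd
      · exact h1
      · exact h1.trans (List.rel_of_pairwise_cons h hd)

theorem Sorted.push {o : Bool} {x : TopTree α} {S : List (TopTree α)} (h : Sorted S) :
    Sorted (push o x S) := by
  cases S with
  | nil => simp [TopTree.push, Sorted]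
  | cons c S =>
    rw [TopTree.push]; split_ifs
    · exact (h.tail.of_suffix (absorb_suffix _ _ _ _)).carry
    · exact h.carry

theorem carry_ne_nil (o : Bool) (x : TopTree α) (S : List (TopTree α)) : carry o x S ≠ [] := by
  induction S generalizing x with
  | nil => simp [carry]
  | cons c S ih => rw [carry]; split_ifs <;> simp_all

theorem push_ne_nil (o : Bool) (x : TopTree α) (S : List (TopTree α)) : push o x S ≠ [] := by
  cases S with
  | nil => simp [push]
  | cons c S => rw [push]; split_ifs <;> exact carry_ne_nil _ _ _

/-- A sorted stack has at most logarithmically many elements. -/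
theorem Sorted.length_le {S : List (TopTree α)} (h : Sorted S) :
    S.length ≤ Nat.log 2 (total S) + 1 := by
  suffices H : ∀ (S : List (TopTree α)) (k : ℕ), Sorted S → (∀ c ∈ S, k ≤ c.cls) → S ≠ [] →
      2 ^ (k + S.length - 1) ≤ total S by
    rcases eq_or_ne S [] with rfl | hS
    · simp
    · have h1 := H S 0 h (by simp) hS
      have := Nat.le_log_of_pow_le (by norm_num) h1
      omega
  intro S
  induction S with
  | nil => simp
  | cons c S ih =>
    intro k h hk _
    rcases eq_or_ne S [] with rfl | hS
    · have := (le_cls_iff c k).1 (hk c (by simp))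
      simpa using this
    · have h1 := ih (k + 1) h.tail (fun d hd =>
        (hk c (by simp)).trans_lt (List.rel_of_pairwise_cons h hd)) hS
      rw [total_cons, List.length_cons]
      rw [show k + (S.length + 1) - 1 = k + 1 + S.length - 1 by omega]
      omega

/-! ### Sharing: subtrees created by the stack operations -/

/-- The set `N` contains all subtrees of elements of `out` that are not subtrees of elements
of `ins`. -/
def Covers (N : Finset (TopTree α)) (ins out : List (TopTree α)) : Prop :=
  ∀ c ∈ out, ∀ X ∈ c.subtrees, X ∈ N ∨ ∃ d ∈ ins, X ∈ d.subtrees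

/-- All subtrees of elements of `ins` are subtrees of elements of `out`. -/
def Keeps (ins out : List (TopTree α)) : Prop :=
  ∀ c ∈ ins, ∀ X ∈ c.subtrees, ∃ d ∈ out, X ∈ d.subtrees

theorem Keeps.refl (S : List (TopTree α)) : Keeps S S := fun c hc _ hX => ⟨c, hc, hX⟩

theorem Keeps.of_subset {S S' : List (TopTree α)} (h : S ⊆ S') : Keeps S S' :=
  fun c hc _ hX => ⟨c, h hc, hX⟩

theorem Keeps.trans {S S' S'' : List (TopTree α)} (h : Keeps S S') (h' : Keeps S' S'') :
    Keeps S S'' := fun c hc X hX =>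
  let ⟨d, hd, hXd⟩ := h c hc X hX
  h' d hd X hXd

theorem Keeps.append {S S' R R' : List (TopTree α)} (h : Keeps S S') (h' : Keeps R R') :
    Keeps (S ++ R) (S' ++ R') := fun c hc X hX => by
  rcases List.mem_append.1 hc with hc | hc
  · obtain ⟨d, hd, hX⟩ := h c hc X hX; exact ⟨d, by simp [hd], hX⟩
  · obtain ⟨d, hd, hX⟩ := h' c hc X hX; exact ⟨d, by simp [hd], hX⟩

theorem keeps_merge (o : Bool) (x y : TopTree α) (S : List (TopTree α)) :
    Keeps (x :: y :: S) (merge o x y :: S) := by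
  intro c hc X hX
  simp only [List.mem_cons] at hc
  rcases hc with rfl | rfl | hc
  · exact ⟨_, List.mem_cons_self, by rw [subtrees_merge]; simp [hX]⟩
  · exact ⟨_, List.mem_cons_self, by rw [subtrees_merge]; simp [hX]⟩
  · exact ⟨c, by simp [hc], hX⟩

theorem keeps_absorb (o : Bool) (b : ℕ) (x : TopTree α) (S : List (TopTree α)) :
    Keeps (x :: S) ((absorb o b x S).1 :: (absorb o b x S).2) := by
  induction S generalizing x with
  | nil => exact Keeps.refl _
  | cons c S ih =>
    rw [absorb]; split_ifs
    · exact (keeps_merge o x c S).trans (ih _)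
    · exact Keeps.refl _

theorem keeps_carry (o : Bool) (x : TopTree α) (S : List (TopTree α)) :
    Keeps (x :: S) (carry o x S) := by
  induction S generalizing x with
  | nil => exact Keeps.refl _
  | cons c S ih =>
    rw [carry]; split_ifs
    · exact (keeps_merge o x c S).trans (ih _)
    · exact Keeps.refl _

theorem keeps_push (o : Bool) (x : TopTree α) (S : List (TopTree α)) :
    Keeps (x :: S) (push o x S) := by
  cases S with
  | nil => exact Keeps.refl _
  | cons c S =>
    rw [push]; split_ifs
    · exact (((Keeps.refl [x]).append (keeps_absorb o x.pw c S)).trans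
        (keeps_merge o x _ _)).trans (keeps_carry _ _ _)
    · exact keeps_carry _ _ _

theorem keeps_collapse (o : Bool) (x : TopTree α) (S : List (TopTree α)) :
    Keeps (x :: S) [collapse o x S] := by
  induction S generalizing x with
  | nil => exact Keeps.refl _
  | cons c S ih => exact (keeps_merge o x c S).trans (ih _)

open Classical in
theorem Covers.trans {N N' : Finset (TopTree α)} {S S' S'' : List (TopTree α)}
    (h : Covers N S S') (h' : Covers N' S' S'') : Covers (N ∪ N') S S'' := by
  intro c hc X hX
  rcases h' c hc X hX with h1 | ⟨d, hd, h1⟩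
  · simp [h1]
  · rcases h d hd X h1 with h2 | h2
    · simp [h2]
    · exact Or.inr h2

open Classical in
theorem Covers.append {N N' : Finset (TopTree α)} {S S' R R' : List (TopTree α)}
    (h : Covers N S S') (h' : Covers N' R R') : Covers (N ∪ N') (S ++ R) (S' ++ R') := by
  intro c hc X hX
  rcases List.mem_append.1 hc with hc | hc
  · rcases h c hc X hX with h1 | ⟨d, hd, h1⟩
    · simp [h1]
    · exact Or.inr ⟨d, by simp [hd], h1⟩
  · rcases h' c hc X hX with h1 | ⟨d, hd, h1⟩
    · simp [h1]
    · exact Or.inr ⟨d, by simp [hd], h1⟩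

theorem Covers.refl (S : List (TopTree α)) : Covers ∅ S S := fun c hc _ hX => Or.inr ⟨c, hc, hX⟩

/-- The top trees in `out` arise from those in `ins` by at most `k` steps, each of which creates
one new node. -/
def Creates (k : ℕ) (ins out : List (TopTree α)) : Prop :=
  ∃ N : Finset (TopTree α), N.card ≤ k ∧ Covers N ins out

theorem Creates.refl (S : List (TopTree α)) : Creates 0 S S := ⟨∅, by simp, Covers.refl S⟩

theorem Creates.mono {k l : ℕ} {S S' : List (TopTree α)} (h : Creates k S S') (hkl : k ≤ l) :
    Creates l S S' := h.imp fun _ hN => ⟨hN.1.trans hkl, hN.2⟩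

theorem Creates.trans {k l : ℕ} {S S' S'' : List (TopTree α)} (h : Creates k S S')
    (h' : Creates l S' S'') : Creates (k + l) S S'' := by
  classical
  obtain ⟨N, hN, hc⟩ := h
  obtain ⟨N', hN', hc'⟩ := h'
  exact ⟨N ∪ N', (Finset.card_union_le _ _).trans (by omega), hc.trans hc'⟩

theorem Creates.append {k l : ℕ} {S S' R R' : List (TopTree α)} (h : Creates k S S')
    (h' : Creates l R R') : Creates (k + l) (S ++ R) (S' ++ R') := by
  classical
  obtain ⟨N, hN, hc⟩ := h
  obtain ⟨N', hN', hc'⟩ := h'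
  exact ⟨N ∪ N', (Finset.card_union_le _ _).trans (by omega), hc.append hc'⟩

theorem creates_merge (o : Bool) (x y : TopTree α) : Creates 1 [x, y] [merge o x y] := by
  refine ⟨{merge o x y}, by simp, ?_⟩
  intro c hc X hX
  rw [List.mem_singleton.1 hc, subtrees_merge] at hX
  simp only [List.mem_cons, List.mem_append] at hX
  rcases hX with rfl | hX | hX
  · simp
  · exact Or.inr ⟨x, by simp, hX⟩
  · exact Or.inr ⟨y, by simp, hX⟩

theorem creates_leaf (a b : α) (r : Bool) : Creates 1 [] [leaf a b r] :=
  ⟨{leaf a b r}, by simp, by intro c hc X hX; simp_all [subtrees]⟩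

/-- Each merge lowers the number of top trees by one and creates one node. -/
theorem creates_absorb (o : Bool) (b : ℕ) (x : TopTree α) (S : List (TopTree α)) :
    ∃ k, k + (absorb o b x S).2.length = S.length ∧
      Creates k (x :: S) ((absorb o b x S).1 :: (absorb o b x S).2) := by
  induction S generalizing x with
  | nil => exact ⟨0, by simp [absorb], Creates.refl _⟩
  | cons c S ih =>
    rw [absorb]; split_ifs
    · obtain ⟨k, hk, h⟩ := ih (merge o x c)
      exact ⟨1 + k, by simp; omega, ((creates_merge o x c).append (Creates.refl S)).trans h⟩
    · exact ⟨0, by simp, Creates.refl _⟩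

theorem creates_carry (o : Bool) (x : TopTree α) (S : List (TopTree α)) :
    ∃ k, k + (carry o x S).length = S.length + 1 ∧ Creates k (x :: S) (carry o x S) := by
  induction S generalizing x with
  | nil => exact ⟨0, by simp [carry], Creates.refl _⟩
  | cons c S ih =>
    rw [carry]; split_ifs
    · obtain ⟨k, hk, h⟩ := ih (merge o x c)
      exact ⟨1 + k, by simp; omega, ((creates_merge o x c).append (Creates.refl S)).trans h⟩
    · exact ⟨0, by simp, Creates.refl _⟩

theorem creates_push (o : Bool) (x : TopTree α) (S : List (TopTree α)) :
    ∃ k, k + (push o x S).length = S.length + 1 ∧ Creates k (x :: S) (push o x S) := by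
  cases S with
  | nil => exact ⟨0, by simp [push], Creates.refl _⟩
  | cons c S =>
    rw [push]; split_ifs
    · obtain ⟨k, hk, h⟩ := creates_absorb o x.pw c S
      obtain ⟨l, hl, h'⟩ := creates_carry o (merge o x (absorb o x.pw c S).1)
        (absorb o x.pw c S).2
      exact ⟨0 + k + (1 + 0) + l, by simp; omega, (((Creates.refl [x]).append h).trans
        ((creates_merge o x _).append (Creates.refl _))).trans h'⟩
    · exact creates_carry o x (c :: S)

theorem creates_collapse (o : Bool) (x : TopTree α) (S : List (TopTree α)) :
    Creates S.length (x :: S) [collapse o x S] := by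
  induction S generalizing x with
  | nil => exact Creates.refl _
  | cons c S ih =>
    exact (((creates_merge o x c).append (Creates.refl S)).trans (ih _)).mono (by simp; omega)

theorem creates_foldr_push (o : Bool) (Y : List (TopTree α)) :
    Creates Y.length Y (Y.foldr (push o) []) := by
  suffices H : ∃ k, k + (Y.foldr (push o) []).length = Y.length ∧
      Creates k Y (Y.foldr (push o) []) by
    obtain ⟨k, hk, h⟩ := H
    exact h.mono (by omega)
  induction Y with
  | nil => exact ⟨0, by simp, Creates.refl _⟩
  | cons y Y ih =>
    obtain ⟨k, hk, h⟩ := ih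
    obtain ⟨l, hl, h'⟩ := creates_push o y (Y.foldr (push o) [])
    exact ⟨0 + k + l, by simp; omega, ((Creates.refl [y]).append h).trans h'⟩

/-! ### Balance: heights on stacks -/

/-- Elements of a stack satisfy the height bound `M + 1 + 2 * cls`, where the items that are pushed
satisfy the bound `M + 2 * cls`. -/
def HeightBound (M : ℕ) (S : List (TopTree α)) : Prop := ∀ c ∈ S, c.height ≤ M + 1 + 2 * c.cls

theorem absorb_height {o : Bool} {b M g : ℕ} {x : TopTree α} {S : List (TopTree α)}
    (hS : Sorted S) (hM : HeightBound M S) (hg : ∀ c ∈ S, g < c.cls) (hx : x.height ≤ M + 2 + 2 * g) :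
    ∃ g', (g' = g ∨ 2 ^ g' < b ∧ g < g') ∧ (absorb o b x S).1.height ≤ M + 2 + 2 * g' := by
  induction S generalizing x g with
  | nil => exact ⟨g, Or.inl rfl, hx⟩
  | cons c S ih =>
    rw [absorb]; split_ifs with h
    · have h1 := hM c (by simp)
      have h2 := hg c (by simp)
      obtain ⟨g', hg', h'⟩ := ih (x := merge o x c) (g := c.cls) hS.tail
        (fun d hd => hM d (by simp [hd])) (fun d hd => List.rel_of_pairwise_cons hS hd)
        (by rw [height_merge]; omega)
      refine ⟨g', Or.inr ?_, h'⟩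
      rcases hg' with rfl | hg'
      · exact ⟨h, h2⟩
      · exact ⟨hg'.1, by omega⟩
    · exact ⟨g, Or.inl rfl, hx⟩

theorem carry_height {o : Bool} {M g : ℕ} {x : TopTree α} {S : List (TopTree α)}
    (hS : Sorted S) (hM : HeightBound M S) (hg : ∀ c ∈ S, g ≤ c.cls) (hgx : g ≤ x.cls)
    (hx : x.height ≤ M + 1 + 2 * g) : HeightBound M (carry o x S) := by
  induction S generalizing x g with
  | nil => intro c hc; rw [carry, List.mem_singleton] at hc; subst hc; omega
  | cons c S ih =>
    rw [carry]; split_ifs with h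
    · have h1 := hM c (by simp)
      have h2 := hg c (by simp)
      refine ih (g := c.cls + 1) hS.tail (fun d hd => hM d (by simp [hd]))
        (fun d hd => List.rel_of_pairwise_cons hS hd)
        (cls_lt_merge (pw_le_pw.1 h) le_rfl) (by rw [height_merge]; omega)
    · intro d hd
      rcases List.mem_cons.1 hd with rfl | hd
      · omega
      · exact hM d hd

theorem push_height {o : Bool} {M : ℕ} {x : TopTree α} {S : List (TopTree α)}
    (hS : Sorted S) (hM : HeightBound M S) (hx : x.height ≤ M + 2 * x.cls) :
    HeightBound M (push o x S) := by
  cases S with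
  | nil => intro c hc; rw [push, List.mem_singleton] at hc; subst hc; omega
  | cons c S =>
    have hM' : HeightBound M S := fun d hd => hM d (by simp [hd])
    rw [push]; split_ifs with h
    · obtain ⟨g', hg', h'⟩ := absorb_height (o := o) (b := x.pw) (g := c.cls) (x := c)
        hS.tail hM' (fun d hd => List.rel_of_pairwise_cons hS hd)
        (by have := hM c (by simp); omega)
      have hlt : g' < x.cls := by
        rcases hg' with rfl | hg'
        · exact pw_lt_pw.1 h
        · exact (Nat.pow_lt_pow_iff_right (by norm_num)).1 hg'.1
      have hsuf := absorb_suffix o x.pw c S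
      refine carry_height (g := x.cls) (hS.tail.of_suffix hsuf)
        (fun d hd => hM' d (hsuf.subset hd))
        (fun d hd => pw_le_pw.1 (hS.tail.absorb_ge d hd)) (cls_le_merge_left _ _ _)
        (by rw [height_merge]; omega)
    · refine carry_height (g := x.cls) hS hM ?_ le_rfl (by omega)
      intro d hd
      have h1 : x.cls ≤ c.cls := pw_le_pw.1 (not_lt.1 h)
      rcases List.mem_cons.1 hd with rfl | hd
      · exact h1
      · exact h1.trans (List.rel_of_pairwise_cons hS hd).le

theorem collapse_height {o : Bool} {M : ℕ} {x : TopTree α} {S : List (TopTree α)}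
    (hS : Sorted (x :: S)) (hM : HeightBound M (x :: S)) :
    (collapse o x S).height ≤ M + 2 + 2 * (collapse o x S).cls := by
  suffices H : ∀ (S : List (TopTree α)) (x : TopTree α) (g : ℕ), Sorted S → HeightBound M S →
      (∀ c ∈ S, g < c.cls) → g ≤ x.cls → x.height ≤ M + 2 + 2 * g →
      (collapse o x S).height ≤ M + 2 + 2 * (collapse o x S).cls from
    H S x x.cls hS.tail (fun d hd => hM d (by simp [hd]))
      (fun d hd => List.rel_of_pairwise_cons hS hd) le_rfl
      (by have := hM x (by simp); omega)
  intro S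
  induction S with
  | nil => intro x g _ _ _ h1 h2; rw [collapse]; omega
  | cons c S ih =>
    intro x g hS hM hg h1 h2
    have h3 := hM c (by simp)
    have h4 := hg c (by simp)
    exact ih (merge o x c) c.cls hS.tail (fun d hd => hM d (by simp [hd]))
      (fun d hd => List.rel_of_pairwise_cons hS hd) (cls_le_merge_right _ _ _)
      (by rw [height_merge]; omega)

theorem HeightBound.mono {M M' : ℕ} {S : List (TopTree α)} (h : HeightBound M S) (hM : M ≤ M') :
    HeightBound M' S := fun c hc => (h c hc).trans (by omega)

theorem sorted_foldr_push (o : Bool) (Y : List (TopTree α)) : Sorted (Y.foldr (push o) []) := by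
  induction Y with
  | nil => simp [Sorted]
  | cons y Y ih => exact ih.push

theorem heightBound_foldr_push {o : Bool} {M : ℕ} {Y : List (TopTree α)}
    (h : ∀ y ∈ Y, y.height ≤ M + 2 * y.cls) : HeightBound M (Y.foldr (push o) []) := by
  induction Y with
  | nil => simp [HeightBound]
  | cons y Y ih =>
    exact push_height (sorted_foldr_push o Y) (ih fun z hz => h z (by simp [hz])) (h y (by simp))

theorem total_foldr_push (o : Bool) (Y : List (TopTree α)) :
    total (Y.foldr (push o) []) = total Y := by
  induction Y with
  | nil => rfl
  | cons y Y ih => rw [List.foldr_cons, push_total, ih, total_cons]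

end TopTree

/-! ### The clusters that stacks stand for -/

namespace Cluster1

variable {α : Type}

theorem comp_assoc (c d e : Cluster1 α) : (c.comp d).comp e = c.comp (d.comp e) := by
  induction c with
  | bottom => rfl
  | node a l c r ih => simp [comp, ih]

theorem fill_comp (c d : Cluster1 α) (t : LTree α) : (c.comp d).fill t = c.fill (d.fill t) := by
  induction c with
  | bottom => rfl
  | node a l c r ih => simp [comp, fill, ih]

theorem bottomLabel_comp (c d : Cluster1 α) : (c.comp d).bottomLabel = d.bottomLabel := by
  induction c with
  | bottom => rfl
  | node a l c r ih => simpa [comp, bottomLabel] using ih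

theorem topLabel_comp (c d : Cluster1 α) (h : c.bottomLabel = d.topLabel) :
    (c.comp d).topLabel = c.topLabel := by
  cases c with
  | bottom => exact h.symm
  | node a l c r => rfl

theorem label_fill (c : Cluster1 α) (t : LTree α) (h : c.bottomLabel = t.label) :
    (c.fill t).label = c.topLabel := by
  cases c with
  | bottom => exact h.symm
  | node a l c r => rfl

end Cluster1

namespace TopTree

variable {α : Type} [DecidableEq α]

/-- The merge of two possibly undefined clusters: vertical for `true`, horizontal for `false`. -/
def comb (o : Bool) (c d : Option (Cluster α)) : Option (Cluster α) :=
  c.bind fun c => d.bind fun d => if o then c.vmerge d else c.hmerge d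

theorem eval_merge (o : Bool) (x y : TopTree α) :
    (merge o x y).eval = comb o x.eval y.eval := by
  cases o <;> rfl

theorem comb_assoc (o : Bool) (c d e : Option (Cluster α)) :
    comb o (comb o c d) e = comb o c (comb o d e) := by
  rcases c with _ | c
  · rfl
  rcases d with _ | d
  · rfl
  rcases e with _ | e
  · simp [comb]
  cases o with
  | true =>
    rcases c with t | c <;> rcases d with u | d
    · simp [comb, Cluster.vmerge]
    · rcases e with v | e <;> simp only [comb, Cluster.vmerge, Option.bind_some, if_true] <;>
        split_ifs <;> simp
    · simp only [comb, Cluster.vmerge, Option.bind_some, if_true]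
      split_ifs <;> simp
    · rcases e with v | e
      · simp only [comb, Cluster.vmerge, Option.bind_some, if_true]
        by_cases h1 : c.bottomLabel = d.topLabel <;> by_cases h2 : d.bottomLabel = v.label <;>
          simp [h1, h2, Cluster1.fill_comp, Cluster1.bottomLabel_comp,
            Cluster1.label_fill]
      · simp only [comb, Cluster.vmerge, Option.bind_some, if_true]
        by_cases h1 : c.bottomLabel = d.topLabel <;> by_cases h2 : d.bottomLabel = e.topLabel <;>
          simp [h1, h2, Cluster1.comp_assoc, Cluster1.bottomLabel_comp,
            Cluster1.topLabel_comp]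
  | false =>
    rcases c with ⟨⟨a, xs⟩⟩ | ⟨a⟩ | ⟨a, l, c, r⟩ <;> rcases d with ⟨⟨b, ys⟩⟩ | ⟨b⟩ | ⟨b, l', d, r'⟩ <;>
      rcases e with ⟨⟨f, zs⟩⟩ | ⟨f⟩ | ⟨f, l'', e, r''⟩ <;>
      simp only [comb, Cluster.hmerge, Option.bind_some, Bool.false_eq_true, if_false,
        Option.bind_none] <;>
      (by_cases h1 : a = b <;> by_cases h2 : b = f <;> simp_all)

/-- The cluster that a stack stands for: the merge of the clusters of its elements, from the top to
the bottom. -/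
def den (o : Bool) : List (TopTree α) → Option (Cluster α)
  | [] => none
  | [x] => x.eval
  | x :: y :: S => comb o x.eval (den o (y :: S))

theorem den_cons (o : Bool) (x : TopTree α) {S : List (TopTree α)} (h : S ≠ []) :
    den o (x :: S) = comb o x.eval (den o S) := by
  cases S with
  | nil => exact absurd rfl h
  | cons => rfl

theorem den_merge (o : Bool) (x y : TopTree α) (S : List (TopTree α)) :
    den o (merge o x y :: S) = den o (x :: y :: S) := by
  cases S with
  | nil => simp [den, eval_merge]
  | cons c S => simp [den, eval_merge, comb_assoc]

theorem den_absorb (o : Bool) (b : ℕ) (x : TopTree α) (S : List (TopTree α)) :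
    den o ((absorb o b x S).1 :: (absorb o b x S).2) = den o (x :: S) := by
  induction S generalizing x with
  | nil => rfl
  | cons c S ih =>
    rw [absorb]; split_ifs
    · rw [ih, den_merge]
    · rfl

theorem den_carry (o : Bool) (x : TopTree α) (S : List (TopTree α)) :
    den o (carry o x S) = den o (x :: S) := by
  induction S generalizing x with
  | nil => rfl
  | cons c S ih =>
    rw [carry]; split_ifs
    · rw [ih, den_merge]
    · rfl

theorem den_push (o : Bool) (x : TopTree α) (S : List (TopTree α)) :
    den o (push o x S) = den o (x :: S) := by
  cases S with
  | nil => rfl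
  | cons c S =>
    rw [push]; split_ifs
    · rw [den_carry, den_merge, den_cons _ _ (List.cons_ne_nil _ _), den_absorb,
        den_cons _ _ (List.cons_ne_nil _ _)]
    · rw [den_carry]

theorem eval_collapse (o : Bool) (x : TopTree α) (S : List (TopTree α)) :
    (collapse o x S).eval = den o (x :: S) := by
  induction S generalizing x with
  | nil => rfl
  | cons c S ih => rw [collapse, ih, den_merge]

theorem den_foldr_push (o : Bool) (Y : List (TopTree α)) :
    den o (Y.foldr (push o) []) = den o Y := by
  induction Y with
  | nil => rfl
  | cons y Y ih =>
    rw [List.foldr_cons, den_push]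
    rcases eq_or_ne Y [] with rfl | hY
    · rfl
    · rw [den_cons _ _ hY, den_cons, ih]
      cases Y with
      | nil => exact absurd rfl hY
      | cons => exact push_ne_nil _ _ _

end TopTree

/-! ### The construction -/

/-- What the construction keeps of a subtree that it has processed. -/
structure Entry (α : Type) : Type where
  /-- the label of the root -/
  label : α
  /-- the number of edges -/
  size : ℕ
  /-- clusters whose vertical merge is the subtree, from the root to the bottom of its heavy path;
  empty for a single node -/
  stack : List (TopTree α)

namespace Entry

variable {α : Type}

open TopTree

/-- The item of a light child below an `a`-labelled node: the cluster of rank zero that consists of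
the edge to the child and the subtree of the child. -/
def light (a : α) (e : Entry α) : TopTree α :=
  match e.stack with
  | [] => .leaf a e.label false
  | c :: S => .vert (.leaf a e.label true) (collapse true c S)

/-- The item of the heavy child below an `a`-labelled node: just the edge to the child. It has
rank one unless the child is a leaf. -/
def heavy (a : α) (e : Entry α) : TopTree α := .leaf a e.label (!e.stack.isEmpty)

/-- The heavy child: the increased size, the position and the stack of a child of maximal size. The
position is counted from the last child on, which has the number zero. For an empty list, the
size is zero and the stack is empty. -/
def heaviest : List (Entry α) → ℕ × ℕ × List (TopTree α)
  | [] => (0, 0, [])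
  | e :: es =>
    if (heaviest es).1 < e.size + 1 then (e.size + 1, es.length, e.stack) else heaviest es

/-- The items of the children of an `a`-labelled node, where the heavy child is the one with the
position `h`, counted from the last child on. -/
def items (a : α) (h : ℕ) : List (Entry α) → List (TopTree α)
  | [] => []
  | e :: es => (if es.length = h then heavy a e else light a e) :: items a h es

/-- The stack of a node: if there are children, their items are merged horizontally, and the result
is pushed on the stack of the heavy child. -/
def nodeStack (a : α) (es : List (Entry α)) : List (TopTree α) :=
  match (items a (heaviest es).2.1 es).foldr (push false) [] with
  | [] => []
  | c :: S => push true (collapse false c S) (heaviest es).2.2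

/-- The entry of an `a`-labelled node, given the entries of its children. -/
def node (a : α) (es : List (Entry α)) : Entry α :=
  ⟨a, (es.map fun e => e.size + 1).sum, nodeStack a es⟩

theorem items_of_length_le {a : α} {h : ℕ} {es : List (Entry α)} (hh : es.length ≤ h) :
    items a h es = es.map (light a) := by
  induction es with
  | nil => rfl
  | cons e es ih =>
    rw [List.length_cons] at hh
    rw [items, if_neg (by omega), ih (by omega)]; rfl

theorem heaviest_spec (a : α) {es : List (Entry α)} (hes : es ≠ []) :
    ∃ l e r, es = l ++ e :: r ∧ (heaviest es).2.2 = e.stack ∧ (heaviest es).1 = e.size + 1 ∧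
      (heaviest es).2.1 = r.length ∧ (∀ f ∈ l ++ r, f.size ≤ e.size) ∧
      items a (heaviest es).2.1 es = l.map (light a) ++ heavy a e :: r.map (light a) := by
  induction es with
  | nil => exact absurd rfl hes
  | cons d es ih =>
    rcases eq_or_ne es [] with rfl | hes
    · exact ⟨[], d, [], rfl, by simp [heaviest], by simp [heaviest], by simp [heaviest], by simp,
        by simp [heaviest, items]⟩
    obtain ⟨l, e, r, h1, h2, h3, h4, h5, h6⟩ := ih hes
    rw [heaviest]
    split_ifs with h
    · refine ⟨[], d, es, rfl, rfl, rfl, rfl, ?_, ?_⟩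
      · intro f hf
        have : f.size ≤ e.size := by
          rw [List.nil_append, h1] at hf
          simp only [List.mem_append, List.mem_cons] at hf
          rcases hf with hf | rfl | hf
          · exact h5 f (by simp [hf])
          · exact le_rfl
          · exact h5 f (by simp [hf])
        omega
      · simp [items, items_of_length_le]
    · refine ⟨d :: l, e, r, by simp [h1], h2, h3, h4, ?_, ?_⟩
      · intro f hf
        simp only [List.cons_append, List.mem_cons] at hf
        rcases hf with rfl | hf
        · omega
        · exact h5 f hf
      · rw [items, if_neg, h6]
        · simp
        · rw [h4, h1]; simp; omega

/-- The stack of a node with children, in terms of the heavy child `e` and of the light children to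
its left and right. -/
theorem nodeStack_spec (a : α) {es : List (Entry α)} (hes : es ≠ []) :
    ∃ l e r c S, es = l ++ e :: r ∧ (∀ f ∈ l ++ r, f.size ≤ e.size) ∧
      (l.map (light a) ++ heavy a e :: r.map (light a)).foldr (push false) [] = c :: S ∧
      nodeStack a es = push true (collapse false c S) e.stack := by
  obtain ⟨l, e, r, h1, h2, -, -, h5, h6⟩ := heaviest_spec a hes
  obtain ⟨c, S, hcS⟩ : ∃ c S, (items a (heaviest es).2.1 es).foldr (push false) [] = c :: S := by
    cases es with
    | nil => exact absurd rfl hes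
    | cons d es => exact List.exists_cons_of_ne_nil (push_ne_nil _ _ _)
  refine ⟨l, e, r, c, S, h1, h5, by rw [← h6, hcS], ?_⟩
  rw [nodeStack, hcS, h2]

end Entry

namespace LTree

variable {α : Type}

/-- The entry that the construction computes for a tree. -/
def entry : LTree α → Entry α
  | node a ts => Entry.node a (ts.map fun t => t.entry)

theorem entry_node (a : α) (ts : List (LTree α)) :
    (node a ts).entry = Entry.node a (ts.map entry) := by
  rw [entry]

@[simp] theorem entry_label (t : LTree α) : t.entry.label = t.label := by
  cases t with
  | node a ts => rw [entry_node]; rfl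

@[simp] theorem entry_size (t : LTree α) : t.entry.size = t.numEdges := by
  induction t using induct with
  | h a ts ih =>
    rw [entry_node, numEdges_node]
    change ((ts.map entry).map fun e => e.size + 1).sum = _
    rw [List.map_map]
    congr 1
    exact List.map_congr_left fun t ht => by rw [Function.comp_apply, ih t ht]

theorem entry_nil (a : α) : (node a []).entry = ⟨a, 0, []⟩ := by
  rw [entry_node]; rfl

/-- The decomposition of a tree with at least one edge at its root, and its entry in terms of the
entries of the subtrees. -/
theorem entry_stack_spec (a : α) {ts : List (LTree α)} (h : ts ≠ []) :
    ∃ l u r c S, ts = l ++ u :: r ∧ (∀ v ∈ l ++ r, v.numEdges ≤ u.numEdges) ∧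
      (l.map (fun v => v.entry.light a) ++ u.entry.heavy a ::
        r.map (fun v => v.entry.light a)).foldr (TopTree.push false) [] = c :: S ∧
      (node a ts).entry.stack = TopTree.push true (TopTree.collapse false c S) u.entry.stack := by
  obtain ⟨l, e, r, c, S, h1, h2, h3, h4⟩ :=
    Entry.nodeStack_spec a (es := ts.map entry) (by simpa using h)
  obtain ⟨l', m, rfl, rfl, hm⟩ := List.map_eq_append_iff.1 h1
  obtain ⟨u, r', rfl, rfl, rfl⟩ := List.map_eq_cons_iff.1 hm
  refine ⟨l', u, r', c, S, rfl, ?_, by simpa [Function.comp_def] using h3, by rw [entry_node]; exact h4⟩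
  intro v hv
  have := h2 v.entry (by rw [← List.map_append]; exact List.mem_map_of_mem hv)
  simpa using this

theorem entry_sorted (t : LTree α) : TopTree.Sorted t.entry.stack := by
  induction t using induct with
  | h a ts ih =>
    rcases eq_or_ne ts [] with rfl | hts
    · rw [entry_nil]; simp [TopTree.Sorted]
    · obtain ⟨l, u, r, c, S, rfl, -, -, h⟩ := entry_stack_spec a hts
      rw [h]
      exact (ih u (by simp)).push

end LTree

namespace Entry

variable {α : Type}

theorem size_light (a : α) (e : Entry α) :
    (e.light a).size = TopTree.total e.stack + 1 := by
  rcases e with ⟨b, n, _ | ⟨c, S⟩⟩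
  · rfl
  · simp [light, TopTree.size, TopTree.collapse_size]; ring

end Entry

namespace LTree

variable {α : Type}

theorem entry_total (t : LTree α) : TopTree.total t.entry.stack = t.numEdges := by
  induction t using induct with
  | h a ts ih =>
    rcases eq_or_ne ts [] with rfl | hts
    · rw [entry_nil]; simp [numEdges_node]
    · obtain ⟨l, u, r, c, S, rfl, -, h1, h⟩ := entry_stack_spec a hts
      have h2 : ∀ l : List (LTree α), (∀ v ∈ l, TopTree.total v.entry.stack = v.numEdges) →
          TopTree.total (l.map fun v => v.entry.light a) = (l.map fun v => v.numEdges + 1).sum := by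
        intro l hl
        rw [TopTree.total, List.map_map]
        congr 1
        exact List.map_congr_left fun v hv => by simp [Entry.size_light, hl v hv]
      have h3 := TopTree.total_foldr_push false (l.map (fun v => v.entry.light a) ++
        u.entry.heavy a :: r.map (fun v => v.entry.light a))
      rw [h1, TopTree.total_cons, TopTree.total_append, TopTree.total_cons, h2 l fun v hv => ih v (by simp [hv]),
        h2 r fun v hv => ih v (by simp [hv])] at h3
      have h4 : (u.entry.heavy a).size = 1 := rfl
      rw [h, TopTree.push_total, TopTree.collapse_size, h3, ih u (by simp), numEdges_node, h4]
      simp; omega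

theorem entry_stack_eq_nil {t : LTree α} : t.entry.stack = [] ↔ t.numEdges = 0 := by
  rw [← entry_total]
  constructor
  · intro h; rw [h]; rfl
  · intro h
    cases hS : t.entry.stack with
    | nil => rfl
    | cons c S => rw [hS, TopTree.total_cons] at h; have := c.size_pos; omega

theorem eq_node_nil_of_numEdges {t : LTree α} (h : t.numEdges = 0) : t = node t.label [] := by
  cases t with
  | node a ts =>
    cases ts with
    | nil => rfl
    | cons u ts => rw [numEdges_node] at h; simp at h

/-- The top tree for a tree: the vertical merge of the stack of its entry. The value for a single
node is irrelevant. -/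
def topTree : LTree α → TopTree α := fun t =>
  match t.entry.stack with
  | [] => .leaf t.label t.label false
  | c :: S => TopTree.collapse true c S

theorem topTree_eq {t : LTree α} {c : TopTree α} {S : List (TopTree α)}
    (h : t.entry.stack = c :: S) : t.topTree = TopTree.collapse true c S := by
  rw [topTree, h]

theorem exists_stack {t : LTree α} (h : 1 ≤ t.numEdges) : ∃ c S, t.entry.stack = c :: S :=
  List.exists_cons_of_ne_nil fun h' => by rw [entry_stack_eq_nil] at h'; omega

theorem topTree_size {t : LTree α} (h : 1 ≤ t.numEdges) : t.topTree.size = t.numEdges := by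
  obtain ⟨c, S, hS⟩ := exists_stack h
  rw [topTree_eq hS, TopTree.collapse_size, ← entry_total, hS, TopTree.total_cons]

/-! ### Correctness -/

section Correct

variable [DecidableEq α]

open TopTree

theorem eval_light (a : α) {t : LTree α} (h : t.entry.stack = [] ∨
      den true t.entry.stack = some (.rank0 t)) :
    (t.entry.light a).eval = some (.rank0 (node a [t])) := by
  rw [Entry.light]
  cases hS : t.entry.stack with
  | nil =>
    have := eq_node_nil_of_numEdges (entry_stack_eq_nil.1 hS)
    rw [this]; simp [eval, Cluster.atomic, label]
  | cons c S =>
    have h' := h.resolve_left (by simp [hS])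
    have h1 := eval_collapse true c S
    rw [← hS, h'] at h1
    simp [eval, h1, Cluster.atomic, Cluster.vmerge, Cluster1.bottomLabel, Cluster1.fill]

/-- Horizontal merges of light items from the left to a cluster of rank zero. -/
theorem den_light_append_rank0 (a : α) {l : List (LTree α)}
    (hl : ∀ v ∈ l, (v.entry.light a).eval = some (.rank0 (node a [v])))
    {R : List (TopTree α)} {ts : List (LTree α)} (hR : R ≠ [])
    (h : den false R = some (.rank0 (node a ts))) :
    den false (l.map (fun v => v.entry.light a) ++ R) = some (.rank0 (node a (l ++ ts))) := by
  induction l with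
  | nil => exact h
  | cons v l ih =>
    rw [List.map_cons, List.cons_append, den_cons _ _ (by simp [hR]),
      ih fun w hw => hl w (by simp [hw]), hl v (by simp)]
    simp [comb, Cluster.hmerge]

theorem den_light_append_rank1 (a : α) {l : List (LTree α)}
    (hl : ∀ v ∈ l, (v.entry.light a).eval = some (.rank0 (node a [v])))
    {R : List (TopTree α)} {l' r : List (LTree α)} {c : Cluster1 α} (hR : R ≠ [])
    (h : den false R = some (.rank1 (.node a l' c r))) :
    den false (l.map (fun v => v.entry.light a) ++ R) =
      some (.rank1 (.node a (l ++ l') c r)) := by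
  induction l with
  | nil => exact h
  | cons v l ih =>
    rw [List.map_cons, List.cons_append, den_cons _ _ (by simp [hR]),
      ih fun w hw => hl w (by simp [hw]), hl v (by simp)]
    simp [comb, Cluster.hmerge]

theorem den_light (a : α) {l : List (LTree α)} (h : l ≠ [])
    (hl : ∀ v ∈ l, (v.entry.light a).eval = some (.rank0 (node a [v]))) :
    den false (l.map fun v => v.entry.light a) = some (.rank0 (node a l)) := by
  have h1 := List.dropLast_append_getLast h
  set v := l.getLast h with hv
  rw [← h1, List.map_append]
  exact den_light_append_rank0 a (fun w hw => hl w (List.mem_of_mem_dropLast hw)) (by simp)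
    (hl v (List.getLast_mem h))

theorem den_entry (t : LTree α) :
    t.entry.stack = [] ∨ den true t.entry.stack = some (.rank0 t) := by
  induction t using induct with
  | h a ts ih =>
    rcases eq_or_ne ts [] with rfl | hts
    · left; rw [entry_nil]
    right
    obtain ⟨l, u, r, c, S, rfl, -, h1, h⟩ := entry_stack_spec a hts
    have hl : ∀ v ∈ l, (v.entry.light a).eval = some (.rank0 (node a [v])) :=
      fun v hv => eval_light a (ih v (by simp [hv]))
    have hr : ∀ v ∈ r, (v.entry.light a).eval = some (.rank0 (node a [v])) :=
      fun v hv => eval_light a (ih v (by simp [hv]))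
    have h2 := eval_collapse false c S
    rw [← h1, den_foldr_push] at h2
    rw [h, den_push]
    cases hS : u.entry.stack with
    | nil =>
      have hu := eq_node_nil_of_numEdges (entry_stack_eq_nil.1 hS)
      rw [den, h2]
      refine den_light_append_rank0 a hl (by simp) ?_
      have h3 : (u.entry.heavy a).eval = some (.rank0 (node a [u])) := by
        rw [Entry.heavy, hS, hu]; simp [eval, Cluster.atomic, label]
      cases r with
      | nil => exact h3
      | cons v r =>
        rw [den_cons _ _ (by simp), h3, den_light a (by simp) hr]
        simp [comb, Cluster.hmerge]
    | cons d S' =>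
      rw [den_cons _ _ (by simp), h2, ← hS,
        (ih u (by simp)).resolve_left (by simp [hS])]
      have h3 : (u.entry.heavy a).eval = some (.rank1 (.node a [] (.bottom u.label) [])) := by
        rw [Entry.heavy, hS]; simp [eval, Cluster.atomic]
      have h4 : den false (u.entry.heavy a :: r.map fun v => v.entry.light a) =
          some (.rank1 (.node a [] (.bottom u.label) r)) := by
        cases r with
        | nil => exact h3
        | cons v r =>
          rw [den_cons _ _ (by simp), h3, den_light a (by simp) hr]
          simp [comb, Cluster.hmerge]
      rw [den_light_append_rank1 a hl (by simp) h4]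
      simp [comb, Cluster.vmerge, Cluster1.bottomLabel, Cluster1.fill]

theorem topTree_isTopTreeFor {t : LTree α} (h : 1 ≤ t.numEdges) : t.topTree.IsTopTreeFor t := by
  obtain ⟨c, S, hS⟩ := exists_stack h
  rw [IsTopTreeFor, topTree_eq hS, eval_collapse, ← hS]
  exact (den_entry t).resolve_left (by simp [hS])

end Correct

/-! ### Height -/

open TopTree

theorem height_light_le (a : α) {t : LTree α} {M : ℕ} (h : HeightBound M t.entry.stack) :
    (t.entry.light a).height ≤ M + 3 + 2 * Nat.log 2 t.numEdges ∧
      (t.numEdges = 0 → (t.entry.light a).height = 0) := by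
  have ht := entry_total t
  rw [Entry.light]
  cases hS : t.entry.stack with
  | nil => simp [height]
  | cons c S =>
    rw [hS] at h ht
    have h1 := collapse_height (o := true) (hS ▸ entry_sorted t) h
    have h2 : (collapse true c S).cls = Nat.log 2 t.numEdges := by
      rw [cls, collapse_size, ← ht, total_cons]
    rw [h2] at h1
    refine ⟨?_, fun h0 => ?_⟩
    · simp only [height]; omega
    · rw [h0, total_cons] at ht; have := c.size_pos; omega

/-- The clusters on the stack of a tree have logarithmic height. A light subtree has at most half
of the edges, which pays for the constant number of levels added on top of it. -/
theorem entry_heightBound (t : LTree α) : HeightBound (5 * Nat.log 2 t.numEdges + 2) t.entry.stack := by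
  induction t using induct with
  | h a ts ih =>
    rcases eq_or_ne ts [] with rfl | hts
    · rw [entry_nil]; simp [HeightBound]
    obtain ⟨l, u, r, c, S, hts', hmax, h1, h⟩ := entry_stack_spec a hts
    have hsum : ∀ v ∈ l ++ r, 2 * v.numEdges + 2 ≤ (node a ts).numEdges := by
      intro v hv
      have h2 := hmax v hv
      have h3 : v.numEdges + 1 ≤ ((l ++ r).map fun c => c.numEdges + 1).sum :=
        List.single_le_sum (by simp) _ (List.mem_map_of_mem (f := fun c => c.numEdges + 1) hv)
      rw [numEdges_node, hts']
      simp at h3 ⊢; omega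
    have hu : u.numEdges ≤ (node a ts).numEdges := by
      rw [numEdges_node, hts']; simp; omega
    have hlight : ∀ v ∈ l ++ r, (v.entry.light a).height ≤
        5 * Nat.log 2 (node a ts).numEdges + 2 * (v.entry.light a).cls := by
      intro v hv
      have hv' := hsum v hv
      have h2 := height_light_le a (ih v (by
        rw [hts']; simp only [List.mem_append, List.mem_cons] at hv ⊢; tauto))
      rcases Nat.eq_zero_or_pos v.numEdges with h0 | h0
      · rw [h2.2 h0]; omega
      · have h3 : Nat.log 2 v.numEdges + 1 ≤ Nat.log 2 (node a ts).numEdges := by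
          rw [← Nat.log_mul_base (by norm_num) h0.ne']
          exact Nat.log_mono_right (by omega)
        have h4 : Nat.log 2 v.numEdges ≤ (v.entry.light a).cls := by
          rw [cls, Entry.size_light, entry_total]
          exact Nat.log_mono_right (by omega)
        omega
    have hb : HeightBound (5 * Nat.log 2 (node a ts).numEdges) (c :: S) := by
      rw [← h1]
      refine heightBound_foldr_push fun y hy => ?_
      simp only [List.mem_append, List.mem_cons, List.mem_map] at hy
      rcases hy with ⟨v, hv, rfl⟩ | rfl | ⟨v, hv, rfl⟩
      · exact hlight v (by simp [hv])
      · simp [Entry.heavy, height]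
      · exact hlight v (by simp [hv])
    rw [h]
    refine push_height (entry_sorted u) ((ih u (by rw [hts']; simp)).mono ?_) ?_
    · have := Nat.log_mono_right (b := 2) hu; omega
    · exact collapse_height (h1 ▸ sorted_foldr_push _ _) hb

theorem topTree_height_le {t : LTree α} (h : 1 ≤ t.numEdges) :
    t.topTree.height ≤ 7 * Nat.log 2 t.numEdges + 4 := by
  have hs := topTree_size h
  obtain ⟨c, S, hS⟩ := exists_stack h
  rw [topTree_eq hS] at hs ⊢
  have h1 := collapse_height (o := true) (hS ▸ entry_sorted t) (hS ▸ entry_heightBound t)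
  rw [cls, hs] at h1
  omega

/-! ### The bound in terms of the minimal dag of the tree -/

theorem entry_length_le (t : LTree α) : t.entry.stack.length ≤ Nat.log 2 t.numEdges + 1 := by
  have := (entry_sorted t).length_le
  rwa [entry_total] at this

theorem creates_light (a : α) (t : LTree α) :
    Creates (t.entry.stack.length + 1) t.entry.stack [t.entry.light a] := by
  rw [Entry.light]
  cases hS : t.entry.stack with
  | nil => exact creates_leaf _ _ _
  | cons c S =>
    exact ((((creates_leaf a t.entry.label true).append (creates_collapse true c S))).trans
      (creates_merge true _ _)).mono (by simp; omega)

theorem creates_map_light (a : α) (l : List (LTree α)) {k : ℕ}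
    (h : ∀ t ∈ l, t.entry.stack.length ≤ k) :
    Creates (l.length * (k + 1)) (l.flatMap fun v => v.entry.stack)
      (l.map fun v => v.entry.light a) := by
  induction l with
  | nil => exact (Creates.refl _).mono (by simp)
  | cons t l ih =>
    have := (creates_light a t).append (ih fun v hv => h v (by simp [hv]))
    refine this.mono ?_
    have := h t (by simp)
    rw [List.length_cons, add_mul]; omega

theorem Covers_left {N : Finset (TopTree α)} {ins ins' out : List (TopTree α)}
    (h : Covers N ins out) (hi : ins ⊆ ins') : Covers N ins' out := fun c hc X hX =>
  (h c hc X hX).imp_right fun ⟨d, hd, hX⟩ => ⟨d, hi hd, hX⟩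

/-- Each node of the tree creates a number of new top trees that is at most logarithmic in the number
of edges for each of its children. -/
theorem creates_entry (a : α) (ts : List (LTree α)) {k : ℕ}
    (h : ∀ t ∈ ts, t.entry.stack.length ≤ k) :
    Creates (ts.length * (k + 4)) (ts.flatMap fun v => v.entry.stack)
      (node a ts).entry.stack := by
  rcases eq_or_ne ts [] with rfl | hts
  · rw [entry_nil]; exact (Creates.refl _).mono (by simp)
  obtain ⟨l, u, r, c, S, rfl, -, h1, hst⟩ := entry_stack_spec a hts
  have hl := creates_map_light a l fun v hv => h v (by simp [hv])
  have hr := creates_map_light a r fun v hv => h v (by simp [hv])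
  have hfold := creates_foldr_push false (l.map (fun v => v.entry.light a) ++
    u.entry.heavy a :: r.map (fun v => v.entry.light a))
  rw [h1] at hfold
  have hlen : S.length + 1 ≤ l.length + r.length + 1 := by
    suffices H : ∀ Y : List (TopTree α), (Y.foldr (push false) []).length ≤ Y.length by
      have := H (l.map (fun v => v.entry.light a) ++
        u.entry.heavy a :: r.map (fun v => v.entry.light a))
      rw [h1] at this; simp at this; omega
    intro Y
    induction Y with
    | nil => simp
    | cons y Y ih =>
      obtain ⟨k, hk, -⟩ := creates_push false y (Y.foldr (push false) [])
      simp; omega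
  obtain ⟨m, hm, hpush⟩ := creates_push true (collapse false c S) u.entry.stack
  have hu := h u (by simp)
  have h2 : Creates 1 [] [u.entry.heavy a] := creates_leaf _ _ _
  have h3 := ((((hl.append (h2.append hr)).trans hfold).trans (creates_collapse false c S)).append
    (Creates.refl u.entry.stack)).trans hpush
  rw [← hst] at h3
  obtain ⟨N, hN, hcov⟩ := h3
  refine ⟨N, hN.trans ?_, Covers_left hcov ?_⟩
  · simp only [List.length_append, List.length_cons, List.length_map]
    have : (l.length + (r.length + 1)) * (k + 4) =
      l.length * (k + 1) + r.length * (k + 1) + (k + 1) + 3 * (l.length + r.length + 1) := by ring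
    omega
  · intro x hx
    simp only [List.mem_append, List.mem_flatMap, List.nil_append, List.mem_cons] at hx ⊢
    rcases hx with (⟨v, hv, hx⟩ | ⟨v, hv, hx⟩) | hx
    · exact ⟨v, Or.inl hv, hx⟩
    · exact ⟨v, Or.inr (Or.inr hv), hx⟩
    · exact ⟨u, Or.inr (Or.inl rfl), hx⟩

theorem numEdges_le_of_mem {a : α} {ts : List (LTree α)} {u : LTree α} (hu : u ∈ ts) :
    u.numEdges + 1 ≤ (node a ts).numEdges := by
  rw [numEdges_node]
  exact List.single_le_sum (by simp) _ (List.mem_map_of_mem (f := fun c => c.numEdges + 1) hu)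

theorem numEdges_le_of_mem_subtrees {t u : LTree α} (hu : u ∈ t.subtrees) :
    u.numEdges ≤ t.numEdges := by
  induction t using induct with
  | h a ts ih =>
    rw [subtrees_node] at hu
    rcases List.mem_cons.1 hu with rfl | hu
    · exact le_rfl
    · obtain ⟨v, hv, hu⟩ := List.mem_flatMap.1 hu
      have := ih v hv hu
      have := numEdges_le_of_mem (a := a) hv
      omega

open Classical in
/-- The number of different clusters on the way to the stack of a tree. -/
theorem exists_cover (t : LTree α) {k : ℕ} (hk : ∀ u ∈ t.subtrees, u.entry.stack.length ≤ k) :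
    ∃ N : Finset (TopTree α), N.card ≤ t.dagSize * (k + 4) ∧ Covers N [] t.entry.stack := by
  have h1 : ∀ u : LTree α, ∃ N : Finset (TopTree α), u ∈ t.subtrees → N.card ≤ u.degree * (k + 4) ∧
      ∀ a ts, u = node a ts → Covers N (ts.flatMap fun v => v.entry.stack) u.entry.stack := by
    intro u
    by_cases hu : u ∈ t.subtrees
    · cases u with
      | node a ts =>
        obtain ⟨N, hN, hc⟩ := creates_entry a ts (k := k) fun v hv => by
          refine hk v ?_
          suffices H : ∀ t u : LTree α, u ∈ t.subtrees → u.subtrees ⊆ t.subtrees from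
            H t _ hu (by
              rw [subtrees_node]
              exact List.mem_cons_of_mem _ (List.mem_flatMap.2 ⟨v, hv, self_mem_subtrees v⟩))
          intro t
          induction t using induct with
          | h b ss ih =>
            intro u hu
            rw [subtrees_node] at hu ⊢
            rcases List.mem_cons.1 hu with rfl | hu
            · rw [subtrees_node]; exact List.Subset.refl _
            · obtain ⟨w, hw, hu⟩ := List.mem_flatMap.1 hu
              exact fun x hx =>
                List.mem_cons_of_mem _ (List.mem_flatMap.2 ⟨w, hw, ih w hw u hu hx⟩)
        refine ⟨N, fun _ => ⟨hN, fun b ss hb => ?_⟩⟩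
        obtain ⟨rfl, rfl⟩ : a = b ∧ ts = ss := by simpa using hb
        exact hc
    · exact ⟨∅, fun h => absurd h hu⟩
  choose N hN using h1
  refine ⟨t.subtrees.toFinset.biUnion N, ?_, ?_⟩
  · refine Finset.card_biUnion_le.trans ?_
    rw [dagSize, Finset.sum_mul]
    refine Finset.sum_le_sum fun u hu => ((hN u (List.mem_toFinset.1 hu)).1).trans ?_
    exact Nat.mul_le_mul_right _ (by omega)
  · suffices H : ∀ u : LTree α, u.subtrees ⊆ t.subtrees →
        Covers (t.subtrees.toFinset.biUnion N) [] u.entry.stack from H t (List.Subset.refl _)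
    intro u
    induction u using induct with
    | h a ts ih =>
      intro hsub c hc X hX
      have hself := hsub (self_mem_subtrees _)
      rcases (hN _ hself).2 a ts rfl c hc X hX with h | ⟨d, hd, h⟩
      · exact Or.inl (Finset.mem_biUnion.2 ⟨_, List.mem_toFinset.2 hself, h⟩)
      · obtain ⟨v, hv, hd⟩ := List.mem_flatMap.1 hd
        refine ih v hv (fun x hx => hsub ?_) d hd X h
        rw [subtrees_node]
        exact List.mem_cons_of_mem _ (List.mem_flatMap.2 ⟨v, hv, hx⟩)

end LTree

namespace TopTree

variable {α : Type}

open Classical in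
theorem dagSize_le (T : TopTree α) : T.dagSize ≤ 3 * T.subtrees.toFinset.card := by
  rw [dagSize, mul_comm]
  refine Finset.sum_le_card_nsmul _ _ _ fun S _ => ?_
  cases S <;> simp [degree]

open Classical in
theorem dagSize_le_size (T : TopTree α) : T.dagSize ≤ 6 * T.size := by
  have h1 := T.dagSize_le
  have h2 := T.subtrees.toFinset_card_le
  have h3 := T.length_subtrees
  omega

end TopTree

open Classical in
theorem LTree.topTree_dagSize_le {α : Type} {t : LTree α} (h : 1 ≤ t.numEdges) :
    t.topTree.dagSize ≤ 3 * (t.dagSize * (Nat.log 2 t.numEdges + 5) + Nat.log 2 t.numEdges) := by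
  obtain ⟨N, hN, hcov⟩ := t.exists_cover (k := Nat.log 2 t.numEdges + 1) fun u hu =>
    u.entry_length_le.trans (by
      have := Nat.log_mono_right (b := 2) (numEdges_le_of_mem_subtrees hu); omega)
  have hlen := t.entry_length_le
  obtain ⟨c, S, hS⟩ := exists_stack h
  rw [topTree_eq hS]
  rw [hS] at hcov hlen
  obtain ⟨N', hN', hcov'⟩ := TopTree.creates_collapse true c S
  refine (TopTree.dagSize_le _).trans (Nat.mul_le_mul_left 3 ?_)
  refine (Finset.card_le_card (t := N ∪ N') fun X hX => ?_).trans
    ((Finset.card_union_le _ _).trans (add_le_add hN (hN'.trans ?_)))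
  · rcases hcov.trans hcov' _ (List.mem_singleton_self _) X (List.mem_toFinset.1 hX) with h | h
    · exact h
    · simp at h
  · simp at hlen; omega

/-! ### The number of large clusters -/

namespace TopTree

variable {α : Type}

/-- A top tree is large, with respect to the threshold `2 ^ κ`, if it has at least that many
leaves. -/
def Large (κ : ℕ) (x : TopTree α) : Prop := 2 ^ κ ≤ x.size

instance (κ : ℕ) : DecidablePred (Large (α := α) κ) := fun x =>
  inferInstanceAs (Decidable (2 ^ κ ≤ x.size))

/-- The number of inner nodes that are large and have no large child. -/
def fresh (κ : ℕ) : TopTree α → ℕ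
  | leaf _ _ _ => 0
  | vert x y => x.fresh κ + y.fresh κ +
      if 2 ^ κ ≤ x.size + y.size ∧ ¬ x.Large κ ∧ ¬ y.Large κ then 1 else 0
  | horiz x y => x.fresh κ + y.fresh κ +
      if 2 ^ κ ≤ x.size + y.size ∧ ¬ x.Large κ ∧ ¬ y.Large κ then 1 else 0

/-- The number of inner nodes with exactly one large child. -/
def unary (κ : ℕ) : TopTree α → ℕ
  | leaf _ _ _ => 0
  | vert x y => x.unary κ + y.unary κ + if x.Large κ ↔ y.Large κ then 0 else 1
  | horiz x y => x.unary κ + y.unary κ + if x.Large κ ↔ y.Large κ then 0 else 1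

variable {κ : ℕ}

theorem large_iff {x : TopTree α} : x.Large κ ↔ κ ≤ x.cls := (le_cls_iff x κ).symm

theorem large_merge {o : Bool} {x y : TopTree α} :
    (merge o x y).Large κ ↔ 2 ^ κ ≤ x.size + y.size := by rw [Large, size_merge]

theorem Large.merge_left {x : TopTree α} (h : x.Large κ) (o : Bool) (y : TopTree α) :
    (merge o x y).Large κ := by rw [Large] at h; rw [large_merge]; omega

theorem Large.merge_right {y : TopTree α} (h : y.Large κ) (o : Bool) (x : TopTree α) :
    (merge o x y).Large κ := by rw [Large] at h; rw [large_merge]; omega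

theorem fresh_merge (o : Bool) (x y : TopTree α) : (merge o x y).fresh κ = x.fresh κ + y.fresh κ +
    if (merge o x y).Large κ ∧ ¬ x.Large κ ∧ ¬ y.Large κ then 1 else 0 := by
  cases o <;> rfl

theorem unary_merge (o : Bool) (x y : TopTree α) : (merge o x y).unary κ =
    x.unary κ + y.unary κ + if x.Large κ ↔ y.Large κ then 0 else 1 := by
  cases o <;> rfl

/-- Induction along merges, without distinguishing the two operations. -/
theorem merge_induct {P : TopTree α → Prop} (hl : ∀ a b r, P (leaf a b r))
    (hm : ∀ o x y, P x → P y → P (merge o x y)) (T : TopTree α) : P T := by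
  induction T with
  | leaf a b r => exact hl a b r
  | vert x y hx hy => exact hm true x y hx hy
  | horiz x y hx hy => exact hm false x y hx hy

theorem fresh_eq_zero {x : TopTree α} (h : ¬ x.Large κ) : x.fresh κ = 0 ∧ x.unary κ = 0 := by
  induction x using merge_induct with
  | hl => exact ⟨rfl, rfl⟩
  | hm o x y hx hy =>
    have h1 : ¬ x.Large κ := fun h' => h (h'.merge_left o y)
    have h2 : ¬ y.Large κ := fun h' => h (h'.merge_right o x)
    simp [fresh_merge, unary_merge, h, h1, h2, hx h1, hy h2]

theorem fresh_pos (hκ : 1 ≤ κ) {x : TopTree α} (h : x.Large κ) : 1 ≤ x.fresh κ := by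
  induction x using merge_induct with
  | hl a b r =>
    have : 2 ^ 1 ≤ 2 ^ κ := Nat.pow_le_pow_right (by norm_num) hκ
    simp only [Large, size] at h; omega
  | hm o x y hx hy =>
    rw [fresh_merge]
    by_cases h1 : x.Large κ
    · have := hx h1; omega
    by_cases h2 : y.Large κ
    · have := hy h2; omega
    simp [h, h1, h2]

theorem fresh_mul_le (x : TopTree α) : 2 ^ κ * x.fresh κ ≤ x.size := by
  induction x using merge_induct with
  | hl => simp [fresh]
  | hm o x y hx hy =>
    rw [fresh_merge, mul_add, mul_add, size_merge]
    split_ifs with h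
    · rw [(fresh_eq_zero h.2.1).1, (fresh_eq_zero h.2.2).1, mul_one]
      have := large_merge.1 h.1
      omega
    · omega

/-- The number of large nodes: those without large children are at least as many as those with two
large children. -/
theorem countP_large_le (hκ : 1 ≤ κ) (x : TopTree α) :
    x.subtrees.countP (fun y => y.Large κ) ≤ 2 * x.fresh κ + x.unary κ := by
  suffices H : (¬ x.Large κ → x.subtrees.countP (fun y => y.Large κ) = 0) ∧ (x.Large κ →
      x.subtrees.countP (fun y => y.Large κ) + 1 ≤ 2 * x.fresh κ + x.unary κ) by
    by_cases h : x.Large κ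
    · have := H.2 h; omega
    · have := H.1 h; omega
  induction x using merge_induct with
  | hl a b r =>
    have : 2 ^ 1 ≤ 2 ^ κ := Nat.pow_le_pow_right (by norm_num) hκ
    have h : ¬ (leaf a b r).Large κ := by simp only [Large, size]; omega
    exact ⟨fun _ => by simp [subtrees, h], fun h' => absurd h' h⟩
  | hm o x y hx hy =>
    rw [subtrees_merge, List.countP_cons, List.countP_append, fresh_merge, unary_merge]
    constructor
    · intro h
      have h1 : ¬ x.Large κ := fun h' => h (h'.merge_left o y)
      have h2 : ¬ y.Large κ := fun h' => h (h'.merge_right o x)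
      simp [h, hx.1 h1, hy.1 h2]
    · intro h
      by_cases h1 : x.Large κ <;> by_cases h2 : y.Large κ
      · have := hx.2 h1; have := hy.2 h2; simp [h, h1, h2]; omega
      · have := hx.2 h1; have := hy.1 h2; simp [h, h1, h2]; omega
      · have := hx.1 h1; have := hy.2 h2; simp [h, h1, h2]; omega
      · have := hx.1 h1; have := hy.1 h2; simp [h, h1, h2]; omega

/-- Sums of `fresh` over a stack. -/
def freshSum (κ : ℕ) (S : List (TopTree α)) : ℕ := (S.map (fresh κ)).sum

/-- Sums of `unary` over a stack. -/
def unarySum (κ : ℕ) (S : List (TopTree α)) : ℕ := (S.map (unary κ)).sum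

@[simp] theorem freshSum_nil : freshSum κ ([] : List (TopTree α)) = 0 := rfl
@[simp] theorem unarySum_nil : unarySum κ ([] : List (TopTree α)) = 0 := rfl
@[simp] theorem freshSum_cons (x : TopTree α) (S) :
    freshSum κ (x :: S) = x.fresh κ + freshSum κ S := rfl
@[simp] theorem unarySum_cons (x : TopTree α) (S) :
    unarySum κ (x :: S) = x.unary κ + unarySum κ S := rfl

theorem fresh_add_le (o : Bool) (x y : TopTree α) :
    x.fresh κ + y.fresh κ ≤ (merge o x y).fresh κ := by rw [fresh_merge]; omega

theorem fresh_le_absorb (o : Bool) (b : ℕ) (x : TopTree α) (S : List (TopTree α)) :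
    x.fresh κ + freshSum κ S ≤ (absorb o b x S).1.fresh κ + freshSum κ (absorb o b x S).2 := by
  induction S generalizing x with
  | nil => simp [absorb]
  | cons c S ih =>
    rw [absorb]; split_ifs
    · have := ih (merge o x c); have := fresh_add_le (κ := κ) o x c
      rw [freshSum_cons]; omega
    · exact le_rfl

theorem fresh_le_carry (o : Bool) (x : TopTree α) (S : List (TopTree α)) :
    x.fresh κ + freshSum κ S ≤ freshSum κ (carry o x S) := by
  induction S generalizing x with
  | nil => simp [carry]
  | cons c S ih =>
    rw [carry]; split_ifs
    · have := ih (merge o x c); have := fresh_add_le (κ := κ) o x c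
      rw [freshSum_cons]; omega
    · exact le_rfl

theorem fresh_le_push (o : Bool) (x : TopTree α) (S : List (TopTree α)) :
    x.fresh κ + freshSum κ S ≤ freshSum κ (push o x S) := by
  cases S with
  | nil => simp [push]
  | cons c S =>
    rw [push]; split_ifs
    · have := fresh_le_absorb (κ := κ) o x.pw c S
      have := fresh_add_le (κ := κ) o x (absorb o x.pw c S).1
      have := fresh_le_carry (κ := κ) o (merge o x (absorb o x.pw c S).1) (absorb o x.pw c S).2
      rw [freshSum_cons]; omega
    · exact fresh_le_carry _ _ _

theorem fresh_le_collapse (o : Bool) (x : TopTree α) (S : List (TopTree α)) :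
    x.fresh κ + freshSum κ S ≤ (collapse o x S).fresh κ := by
  induction S generalizing x with
  | nil => simp [collapse]
  | cons c S ih =>
    have := ih (merge o x c); have := fresh_add_le (κ := κ) o x c
    rw [freshSum_cons, collapse]; omega

/-- Absorbing a sorted stack: the accumulated top tree is never large while the next element is
not, so that only the first large element can be merged with a top tree that is not large. -/
theorem unary_absorb {o : Bool} {b : ℕ} {x : TopTree α} {S : List (TopTree α)} (hS : Sorted S)
    (hx : ∀ c ∈ S, x.size < 2 ^ (c.cls + 1)) :
    (absorb o b x S).1.unary κ + unarySum κ (absorb o b x S).2 ≤ x.unary κ + unarySum κ S +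
      (if (absorb o b x S).1.Large κ ∧ ¬ x.Large κ then 1 else 0) := by
  induction S generalizing x with
  | nil => simp [absorb]
  | cons c S ih =>
    rw [absorb]; split_ifs with hb hl hl'
    · have h1 := hx c (by simp)
      have h2 := ih (x := merge o x c) hS.tail fun d hd => by
        have h3 := List.rel_of_pairwise_cons hS hd
        have h4 := c.size_lt
        have h5 : 2 ^ (c.cls + 2) ≤ 2 ^ (d.cls + 1) := Nat.pow_le_pow_right (by norm_num) (by omega)
        rw [size_merge]
        rw [pow_succ] at h5; omega
      rw [unary_merge] at h2
      rw [unarySum_cons]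
      by_cases hc : c.Large κ
      · have := hc.merge_right o x
        simp only [hl.2, hc, this, false_iff, not_true, and_false, if_false] at h2
        omega
      · simp only [hl.2, hc, iff_self, if_true] at h2
        split_ifs at h2 <;> omega
    · have h1 := hx c (by simp)
      have h2 := ih (x := merge o x c) hS.tail fun d hd => by
        have h3 := List.rel_of_pairwise_cons hS hd
        have h4 := c.size_lt
        have h5 : 2 ^ (c.cls + 2) ≤ 2 ^ (d.cls + 1) := Nat.pow_le_pow_right (by norm_num) (by omega)
        rw [size_merge]
        rw [pow_succ] at h5; omega
      rw [unary_merge] at h2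
      rw [unarySum_cons]
      by_cases hxl : x.Large κ
      · have hc : c.Large κ := by
          rw [large_iff]
          by_contra h
          have : 2 ^ (c.cls + 1) ≤ 2 ^ κ := Nat.pow_le_pow_right (by norm_num) (by omega)
          rw [Large] at hxl; omega
        have := hc.merge_right o x
        simp only [hxl, hc, this, iff_self, not_true, and_false, if_false, if_true] at h2
        omega
      · have hnl : ¬ (absorb o b (merge o x c) S).1.Large κ := fun h => hl ⟨h, hxl⟩
        rw [(fresh_eq_zero hnl).2] at h2 ⊢
        by_cases hc : c.Large κ
        · exfalso
          apply hnl
          have h3 : ∀ (y : TopTree α) (S : List (TopTree α)), y.Large κ →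
              (absorb o b y S).1.Large κ := by
            intro y S
            induction S generalizing y with
            | nil => exact fun h => h
            | cons d S ih =>
              intro h
              rw [absorb]; split_ifs
              · exact ih _ (h.merge_left o d)
              · exact h
          exact h3 _ _ (hc.merge_right o x)
        · simp only [hxl, hc, iff_self, if_true, hnl, false_and, if_false] at h2
          omega
    · exact absurd hl'.1 hl'.2
    · simp

theorem size_absorb_lt {o : Bool} {ℓ : ℕ} {x : TopTree α} {S : List (TopTree α)} (hS : Sorted S)
    (hx : ∀ c ∈ S, x.size < 2 ^ (c.cls + 1)) (hℓ : x.size < 2 ^ (ℓ + 1)) :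
    (absorb o (2 ^ ℓ) x S).1.size < 2 ^ (ℓ + 1) := by
  induction S generalizing x with
  | nil => simpa [absorb]
  | cons c S ih =>
    rw [absorb]; split_ifs with hb
    · have h1 := hx c (by simp)
      have h4 := c.size_lt
      refine ih (x := merge o x c) hS.tail (fun d hd => ?_) ?_
      · have h3 := List.rel_of_pairwise_cons hS hd
        have h5 : 2 ^ (c.cls + 2) ≤ 2 ^ (d.cls + 1) := Nat.pow_le_pow_right (by norm_num) (by omega)
        rw [size_merge]
        rw [pow_succ] at h5; omega
      · have h3 : c.cls < ℓ := (Nat.pow_lt_pow_iff_right (by norm_num)).1 hb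
        have h5 : 2 ^ (c.cls + 2) ≤ 2 ^ (ℓ + 1) := Nat.pow_le_pow_right (by norm_num) (by omega)
        rw [size_merge]
        rw [pow_succ] at h5; omega
    · exact hℓ

theorem unary_carry_of_large {o : Bool} {z : TopTree α} {S : List (TopTree α)} (hz : z.Large κ)
    (hS : ∀ c ∈ S, c.Large κ) : unarySum κ (carry o z S) ≤ z.unary κ + unarySum κ S := by
  induction S generalizing z with
  | nil => simp [carry]
  | cons c S ih =>
    rw [carry]; split_ifs
    · have h1 := ih (z := merge o z c) (hz.merge_left o c) fun d hd => hS d (by simp [hd])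
      rw [unary_merge, if_pos (by simp [hz, hS c])] at h1
      rw [unarySum_cons]; omega
    · exact le_rfl

/-- Carrying a large `z` whose size is not much larger than the classes on the stack: at most one
element can be small, since its class has to be just below that of the threshold. -/
theorem unary_carry_le {o : Bool} {z : TopTree α} {S : List (TopTree α)} (hS : Sorted S)
    (hz : z.Large κ) (hsz : ∀ c ∈ S, z.size < 2 ^ (c.cls + 2)) :
    unarySum κ (carry o z S) ≤ z.unary κ + unarySum κ S + 1 := by
  cases S with
  | nil => simp [carry]
  | cons c S =>
    by_cases hc : c.Large κ
    · refine (unary_carry_of_large hz fun d hd => ?_).trans (Nat.le_succ _)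
      rcases List.mem_cons.1 hd with rfl | hd
      · exact hc
      · have := List.rel_of_pairwise_cons hS hd
        rw [large_iff] at hc ⊢; omega
    · rw [carry]; split_ifs
      · have h0 : κ < c.cls + 2 := by
          by_contra h
          have h1 := hsz c (by simp)
          have : 2 ^ (c.cls + 2) ≤ 2 ^ κ := Nat.pow_le_pow_right (by norm_num) (by omega)
          rw [Large] at hz; omega
        have h1 := unary_carry_of_large (κ := κ) (o := o) (hz.merge_left o c) (S := S) fun d hd => by
          have := List.rel_of_pairwise_cons hS hd
          rw [large_iff]; omega
        rw [unary_merge, if_neg (by simp [hz, hc])] at h1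
        rw [unarySum_cons]; omega
      · rw [unarySum_cons]; omega

theorem unary_carry {o : Bool} {z : TopTree α} {S : List (TopTree α)} (hS : Sorted S)
    (hsz : ∀ c ∈ S, z.size < 2 ^ (c.cls + 2)) :
    unarySum κ (carry o z S) + z.fresh κ + freshSum κ S ≤
      z.unary κ + unarySum κ S + freshSum κ (carry o z S) + if z.Large κ then 1 else 0 := by
  by_cases hz : z.Large κ
  · have h1 := unary_carry_le (κ := κ) (o := o) hS hz hsz
    have h2 := fresh_le_carry (κ := κ) o z S
    rw [if_pos hz]; omega
  rw [if_neg hz]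
  induction S generalizing z with
  | nil => simp [carry]
  | cons c S ih =>
    rw [carry]; split_ifs with h
    · have hc : ¬ c.Large κ := by
        rw [large_iff] at hz ⊢
        have := pw_le_pw.1 h; omega
      have hsz' : ∀ d ∈ S, (merge o z c).size < 2 ^ (d.cls + 2) := by
        intro d hd
        have h3 := List.rel_of_pairwise_cons hS hd
        have h4 := c.size_lt
        have h1 := hsz c (by simp)
        have h5 : 2 ^ (c.cls + 3) ≤ 2 ^ (d.cls + 2) := Nat.pow_le_pow_right (by norm_num) (by omega)
        rw [size_merge]
        have e1 : 2 ^ (c.cls + 1) * 2 = 2 ^ (c.cls + 2) := (pow_succ _ _).symm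
        have e2 : 2 ^ (c.cls + 2) * 2 = 2 ^ (c.cls + 3) := (pow_succ _ _).symm
        omega
      rw [unarySum_cons, freshSum_cons]
      have hu : (merge o z c).unary κ = z.unary κ + c.unary κ := by
        rw [unary_merge, if_pos (by simp [hz, hc]), add_zero]
      by_cases hm : (merge o z c).Large κ
      · have h1 := unary_carry_le (κ := κ) (o := o) hS.tail hm hsz'
        have h2 := fresh_le_carry (κ := κ) o (merge o z c) S
        have h3 : (merge o z c).fresh κ = z.fresh κ + c.fresh κ + 1 := by
          rw [fresh_merge, if_pos ⟨hm, hz, hc⟩]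
        omega
      · have h1 := ih hS.tail hsz' hm
        have h3 : (merge o z c).fresh κ = z.fresh κ + c.fresh κ := by
          rw [fresh_merge, if_neg (fun h => hm h.1), add_zero]
        omega
    · simp; omega

/-- The effect of pushing an item: each merge of a large with a small top tree is paid for by a
fresh large node, or the item itself is large. -/
theorem unary_push {o : Bool} {x : TopTree α} {S : List (TopTree α)} (hS : Sorted S) :
    unarySum κ (push o x S) + x.fresh κ + freshSum κ S ≤
      x.unary κ + unarySum κ S + freshSum κ (push o x S) + 2 * if x.Large κ then 1 else 0 := by
  cases S with
  | nil => simp [push]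
  | cons c S =>
    rw [push]; split_ifs with h hx hx
    · -- a large item that absorbs smaller elements
      have hlt : ∀ d ∈ S, c.size < 2 ^ (d.cls + 1) := fun d hd => by
        have := List.rel_of_pairwise_cons hS hd
        exact c.size_lt.trans (Nat.pow_lt_pow_right (by norm_num) (by omega))
      have h1 := unary_absorb (κ := κ) (o := o) (b := x.pw) hS.tail hlt
      have h2 := fresh_le_absorb (κ := κ) o x.pw c S
      set p := absorb o x.pw c S with hp
      have h3 := fresh_le_carry (κ := κ) o (merge o x p.1) p.2
      have h4 := fresh_add_le (κ := κ) o x p.1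
      have h5 := unary_carry_of_large (κ := κ) (o := o) (hx.merge_left o p.1) (S := p.2) fun d hd => by
        have := pw_le_pw.1 (hS.tail.absorb_ge d hd)
        rw [large_iff] at hx ⊢; omega
      rw [unary_merge] at h5
      rw [unarySum_cons, freshSum_cons]
      by_cases hl : p.1.Large κ
      · simp only [hx, hl, iff_self, if_true] at h5
        split_ifs at h1 <;> omega
      · simp only [hl, false_and, if_false] at h1
        split_ifs at h5 <;> omega
    · -- a small item that absorbs smaller elements
      have hlt : ∀ d ∈ S, c.size < 2 ^ (d.cls + 1) := fun d hd => by
        have := List.rel_of_pairwise_cons hS hd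
        exact c.size_lt.trans (Nat.pow_lt_pow_right (by norm_num) (by omega))
      have h0 := size_absorb_lt (o := o) (ℓ := x.cls) hS.tail hlt (by
        have := pw_lt_pw.1 h
        exact c.size_lt.trans (Nat.pow_lt_pow_right (by norm_num) (by omega)))
      have h1 := unary_absorb (κ := κ) (o := o) (b := x.pw) hS.tail hlt
      have h2 := fresh_le_absorb (κ := κ) o x.pw c S
      have h6 := (hS.tail.of_suffix (absorb_suffix o x.pw c S))
      have h7 := hS.tail.absorb_ge (o := o) (b := x.pw) (acc := c)
      change (absorb o x.pw c S).1.size < _ at h0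
      set p := absorb o x.pw c S with hp
      have hpl : ¬ p.1.Large κ := by
        rw [large_iff] at hx
        have : 2 ^ (x.cls + 1) ≤ 2 ^ κ := Nat.pow_le_pow_right (by norm_num) (by omega)
        rw [Large]; omega
      have h5 := unary_carry (κ := κ) (o := o) (z := merge o x p.1) h6 fun d hd => by
        have e := pw_le_pw.1 (h7 d hd)
        have e1 : 2 ^ (x.cls + 2) ≤ 2 ^ (d.cls + 2) := Nat.pow_le_pow_right (by norm_num) (by omega)
        have e2 : 2 ^ (x.cls + 1) * 2 = 2 ^ (x.cls + 2) := (pow_succ _ _).symm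
        have := x.size_lt
        rw [size_merge]; omega
      rw [unary_merge, if_pos (by simp [hx, hpl]), fresh_merge] at h5
      simp only [hpl, false_and, if_false] at h1
      rw [unarySum_cons, freshSum_cons]
      by_cases hm : (merge o x p.1).Large κ
      · simp only [hm, hx, hpl, not_false_eq_true, and_self, if_true] at h5
        omega
      · simp only [hm, false_and, if_false] at h5
        omega
    · -- a large item on top of large elements
      have h1 := unary_carry_of_large (κ := κ) (o := o) hx (S := c :: S) fun d hd => by
        have e := pw_le_pw.1 (not_lt.1 h)
        rw [large_iff] at hx ⊢
        rcases List.mem_cons.1 hd with rfl | hd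
        · omega
        · have := List.rel_of_pairwise_cons hS hd; omega
      have h2 := fresh_le_carry (κ := κ) o x (c :: S)
      omega
    · have h1 := unary_carry (κ := κ) (o := o) (z := x) hS fun d hd => by
        have e := pw_le_pw.1 (not_lt.1 h)
        have e1 : x.cls ≤ d.cls := by
          rcases List.mem_cons.1 hd with rfl | hd
          · exact e
          · have := List.rel_of_pairwise_cons hS hd; omega
        exact x.size_lt.trans (Nat.pow_lt_pow_right (by norm_num) (by omega))
      rw [if_neg hx] at h1
      omega

theorem unary_collapse {o : Bool} {x : TopTree α} {S : List (TopTree α)} (hS : Sorted (x :: S)) :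
    (collapse o x S).unary κ ≤ x.unary κ + unarySum κ S +
      if (collapse o x S).Large κ then 1 else 0 := by
  obtain ⟨k, hk⟩ := exists_bound S
  have h1 := unary_absorb (κ := κ) (o := o) (b := 2 ^ k) (x := x) hS.tail fun d hd => by
    have := List.rel_of_pairwise_cons hS hd
    exact x.size_lt.trans (Nat.pow_lt_pow_right (by norm_num) (by omega))
  rw [absorb_eq_collapse hk, unarySum_nil, add_zero] at h1
  refine h1.trans ?_
  split_ifs <;> simp_all

/-- The sum over all items when they are pushed one after the other on an empty stack. -/
theorem unary_foldr_push (o : Bool) (Y : List (TopTree α)) :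
    unarySum κ (Y.foldr (push o) []) + freshSum κ Y ≤
      unarySum κ Y + freshSum κ (Y.foldr (push o) []) +
        2 * (Y.map fun y => if y.Large κ then 1 else 0).sum := by
  induction Y with
  | nil => simp
  | cons y Y ih =>
    have := unary_push (κ := κ) (o := o) (x := y) (sorted_foldr_push o Y)
    simp only [List.foldr_cons, unarySum_cons, freshSum_cons, List.map_cons, List.sum_cons]
    omega

theorem freshSum_foldr_push (o : Bool) (Y : List (TopTree α)) :
    freshSum κ Y ≤ freshSum κ (Y.foldr (push o) []) := by
  induction Y with
  | nil => simp
  | cons y Y ih =>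
    have := fresh_le_push (κ := κ) o y (Y.foldr (push o) [])
    simp only [List.foldr_cons, freshSum_cons]
    omega

/-- The potential `unary - 5 * fresh`, summed over a stack. -/
def pot (κ : ℕ) (S : List (TopTree α)) : ℤ := unarySum κ S - 5 * freshSum κ S

theorem pot_cons (x : TopTree α) (S) :
    pot κ (x :: S) = (x.unary κ : ℤ) - 5 * x.fresh κ + pot κ S := by
  simp only [pot, unarySum_cons, freshSum_cons]; push_cast; ring

theorem pot_eq_zero {S : List (TopTree α)} (h : total S < 2 ^ κ) : pot κ S = 0 := by
  induction S with
  | nil => simp [pot]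
  | cons x S ih =>
    rw [total_cons] at h
    have hx : ¬ x.Large κ := by rw [Large]; omega
    rw [pot_cons, ih (by omega), (fresh_eq_zero hx).1, (fresh_eq_zero hx).2]; simp

theorem pot_push {o : Bool} {x : TopTree α} {S : List (TopTree α)} (hS : Sorted S) :
    pot κ (push o x S) ≤ pot κ (x :: S) + 2 * if x.Large κ then 1 else 0 := by
  have h1 := unary_push (κ := κ) (o := o) (x := x) hS
  have h2 := fresh_le_push (κ := κ) o x S
  simp only [pot, unarySum_cons, freshSum_cons]
  split_ifs at * <;> push_cast <;> omega

theorem pot_collapse {o : Bool} {x : TopTree α} {S : List (TopTree α)} (hS : Sorted (x :: S)) :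
    pot κ [collapse o x S] ≤ pot κ (x :: S) + if (collapse o x S).Large κ then 1 else 0 := by
  have h1 := unary_collapse (κ := κ) (o := o) hS
  have h2 := fresh_le_collapse (κ := κ) o x S
  simp only [pot, unarySum_cons, freshSum_cons, unarySum_nil, freshSum_nil]
  split_ifs at * <;> push_cast <;> omega

theorem pot_foldr_push (o : Bool) (Y : List (TopTree α)) :
    pot κ (Y.foldr (push o) []) ≤
      (Y.map fun y => pot κ [y] + 2 * if y.Large κ then 1 else 0).sum := by
  induction Y with
  | nil => simp [pot]
  | cons y Y ih =>
    have := pot_push (κ := κ) (o := o) (x := y) (sorted_foldr_push o Y)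
    rw [pot_cons] at this
    simp only [List.foldr_cons, List.map_cons, List.sum_cons]
    rw [pot_cons]
    have e : pot κ ([] : List (TopTree α)) = 0 := by simp [pot]
    omega

end TopTree

namespace LTree

variable {α : Type} {κ : ℕ}

open TopTree

theorem pot_light (hκ : 1 ≤ κ) (a : α) (t : LTree α) :
    pot κ [t.entry.light a] + 2 * (if (t.entry.light a).Large κ then 1 else 0) ≤
      pot κ t.entry.stack + 4 * if 2 ^ κ ≤ t.numEdges then 1 else 0 := by
  have hsz := Entry.size_light a t.entry
  have ht := entry_total t
  have h2 : 2 ^ 1 ≤ 2 ^ κ := Nat.pow_le_pow_right (by norm_num) hκ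
  by_cases hl : (t.entry.light a).Large κ
  · have hl' := hl
    rw [Large, hsz, ht] at hl'
    obtain ⟨c, S, hS⟩ := exists_stack (t := t) (by omega)
    have he : t.entry.light a = merge true (.leaf a t.entry.label true) (collapse true c S) := by
      rw [Entry.light, hS]; rfl
    have hcs : (collapse true c S).size = t.numEdges := by
      rw [collapse_size, ← ht, hS, total_cons]
    have h3 := pot_collapse (κ := κ) (o := true) (hS ▸ entry_sorted t)
    rw [← hS] at h3
    have hleaf : ¬ (TopTree.leaf a t.entry.label true).Large κ := by
      simp only [Large, size]; omega
    rw [if_pos hl, he, pot_cons, fresh_merge, unary_merge, ← he]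
    have e0 : pot κ ([] : List (TopTree α)) = 0 := by simp [pot]
    rw [pot_cons] at h3
    by_cases hc : 2 ^ κ ≤ t.numEdges
    · have hc' : (collapse true c S).Large κ := by rw [Large]; omega
      simp only [hc, hc', hleaf, fresh, unary, e0, if_true, iff_true, if_false, not_true, and_false]
        at h3 ⊢
      push_cast; omega
    · have hc' : ¬ (collapse true c S).Large κ := by rw [Large]; omega
      simp only [hc, hc', hl, hleaf, fresh, unary, e0, if_true, if_false, not_false_eq_true,
        and_self] at h3 ⊢
      push_cast; omega
  · rw [if_neg hl]
    rw [Large, hsz] at hl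
    rw [pot_eq_zero (by simpa [hsz] using hl), pot_eq_zero (by omega)]
    split_ifs <;> simp

/-- The sum of the contributions of the light children. -/
theorem pot_map_light (hκ : 1 ≤ κ) (a : α) (l : List (LTree α)) :
    ((l.map fun v => v.entry.light a).map fun y =>
        pot κ [y] + 2 * if y.Large κ then 1 else 0).sum ≤
      (l.map fun v => pot κ v.entry.stack + 4 * if 2 ^ κ ≤ v.numEdges then 1 else 0).sum := by
  rw [List.map_map]
  exact List.sum_le_sum fun v _ => pot_light hκ a v

/-- If no light subtree is large, then the item of the node pays for itself. -/
theorem two_mul_add_le_of_small (hκ : 1 ≤ κ) (a : α) {l r : List (LTree α)} {u : LTree α}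
    (hs : ∀ v ∈ l ++ r, v.numEdges < 2 ^ κ) {c : TopTree α} {S : List (TopTree α)}
    (h : (l.map (fun v => v.entry.light a) ++ u.entry.heavy a ::
      r.map (fun v => v.entry.light a)).foldr (push false) [] = c :: S) :
    pot κ [collapse false c S] + 2 * (if (collapse false c S).Large κ then 1 else 0) ≤ 0 := by
  set Y := l.map (fun v => v.entry.light a) ++ u.entry.heavy a ::
      r.map (fun v => v.entry.light a) with hY
  have h2 : 2 ^ 1 ≤ 2 ^ κ := Nat.pow_le_pow_right (by norm_num) hκ
  have hitem : ∀ v : LTree α, v.numEdges < 2 ^ κ → (v.entry.light a).unary κ +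
      (if (v.entry.light a).Large κ then 1 else 0) ≤ (v.entry.light a).fresh κ := by
    intro v hv
    split_ifs with hl
    · have hp := fresh_pos hκ hl
      have : (v.entry.light a).unary κ = 0 := by
        rw [Entry.light]
        cases hS : v.entry.stack with
        | nil => rfl
        | cons c S =>
          have h3 : ¬ (collapse true c S).Large κ := by
            rw [Large, collapse_size, ← total_cons, ← hS, entry_total]; omega
          have h4 : ¬ (TopTree.leaf a v.label true).Large κ := by
            simp only [Large, size]; omega
          simp [unary, h3, h4, fresh_eq_zero h3]
      omega
    · rw [(fresh_eq_zero hl).1, (fresh_eq_zero hl).2]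
  have hsum : ∀ l : List (LTree α), (∀ v ∈ l, v.numEdges < 2 ^ κ) →
      unarySum κ (l.map fun v => v.entry.light a) +
        ((l.map fun v => v.entry.light a).map fun y => if y.Large κ then 1 else 0).sum ≤
      freshSum κ (l.map fun v => v.entry.light a) := by
    intro l
    induction l with
    | nil => simp
    | cons v l ih =>
      intro hl
      have h3 := ih fun w hw => hl w (by simp [hw])
      have h4 := hitem v (hl v (by simp))
      simp only [List.map_cons, List.sum_cons, unarySum_cons, freshSum_cons]
      omega
  have hYsum : unarySum κ Y + (Y.map fun y => if y.Large κ then 1 else 0).sum ≤ freshSum κ Y := by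
    have h3 := hsum l fun v hv => hs v (by simp [hv])
    have h4 := hsum r fun v hv => hs v (by simp [hv])
    have h5 : ¬ (u.entry.heavy a).Large κ := by
      simp only [Large, Entry.heavy, size]; omega
    have h6 := fresh_eq_zero h5
    rw [hY]
    simp only [unarySum, freshSum, List.map_append, List.map_cons, List.sum_append, List.sum_cons,
      h5, if_false, h6.1, h6.2] at h3 h4 ⊢
    omega
  have hso := h ▸ sorted_foldr_push false Y
  have h3 := unary_foldr_push (κ := κ) false Y
  have h4 := freshSum_foldr_push (κ := κ) false Y
  rw [h] at h3 h4
  have h5 := unary_collapse (κ := κ) (o := false) hso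
  have h6 := fresh_le_collapse (κ := κ) false c S
  have e0 : pot κ ([] : List (TopTree α)) = 0 := by simp [pot]
  rw [pot_cons, e0]
  rw [unarySum_cons, freshSum_cons] at h3
  rw [freshSum_cons] at h4
  split_ifs at h5 ⊢ with hl
  · have := fresh_pos hκ hl
    push_cast; omega
  · rw [(fresh_eq_zero hl).1, (fresh_eq_zero hl).2]; simp

/-- The potential of the stack of a tree is bounded in terms of the number of edges. A large light
subtree comes with a large heavy subtree; this pays for its constant contribution. -/
theorem pot_entry (hκ : 1 ≤ κ) (t : LTree α) :
    2 ^ κ * pot κ t.entry.stack ≤ 7 * ((t.numEdges - 2 ^ κ : ℕ) : ℤ) := by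
  induction t using induct with
  | h a ts ih =>
    rcases eq_or_ne ts [] with rfl | hts
    · rw [entry_nil]; simp [pot]
    obtain ⟨l, u, r, c, S, hts', hmax, h1, h⟩ := entry_stack_spec a hts
    have hK : (0 : ℤ) < 2 ^ κ := by positivity
    have hK' : 0 < 2 ^ κ := by positivity
    have hne : (node a ts).numEdges =
        ((l ++ r).map fun v => v.numEdges + 1).sum + (u.numEdges + 1) := by
      rw [numEdges_node, hts']; simp; omega
    have hu := ih u (by rw [hts']; simp)
    have hso := h1 ▸ sorted_foldr_push (α := α) false _
    have hp := pot_push (κ := κ) (o := true) (x := collapse false c S) (entry_sorted u)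
    rw [← h, pot_cons] at hp
    by_cases hs : ∀ v ∈ l ++ r, v.numEdges < 2 ^ κ
    · have h2 := two_mul_add_le_of_small hκ a hs h1
      have e0 : pot κ ([] : List (TopTree α)) = 0 := by simp [pot]
      rw [pot_cons, e0] at h2
      have h3 : pot κ (node a ts).entry.stack ≤ pot κ u.entry.stack := by omega
      have h4 := mul_le_mul_of_nonneg_left h3 hK.le
      have h5 : u.numEdges - 2 ^ κ ≤ (node a ts).numEdges - 2 ^ κ := by omega
      have : ((u.numEdges - 2 ^ κ : ℕ) : ℤ) ≤ ((node a ts).numEdges - 2 ^ κ : ℕ) := by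
        exact_mod_cast h5
      linarith
    · push Not at hs
      obtain ⟨w, hw, hwl⟩ := hs
      have hul : 2 ^ κ ≤ u.numEdges := hwl.trans (hmax w hw)
      have h2 := pot_foldr_push (κ := κ) false (l.map (fun v => v.entry.light a) ++
        u.entry.heavy a :: r.map (fun v => v.entry.light a))
      rw [h1] at h2
      have h3 := pot_collapse (κ := κ) (o := false) hso
      have hheavy : ¬ (u.entry.heavy a).Large κ := by
        have h2 : 2 ^ 1 ≤ 2 ^ κ := Nat.pow_le_pow_right (by norm_num) hκ
        simp only [Large, Entry.heavy, size]; omega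
      have hl := pot_map_light (κ := κ) hκ a l
      have hr := pot_map_light (κ := κ) hκ a r
      have e0 : pot κ ([] : List (TopTree α)) = 0 := by simp [pot]
      have e1 : pot κ [u.entry.heavy a] = 0 := by
        rw [pot_cons, e0, (fresh_eq_zero hheavy).1, (fresh_eq_zero hheavy).2]; simp
      rw [List.map_append, List.map_cons, List.sum_append, List.sum_cons, e1, if_neg hheavy] at h2
      -- all light children together
      have hall : ∀ m : List (LTree α), (∀ v ∈ m, v ∈ l ++ r) →
          2 ^ κ * (m.map fun v =>
            pot κ v.entry.stack + 4 * if 2 ^ κ ≤ v.numEdges then (1 : ℤ) else 0).sum +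
            3 * 2 ^ κ * (m.map fun v => if 2 ^ κ ≤ v.numEdges then (1 : ℤ) else 0).sum ≤
          7 * ((m.map fun v => v.numEdges + 1).sum : ℕ) := by
        intro m
        induction m with
        | nil => simp
        | cons v m ihm =>
          intro hm
          have h4 := ihm fun x hx => hm x (by simp [hx])
          have h5 := ih v (by
            have := hm v (by simp)
            rw [hts']; simp only [List.mem_append, List.mem_cons] at this ⊢; tauto)
          simp only [List.map_cons, List.sum_cons]
          push_cast at h4 ⊢
          split_ifs with hv
          · have h6 : ((v.numEdges - 2 ^ κ : ℕ) : ℤ) = v.numEdges - 2 ^ κ := by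
              rw [Nat.cast_sub hv]; simp
            rw [h6] at h5
            nlinarith
          · have h6 : v.numEdges - 2 ^ κ = 0 := by omega
            rw [h6] at h5
            have : (0 : ℤ) ≤ v.numEdges := by positivity
            push_cast at h5
            nlinarith
      have hal := hall l fun v hv => by simp [hv]
      have har := hall r fun v hv => by simp [hv]
      have hone : 1 ≤ (l.map fun v => if 2 ^ κ ≤ v.numEdges then (1 : ℤ) else 0).sum +
          (r.map fun v => if 2 ^ κ ≤ v.numEdges then (1 : ℤ) else 0).sum := by
        rw [← List.sum_append, ← List.map_append]
        have h5 : (1 : ℤ) ∈ (l ++ r).map fun v => if 2 ^ κ ≤ v.numEdges then (1 : ℤ) else 0 :=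
          List.mem_map.2 ⟨w, hw, if_pos hwl⟩
        refine List.single_le_sum ?_ _ h5
        intro x hx
        obtain ⟨v, -, rfl⟩ := List.mem_map.1 hx
        split_ifs <;> simp
      have hx1 : ((if (collapse false c S).Large κ then 1 else 0 : ℕ) : ℤ) ≤ 1 := by
        split_ifs <;> simp
      have e2 : ((u.numEdges - 2 ^ κ : ℕ) : ℤ) = u.numEdges - 2 ^ κ := by
        rw [Nat.cast_sub hul]; simp
      have e3 : (((node a ts).numEdges - 2 ^ κ : ℕ) : ℤ) = (node a ts).numEdges - 2 ^ κ := by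
        rw [Nat.cast_sub (by omega)]; simp
      rw [e2] at hu
      rw [e3, hne]
      rw [List.map_append, List.sum_append]
      have hx2 : (if (collapse false c S).Large κ then (1 : ℤ) else 0) ≤ 1 := by
        split_ifs <;> simp
      have hfin : pot κ (node a ts).entry.stack ≤
          (l.map fun v => pot κ v.entry.stack + 4 * if 2 ^ κ ≤ v.numEdges then (1 : ℤ) else 0).sum +
          (r.map fun v => pot κ v.entry.stack + 4 * if 2 ^ κ ≤ v.numEdges then (1 : ℤ) else 0).sum +
          pot κ u.entry.stack + 3 * ((l.map fun v => if 2 ^ κ ≤ v.numEdges then (1 : ℤ) else 0).sum +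
          (r.map fun v => if 2 ^ κ ≤ v.numEdges then (1 : ℤ) else 0).sum) := by
        rw [pot_cons, e0] at h3
        omega
      have hfin' := mul_le_mul_of_nonneg_left hfin hK.le
      push_cast at hal har ⊢
      linarith

/-- There are only few large clusters in the top tree. -/
theorem countP_large_topTree (hκ : 1 ≤ κ) {t : LTree α} (h : 1 ≤ t.numEdges) :
    2 ^ κ * t.topTree.subtrees.countP (fun y => y.Large κ) ≤ 15 * t.numEdges := by
  by_cases hbig : t.topTree.Large κ
  · have hsz := topTree_size h
    have h1 := countP_large_le hκ t.topTree
    have h2 := fresh_mul_le (κ := κ) t.topTree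
    have h3 := pot_entry hκ t
    have hle : 2 ^ κ ≤ t.numEdges := by rw [Large, hsz] at hbig; exact hbig
    rw [Nat.cast_sub hle] at h3
    obtain ⟨c, S, hS⟩ := exists_stack h
    have h4 := pot_collapse (κ := κ) (o := true) (hS ▸ entry_sorted t)
    rw [← hS, ← topTree_eq hS, if_pos hbig, pot_cons] at h4
    have e0 : pot κ ([] : List (TopTree α)) = 0 := by simp [pot]
    rw [e0] at h4
    rw [hsz] at h2
    have hK : (0 : ℤ) < 2 ^ κ := by positivity
    zify at h1 h2 ⊢
    have h5 := mul_le_mul_of_nonneg_left h4 hK.le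
    have h6 := mul_le_mul_of_nonneg_left h1 hK.le
    push_cast at h3
    linarith
  · have : t.topTree.subtrees.countP (fun y => y.Large κ) = 0 := by
      rw [List.countP_eq_zero]
      intro y hy
      have : ∀ (x y : TopTree α), y ∈ x.subtrees → y.size ≤ x.size := by
        intro x
        induction x using merge_induct with
        | hl a b r => intro y hy; rw [List.mem_singleton.1 (show y ∈ [TopTree.leaf a b r] from hy)]
        | hm o x z hx hz =>
          intro y hy
          rw [subtrees_merge, List.mem_cons, List.mem_append] at hy
          rcases hy with rfl | hy | hy
          · exact le_rfl
          · have := hx y hy; rw [size_merge]; omega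
          · have := hz y hy; rw [size_merge]; omega
      have h1 := this _ y hy
      rw [Large] at hbig
      rw [decide_eq_true_eq, Large]; omega
    rw [this]; simp

end LTree

/-! ### The number of small clusters and the size bound -/

namespace TopTree

variable {s : ℕ}

/-- The nodes of a top tree in preorder, each with the label that it carries. -/
def code : TopTree (Fin s) → List (Bool ⊕ (Fin s × Fin s × Bool))
  | leaf a b r => [.inr (a, b, r)]
  | vert x y => .inl true :: (x.code ++ y.code)
  | horiz x y => .inl false :: (x.code ++ y.code)

theorem length_code (x : TopTree (Fin s)) : x.code.length + 1 = 2 * x.size := by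
  induction x with
  | leaf => simp [code, size]
  | vert x y hx hy | horiz x y hx hy =>
    simp only [code, size, List.length_cons, List.length_append]; omega

/-- The code is prefix-free, hence injective. -/
theorem code_append_injective {x y : TopTree (Fin s)} {u v : List (Bool ⊕ (Fin s × Fin s × Bool))}
    (h : x.code ++ u = y.code ++ v) : x = y ∧ u = v := by
  induction x generalizing y u v with
  | leaf a b r =>
    cases y <;> simp [code] at h ⊢
    obtain ⟨⟨rfl, rfl, rfl⟩, rfl⟩ := h
    simp
  | vert x x' hx hx' =>
    cases y with
    | leaf => simp [code] at h
    | horiz => simp [code] at h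
    | vert y y' =>
      simp only [code, List.cons_append, List.append_assoc, List.cons.injEq, true_and] at h
      obtain ⟨rfl, h1⟩ := hx h
      obtain ⟨rfl, h2⟩ := hx' h1
      exact ⟨rfl, h2⟩
  | horiz x x' hx hx' =>
    cases y with
    | leaf => simp [code] at h
    | vert => simp [code] at h
    | horiz y y' =>
      simp only [code, List.cons_append, List.append_assoc, List.cons.injEq, true_and] at h
      obtain ⟨rfl, h1⟩ := hx h
      obtain ⟨rfl, h2⟩ := hx' h1
      exact ⟨rfl, h2⟩

/-- Clusters below the threshold `2 ^ κ` are counted by their preorder codes, which are shorter than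
`2 * 2 ^ κ`. -/
theorem card_small_le (κ : ℕ) (N : Finset (TopTree (Fin s))) (hN : ∀ x ∈ N, ¬ x.Large κ) :
    N.card ≤ (max s 2) ^ (8 * 2 ^ κ) := by
  have h1 : N.card ≤ Fintype.card (Fin (2 * 2 ^ κ) → Option (Bool ⊕ (Fin s × Fin s × Bool))) := by
    rw [← Finset.card_univ]
    refine Finset.card_le_card_of_injOn (fun x i => x.code[(i : ℕ)]?) (fun _ _ => by simp) ?_
    intro x hx y hy hxy
    have hx' := hN x hx
    have hy' := hN y hy
    have lx := x.length_code
    have ly := y.length_code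
    rw [Large] at hx' hy'
    have hcode : x.code = y.code := by
      refine List.ext_getElem? fun i => ?_
      by_cases hi : i < 2 * 2 ^ κ
      · exact congrFun hxy ⟨i, hi⟩
      · rw [List.getElem?_eq_none (by omega), List.getElem?_eq_none (by omega)]
    exact (code_append_injective (u := []) (v := []) (by rw [hcode])).1
  refine h1.trans ?_
  simp only [Fintype.card_fun, Fintype.card_option, Fintype.card_sum, Fintype.card_prod,
    Fintype.card_bool, Fintype.card_fin]
  rw [show 8 * 2 ^ κ = 4 * (2 * 2 ^ κ) by ring, pow_mul _ 4]
  refine Nat.pow_le_pow_left ?_ _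
  have h2 : 2 ≤ max s 2 := le_max_right _ _
  have h3 : s ≤ max s 2 := le_max_left _ _
  generalize max s 2 = m at *
  have h4 : s * s ≤ m * m := Nat.mul_le_mul h3 h3
  have h5 : 4 ≤ m * m := Nat.mul_le_mul h2 h2
  have h6 : (m * m) * 4 ≤ (m * m) * (m * m) := Nat.mul_le_mul_left _ h5
  have h7 : m ^ 4 = (m * m) * (m * m) := by ring
  have h8 : s * (s * 2) = 2 * (s * s) := by ring
  rw [h7, h8]; omega

end TopTree

namespace LTree

variable {s : ℕ}

open TopTree in
/-- The number of different clusters of the top tree, with the threshold left open: few different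
small clusters and few large ones. -/
theorem topTree_dagSize_le_add {κ : ℕ} (hκ : 1 ≤ κ) {t : LTree (Fin s)} (h : 1 ≤ t.numEdges) :
    ∃ B, t.topTree.dagSize ≤ 3 * ((max s 2) ^ (8 * 2 ^ κ) + B) ∧ 2 ^ κ * B ≤ 15 * t.numEdges := by
  classical
  refine ⟨_, (dagSize_le _).trans (Nat.mul_le_mul_left 3 ?_), countP_large_topTree hκ h⟩
  rw [← Finset.card_filter_add_card_filter_not (fun y : TopTree (Fin s) => ¬ y.Large κ)]
  refine add_le_add (card_small_le κ _ fun x hx => (Finset.mem_filter.1 hx).2) ?_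
  rw [List.countP_eq_length_filter]
  refine (Finset.card_le_card fun x hx => ?_).trans (List.toFinset_card_le _)
  simpa using hx

theorem topTree_dagSize_le_logb {t : LTree (Fin s)} (h : 2 ≤ t.numEdges) :
    (t.topTree.dagSize : ℝ) ≤ 1500 * (t.numEdges / Real.logb (max s 2 : ℕ) t.numEdges) := by
  set n := t.numEdges with hn
  set σ : ℕ := max s 2 with hσ
  have hσ2 : 2 ≤ σ := le_max_right _ _
  have hσ1 : (1 : ℝ) < σ := by exact_mod_cast (by omega : 1 < σ)
  have hn2 : (2 : ℝ) ≤ n := by exact_mod_cast h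
  set x := Real.logb σ n with hx
  have hx0 : 0 < x := Real.logb_pos hσ1 (by linarith)
  have hn0 : (0 : ℝ) < n := by linarith
  rcases le_total x 64 with hx64 | hx64
  · have h1 : (t.topTree.dagSize : ℝ) ≤ 6 * n := by
      have := t.topTree.dagSize_le_size
      rw [topTree_size (by omega)] at this
      exact_mod_cast this
    have h2 : (6 : ℝ) * n ≤ 384 * (n / x) := by
      rw [mul_div_assoc', le_div_iff₀ hx0]
      nlinarith
    have h3 : 0 ≤ (n : ℝ) / x := by positivity
    linarith
  · set m := ⌊x / 16⌋₊ with hm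
    have hm4 : 4 ≤ m := Nat.le_floor (by push_cast; linarith)
    set κ := Nat.log 2 m with hκ
    have hκ1 : 1 ≤ κ := Nat.le_log_of_pow_le (by norm_num) (by omega)
    have hK1 : 2 ^ κ ≤ m := Nat.pow_log_le_self 2 (by omega)
    have hK2 : m < 2 ^ (κ + 1) := Nat.lt_pow_succ_log_self (by norm_num) m
    have hmx : (m : ℝ) ≤ x / 16 := Nat.floor_le (by positivity)
    have hxm : x / 16 < m + 1 := Nat.lt_floor_add_one _
    have hKx : ((2 ^ κ : ℕ) : ℝ) ≤ x / 16 := (Nat.cast_le.2 hK1).trans hmx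
    have hxK : x / 32 ≤ ((2 ^ κ : ℕ) : ℝ) := by
      have : ((m + 1 : ℕ) : ℝ) ≤ ((2 ^ (κ + 1) : ℕ) : ℝ) := Nat.cast_le.2 hK2
      rw [pow_succ] at this
      push_cast at this ⊢
      linarith
    obtain ⟨B, h1, h2⟩ := topTree_dagSize_le_add hκ1 (t := t) (by omega)
    have hsq : Real.sqrt n ≤ 4 * (n / x) := by
      have h3 : x ≤ 4 * Real.sqrt n := by
        have h4 : Real.log n ≤ 2 * Real.sqrt n := by
          have h5 := Real.log_le_sub_one_of_pos (Real.sqrt_pos.2 hn0)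
          rw [Real.log_sqrt hn0.le] at h5
          linarith
        have h6 : (1 : ℝ) / 2 ≤ Real.log σ := by
          have h7 := Real.log_two_gt_d9
          have h8 : Real.log 2 ≤ Real.log σ :=
            Real.log_le_log (by norm_num) (by exact_mod_cast hσ2)
          linarith
        rw [hx, Real.logb, div_le_iff₀ (by linarith)]
        have := Real.sqrt_nonneg n
        nlinarith
      rw [mul_div_assoc', le_div_iff₀ hx0]
      have h4 := Real.sqrt_nonneg n
      have h5 := Real.mul_self_sqrt hn0.le
      nlinarith
    have hsmall : ((σ ^ (8 * 2 ^ κ) : ℕ) : ℝ) ≤ Real.sqrt n := by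
      have h3 : ((8 * 2 ^ κ : ℕ) : ℝ) ≤ x * (1 / 2) := by
        push_cast at hKx ⊢; linarith
      rw [Nat.cast_pow, ← Real.rpow_natCast]
      refine (Real.rpow_le_rpow_of_exponent_le hσ1.le h3).trans ?_
      rw [Real.rpow_mul (by linarith), hx, Real.rpow_logb (by linarith) hσ1.ne' hn0,
        Real.sqrt_eq_rpow]
    have hB : (B : ℝ) ≤ 480 * (n / x) := by
      have h3 : ((2 ^ κ : ℕ) : ℝ) * B ≤ 15 * n := by exact_mod_cast h2
      have h4 : (0 : ℝ) ≤ B := by positivity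
      rw [mul_div_assoc', le_div_iff₀ hx0]
      nlinarith
    have h4 : (t.topTree.dagSize : ℝ) ≤ 3 * (((σ ^ (8 * 2 ^ κ) : ℕ) : ℝ) + B) := by
      exact_mod_cast h1
    have h5 : 0 ≤ (n : ℝ) / x := by positivity
    linarith

theorem natLog_le_log {n : ℕ} (hn : 2 ≤ n) : (Nat.log 2 n : ℝ) ≤ 2 * Real.log n := by
  have h1 : ((2 ^ Nat.log 2 n : ℕ) : ℝ) ≤ n := Nat.cast_le.2 (Nat.pow_log_le_self 2 (by omega))
  have h2 := Real.log_le_log (by positivity) h1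
  rw [Nat.cast_pow, Real.log_pow] at h2
  have h3 := Real.log_two_gt_d9
  push_cast at h2
  have : (0 : ℝ) ≤ Nat.log 2 n := by positivity
  nlinarith

theorem topTree_dagSize_le_dagSize {t : LTree (Fin s)} (h : 2 ≤ t.numEdges) :
    (t.topTree.dagSize : ℝ) ≤ 100 * (t.dagSize * Real.log t.numEdges) := by
  have h1 := topTree_dagSize_le (t := t) (by omega)
  have h2 := natLog_le_log h
  have h3 : (t.topTree.dagSize : ℝ) ≤ 3 * (t.dagSize * (Nat.log 2 t.numEdges + 5) +
    Nat.log 2 t.numEdges) := by exact_mod_cast h1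
  have h4 : (1 : ℝ) ≤ 2 * Real.log t.numEdges := by
    refine le_trans ?_ h2
    exact_mod_cast Nat.le_log_of_pow_le (by norm_num) (by omega)
  have h5 : (1 : ℝ) ≤ t.dagSize := by
    have : 1 ≤ t.dagSize := by
      classical
      rw [dagSize]
      calc 1 ≤ 1 + t.degree := by omega
        _ ≤ _ := Finset.single_le_sum (f := fun s : LTree (Fin s) => 1 + s.degree) (by simp)
          (List.mem_toFinset.2 t.self_mem_subtrees)
    exact_mod_cast this
  have h6 : (0 : ℝ) ≤ Nat.log 2 t.numEdges := by positivity
  nlinarith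

theorem topTree_height_le_log {t : LTree (Fin s)} (h : 1 ≤ t.numEdges) :
    (t.topTree.height : ℝ) ≤ 100 * Real.log t.numEdges := by
  rcases h.eq_or_lt with h | h
  · have h1 := t.topTree.height_lt_size
    rw [topTree_size h.le, ← h] at h1
    have : t.topTree.height = 0 := by omega
    rw [this, ← h]; simp
  · have h1 := topTree_height_le h.le
    have h2 := natLog_le_log h
    have h3 : (t.topTree.height : ℝ) ≤ 7 * Nat.log 2 t.numEdges + 4 := by exact_mod_cast h1
    have h4 : (1 : ℝ) ≤ Nat.log 2 t.numEdges := by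
      exact_mod_cast Nat.le_log_of_pow_le (by norm_num) (by omega)
    linarith

end LTree

/-! ### A calculus of weakest preconditions for programs with variables and arrays -/

namespace Ram

/-- The variables of the program. The registers `0`, `1` and `2` are reserved: the first one
holds the distance between the arrays, the others serve as scratch space. -/
inductive Var : Type
  | modulus | zero | one | two | three | four | count | cells | node | top
  | w0 | w1 | w2 | w3 | size | power | tmp | key | id
  | oper | bound | head | item | acc | stk
  | lab | clab | deg | base | child | hmax | hpos | hstk | total | row
  deriving DecidableEq

/-- The register of a variable. -/
def Var.reg (x : Var) : ℕ := x.ctorIdx + 3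

theorem Var.reg_inj {x y : Var} : x.reg = y.reg ↔ x = y := by
  refine ⟨fun h => ?_, fun h => h ▸ rfl⟩
  have h' : x.ctorIdx = y.ctorIdx := Nat.add_right_cancel h
  revert h'
  cases x <;> cases y <;> first | exact fun _ => rfl | exact fun h => absurd h (by decide)

/-- The arrays of the program: the input, the output, the dictionary of the records, the sizes of the
clusters and the powers of two below them, the cells of the linked lists (cluster, power of two,
next cell), and the pending entries (label, size, linked list). -/
inductive Arr : Type
  | inp | out | dict | sz | pw | cid | cpw | cnext | plab | psz | pstk
  deriving DecidableEq

/-- The position of an array in the memory: the array starts at the address `A.idx * D`. -/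
def Arr.idx (A : Arr) : ℕ := A.ctorIdx

theorem Arr.idx_lt (A : Arr) : A.idx < 16 := by cases A <;> decide

theorem Arr.idx_inj {A B : Arr} (h : A.idx = B.idx) : A = B := by
  revert h
  cases A <;> cases B <;> first | exact fun _ => rfl | exact fun h => absurd h (by decide)

/-- The abstract state: variables, arrays, and an upper bound for the number of steps so far. -/
structure St : Type where
  /-- the values of the variables -/
  v : Var → ℕ
  /-- the contents of the arrays -/
  m : Arr → ℕ → ℕ
  /-- the clock -/
  clk : ℕ

namespace St

/-- Assign a value to a variable. -/
def set (s : St) (x : Var) (n : ℕ) : St := { s with v := fun y => if y = x then n else s.v y }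

/-- Write into an array. -/
def put (s : St) (A : Arr) (i n : ℕ) : St :=
  { s with m := fun B => if B = A then Function.update (s.m A) i n else s.m B }

/-- Advance the clock. -/
def tick (s : St) (k : ℕ) : St := { s with clk := s.clk + k }

variable (s : St) (x y : Var) (A B : Arr) (i j n k : ℕ)

@[simp] theorem set_v : (s.set x n).v y = if y = x then n else s.v y := rfl
@[simp] theorem set_m : (s.set x n).m = s.m := rfl
@[simp] theorem set_clk : (s.set x n).clk = s.clk := rfl
@[simp] theorem put_v : (s.put A i n).v = s.v := rfl
@[simp] theorem put_m : (s.put A i n).m B = if B = A then Function.update (s.m A) i n else s.m B :=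
  rfl
@[simp] theorem put_clk : (s.put A i n).clk = s.clk := rfl
@[simp] theorem tick_v : (s.tick k).v = s.v := rfl
@[simp] theorem tick_m : (s.tick k).m = s.m := rfl
@[simp] theorem tick_clk : (s.tick k).clk = s.clk + k := rfl

end St

/-- The store `σ` represents the abstract state `s`, where the arrays have length `D` and all words
are smaller than `W`. -/
structure Repr (D W : ℕ) (s : St) (σ : Store) : Prop where
  dist : σ.reg 0 = D
  var : ∀ x : Var, σ.reg x.reg = s.v x
  var_lt : ∀ x : Var, s.v x < W
  arr : ∀ (A : Arr) (i : ℕ), i < D → σ.mem (A.idx * D + i) = s.m A i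
  arr_lt : ∀ (A : Arr) (i : ℕ), i < D → s.m A i < W

/-- The weakest precondition: started in a store that represents `s`, the program halts, within
the time shown by the clock, in a store that represents a state with the property `Q`. -/
def WP (D W : ℕ) (p : Prog) (s : St) (Q : St → Prop) : Prop :=
  ∃ s', (s.clk ≤ s'.clk ∧ ∀ σ, Repr D W s σ →
    ∃ τ k, Exec W p σ τ k ∧ s.clk + k ≤ s'.clk ∧ Repr D W s' τ) ∧ Q s'

/-- Sequential composition of programs. -/
infixr:60 " ;; " => Prog.seq

/-- Assign a constant. -/
def setc (x : Var) (n : ℕ) : Prog := .const x.reg n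

/-- Addition of two variables. -/
def add (x y z : Var) : Prog := .arith .add x.reg y.reg z.reg

/-- Subtraction of two variables. -/
def sub (x y z : Var) : Prog := .arith .sub x.reg y.reg z.reg

/-- Multiplication of two variables. -/
def mul (x y z : Var) : Prog := .arith .mul x.reg y.reg z.reg

/-- Copy a variable, provided that the variable `zero` has the value `0`. -/
def mov (x y : Var) : Prog := .arith .add x.reg y.reg Var.zero.reg

/-- Compute the address of an element of an array in register `1`. -/
def addr (A : Arr) (y : Var) : Prog := .const 1 A.idx ;; .arith .mul 1 1 0 ;; .arith .add 1 1 y.reg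

/-- Read from an array. -/
def ld (x : Var) (A : Arr) (y : Var) : Prog := addr A y ;; .load x.reg 1

/-- Write into an array. -/
def st (A : Arr) (y x : Var) : Prog := addr A y ;; .store 1 x.reg

/-- Tests on variables. -/
inductive Cond : Type
  | lt (x y : Var) | eq (x y : Var) | ne (x y : Var)

/-- The truth of a test in an abstract state. -/
def Cond.Holds (s : St) : Cond → Prop
  | lt x y => s.v x < s.v y
  | eq x y => s.v x = s.v y
  | ne x y => s.v x ≠ s.v y

/-- The test of the machine. -/
def Cond.test : Cond → Test
  | lt x y => .lt x.reg y.reg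
  | eq x y => .eq x.reg y.reg
  | ne x y => .ne x.reg y.reg

/-- Conditional. -/
def cond (c : Cond) (p q : Prog) : Prog := .ite c.test p q

/-- Loop. -/
def loop (c : Cond) (p : Prog) : Prog := .loop c.test p

variable {D W : ℕ} {s : St} {σ : Store} {Q : St → Prop}

theorem Repr.holds (h : Repr D W s σ) (c : Cond) : c.test.Holds σ ↔ c.Holds s := by
  cases c <;> simp [Cond.test, Test.Holds, Cond.Holds, h.var]

theorem Repr.tick (h : Repr D W s σ) (k : ℕ) : Repr D W (s.tick k) σ := ⟨h.1, h.2, h.3, h.4, h.5⟩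

theorem reg_ne (x : Var) : (0 : ℕ) ≠ x.reg ∧ (1 : ℕ) ≠ x.reg := by
  unfold Var.reg; omega

theorem Repr.set (h : Repr D W s σ) (x : Var) {n : ℕ} (hn : n < W) :
    Repr D W (s.set x n) ⟨Function.update σ.reg x.reg n, σ.mem⟩ where
  dist := by simp [Function.update_of_ne (reg_ne x).1, h.dist]
  var y := by simp [Function.update_apply, Var.reg_inj, h.var]
  var_lt y := by
    have := h.var_lt y
    rw [St.set_v]; split_ifs <;> assumption
  arr := h.arr
  arr_lt := h.arr_lt

theorem Repr.scratch (h : Repr D W s σ) (n : ℕ) :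
    Repr D W s ⟨Function.update σ.reg 1 n, σ.mem⟩ where
  dist := by simp [h.dist]
  var y := by simp [Function.update_of_ne (reg_ne y).2.symm, h.var]
  var_lt := h.var_lt
  arr := h.arr
  arr_lt := h.arr_lt

theorem Repr.put (h : Repr D W s σ) (A : Arr) {i n : ℕ} (hi : i < D) (hn : n < W) :
    Repr D W (s.put A i n) ⟨σ.reg, Function.update σ.mem (A.idx * D + i) n⟩ where
  dist := h.dist
  var := h.var
  var_lt := h.var_lt
  arr B j hj := by
    have h1 := h.arr B j hj
    rw [St.put_m]
    split_ifs with hB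
    · subst hB
      simp only [Function.update_apply]
      have : B.idx * D + j = B.idx * D + i ↔ j = i := by omega
      simp only [this, h1]
    · refine (Function.update_of_ne (fun he => hB ?_) _ _).trans h1
      have hD : 0 < D := by omega
      have h2 := congrArg (· / D) he
      simp only [mul_comm _ D, Nat.mul_add_div hD, Nat.div_eq_of_lt hi, Nat.div_eq_of_lt hj,
        add_zero] at h2
      exact Arr.idx_inj h2
  arr_lt B j hj := by
    have h1 := h.arr_lt B j hj
    rw [St.put_m]
    split_ifs with hB
    · subst hB
      rw [Function.update_apply]
      split_ifs <;> assumption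
    · exact h1

namespace WP

theorem skip (h : Q (s.tick 1)) : WP D W .skip s Q :=
  ⟨_, ⟨Nat.le_succ _, fun σ hσ => ⟨σ, 1, .skip σ, le_rfl, hσ.tick 1⟩⟩, h⟩

theorem seq {p q : Prog} (h : WP D W p s fun s' => WP D W q s' Q) : WP D W (p ;; q) s Q := by
  obtain ⟨s', ⟨h1, h2⟩, s'', ⟨h3, h4⟩, hQ⟩ := h
  refine ⟨s'', ⟨h1.trans h3, fun σ hσ => ?_⟩, hQ⟩
  obtain ⟨τ, k, he, hk, hτ⟩ := h2 σ hσ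
  obtain ⟨υ, l, he', hl, hυ⟩ := h4 τ hτ
  exact ⟨υ, k + l, .seq he he', by omega, hυ⟩

theorem setc {x : Var} {n : ℕ} (hn : n < W) (h : Q ((s.set x n).tick 1)) :
    WP D W (setc x n) s Q :=
  ⟨_, ⟨Nat.le_succ _, fun σ hσ => ⟨_, 1, .const σ _ _ hn, le_rfl, (hσ.set x hn).tick 1⟩⟩, h⟩

theorem arith {op : ArithOp} {x y z : Var} {n : ℕ} (he : op.eval (s.v y) (s.v z) = n) (hn : n < W)
    (h : Q ((s.set x n).tick 1)) : WP D W (.arith op x.reg y.reg z.reg) s Q := by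
  subst he
  refine ⟨_, ⟨Nat.le_succ _, fun σ hσ => ?_⟩, h⟩
  rw [← hσ.var y, ← hσ.var z] at hn ⊢
  exact ⟨_, 1, .arith σ op _ _ _ hn, le_rfl, (hσ.set x hn).tick 1⟩

theorem add {x y z : Var} (n : ℕ) (he : s.v y + s.v z = n) (hn : n < W)
    (h : Q ((s.set x n).tick 1)) : WP D W (add x y z) s Q := arith (op := .add) he hn h

theorem sub {x y z : Var} (n : ℕ) (he : s.v y - s.v z = n) (hn : n < W)
    (h : Q ((s.set x n).tick 1)) : WP D W (sub x y z) s Q := arith (op := .sub) he hn h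

theorem mul {x y z : Var} (n : ℕ) (he : s.v y * s.v z = n) (hn : n < W)
    (h : Q ((s.set x n).tick 1)) : WP D W (mul x y z) s Q := arith (op := .mul) he hn h

theorem mov {x y : Var} (n : ℕ) (h0 : s.v .zero = 0) (hn : s.v y = n) (h : Q ((s.set x n).tick 1)) :
    WP D W (mov x y) s Q := by
  subst hn
  refine ⟨_, ⟨Nat.le_succ _, fun σ hσ => ?_⟩, h⟩
  have hy := hσ.var_lt y
  have he : ArithOp.add.eval (σ.reg y.reg) (σ.reg Var.zero.reg) = s.v y := by
    simp [ArithOp.eval, hσ.var, h0]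
  refine ⟨_, 1, .arith σ .add _ _ _ (he ▸ hy), le_rfl, ?_⟩
  rw [he]
  exact (hσ.set x hy).tick 1

theorem exec_addr (hW : 16 * D ≤ W) (h16 : 16 < W) {A : Arr} {y : Var} (hy : s.v y < D)
    (hσ : Repr D W s σ) :
    ∃ τ, Exec W (addr A y) σ τ 3 ∧ Repr D W s τ ∧ τ.reg 1 = A.idx * D + s.v y := by
  have hA := A.idx_lt
  have hmul : (A.idx + 1) * D ≤ 16 * D := Nat.mul_le_mul_right D hA
  rw [add_mul, one_mul] at hmul
  have e1 := Exec.const σ 1 A.idx (hA.trans h16)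
  have e2 := Exec.arith (W := W) ⟨Function.update σ.reg 1 A.idx, σ.mem⟩ .mul 1 1 0
    (by simp [ArithOp.eval, hσ.dist]; omega)
  have r2 := (hσ.scratch A.idx).scratch (A.idx * D)
  have e3 := Exec.arith (W := W) ⟨Function.update (Function.update σ.reg 1 A.idx) 1 (A.idx * D),
    σ.mem⟩ .add 1 1 y.reg (by rw [r2.var]; simp [ArithOp.eval]; omega)
  simp only [ArithOp.eval, Function.update_self, ne_eq, zero_ne_one, not_false_eq_true,
    Function.update_of_ne, hσ.dist] at e2 e3
  refine ⟨_, .seq e1 (.seq e2 e3), r2.scratch _, ?_⟩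
  simp [Function.update_of_ne (reg_ne y).2.symm, hσ.var]

theorem ld (hW : 16 * D ≤ W) (h16 : 16 < W) {x : Var} {A : Arr} {y : Var} (i n : ℕ)
    (hi : s.v y = i) (hy : i < D) (hn : s.m A i = n) (h : Q ((s.set x n).tick 4)) :
    WP D W (ld x A y) s Q := by
  subst hi hn
  refine ⟨_, ⟨by simp, fun σ hσ => ?_⟩, h⟩
  obtain ⟨τ, he, hτ, ha⟩ := exec_addr hW h16 (A := A) hy hσ
  have h1 := hτ.arr A _ hy
  have h2 := hτ.arr_lt A _ hy
  rw [← ha] at h1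
  rw [← h1] at h2 ⊢
  exact ⟨_, 4, .seq he (.load τ _ _ h2), le_rfl, (hτ.set x h2).tick 4⟩

theorem st (hW : 16 * D ≤ W) (h16 : 16 < W) {x : Var} {A : Arr} {y : Var} (i n : ℕ)
    (hi : s.v y = i) (hy : i < D) (hn : s.v x = n) (h : Q ((s.put A i n).tick 4)) :
    WP D W (st A y x) s Q := by
  subst hi hn
  refine ⟨_, ⟨by simp, fun σ hσ => ?_⟩, h⟩
  obtain ⟨τ, he, hτ, ha⟩ := exec_addr hW h16 (A := A) hy hσ
  refine ⟨_, 4, .seq he (.store τ 1 x.reg), le_rfl, ?_⟩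
  rw [ha, hτ.var]
  exact (hτ.put A hy (hτ.var_lt x)).tick 4

theorem cond {c : Cond} {p q : Prog} (hp : c.Holds s → WP D W p (s.tick 1) Q)
    (hq : ¬ c.Holds s → WP D W q (s.tick 1) Q) : WP D W (cond c p q) s Q := by
  by_cases hc : c.Holds s
  · obtain ⟨s', ⟨h1, h2⟩, hQ⟩ := hp hc
    refine ⟨s', ⟨(Nat.le_succ _).trans h1, fun σ hσ => ?_⟩, hQ⟩
    obtain ⟨τ, k, he, hk, hτ⟩ := h2 σ (hσ.tick 1)
    exact ⟨τ, k + 1, .ite_true q ((hσ.holds c).2 hc) he, by simp at hk; omega, hτ⟩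
  · obtain ⟨s', ⟨h1, h2⟩, hQ⟩ := hq hc
    refine ⟨s', ⟨(Nat.le_succ _).trans h1, fun σ hσ => ?_⟩, hQ⟩
    obtain ⟨τ, k, he, hk, hτ⟩ := h2 σ (hσ.tick 1)
    exact ⟨τ, k + 1, .ite_false p (fun h => hc ((hσ.holds c).1 h)) he, by simp at hk; omega, hτ⟩

/-- A conditional assignment. -/
theorem cond_mov {c : Cond} {x y : Var} (n : ℕ) (h0 : s.v .zero = 0) (h1 : c.Holds s → s.v y = n)
    (h2 : ¬ c.Holds s → s.v x = n) (h : Q ((s.set x n).tick 2)) :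
    WP D W (Ram.cond c (Ram.mov x y) .skip) s Q := by
  refine .cond (fun hc => .mov n h0 (h1 hc) h) (fun hc => .skip ?_)
  have : s.set x n = s := by
    rw [← h2 hc, St.set]
    congr
    funext z
    split_ifs with hz
    · rw [hz]
    · rfl
  rwa [this] at h

theorem cond_not_mov {c : Cond} {x y : Var} (n : ℕ) (h0 : s.v .zero = 0)
    (h1 : ¬ c.Holds s → s.v y = n) (h2 : c.Holds s → s.v x = n) (h : Q ((s.set x n).tick 2)) :
    WP D W (Ram.cond c .skip (Ram.mov x y)) s Q := by
  refine .cond (fun hc => .skip ?_) (fun hc => .mov n h0 (h1 hc) h)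
  have : s.set x n = s := by
    rw [← h2 hc, St.set]
    congr
    funext z
    split_ifs with hz
    · rw [hz]
    · rfl
  rwa [this] at h

theorem loop_false {c : Cond} {p : Prog} (hc : ¬ c.Holds s) (h : Q (s.tick 1)) :
    WP D W (loop c p) s Q :=
  ⟨_, ⟨Nat.le_succ _, fun σ hσ =>
    ⟨σ, 1, .loop_false p (fun h => hc ((hσ.holds c).1 h)), le_rfl, hσ.tick 1⟩⟩, h⟩

theorem loop_true {c : Cond} {p : Prog} (hc : c.Holds s)
    (h : WP D W p (s.tick 1) fun s' => WP D W (Ram.loop c p) s' Q) :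
    WP D W (Ram.loop c p) s Q := by
  obtain ⟨s', ⟨h1, h2⟩, s'', ⟨h3, h4⟩, hQ⟩ := h
  simp only [St.tick_clk] at h1 h2
  refine ⟨s'', ⟨by omega, fun σ hσ => ?_⟩, hQ⟩
  obtain ⟨τ, k, he, hk, hτ⟩ := h2 σ (hσ.tick 1)
  obtain ⟨υ, l, he', hl, hυ⟩ := h4 τ hτ
  exact ⟨υ, k + l + 1, .loop_true ((hσ.holds c).2 hc) he he', by omega, hυ⟩

end WP

end Ram

namespace Ram

open TopTree

variable {k : ℕ}

/-! ### The dag of the clusters in memory -/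

/-- The four words of the record of a top tree, if the nodes are numbered as in the list `L`. -/
def Words (L : List (TopTree (Fin k))) : TopTree (Fin k) → ℕ → ℕ → ℕ → ℕ → Prop
  | .leaf a b r, w0, w1, w2, w3 => w0 = 0 ∧ w1 = a ∧ w2 = b ∧ w3 = r.toNat
  | .vert x y, w0, w1, w2, w3 => w0 = 1 ∧ L[w1]? = some x ∧ L[w2]? = some y ∧ w3 = 0
  | .horiz x y, w0, w1, w2, w3 => w0 = 2 ∧ L[w1]? = some x ∧ L[w2]? = some y ∧ w3 = 0

/-- The position of a record in the dictionary, a table with two dimensions of size `M`. The kind of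
the record and the rank of an atomic cluster are combined to a number less than four. -/
def dictKey (M w0 w1 w2 w3 : ℕ) : ℕ := ((3 * w3 + w0) * M + w1) * M + w2

/-- The sizes of the memory: `M` bounds all numbers of nodes and cells, the labels and the
number of steps, `D` is the length of the arrays and `W` the bound for the words. -/
structure Bounds (D W M k : ℕ) : Prop where
  le_M : 16 ≤ M
  k_le : k ≤ M
  D_eq : 4 * M * M = D
  le_W : 16 * D ≤ W

namespace Bounds

variable {D W M : ℕ}

theorem lt_D (h : Bounds D W M k) {n : ℕ} (hn : n < 8 * M) : n < D := by
  have := Nat.mul_le_mul_left (4 * M) h.le_M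
  have := h.D_eq; have := h.le_M; omega

theorem lt_W (h : Bounds D W M k) {n : ℕ} (hn : n < 8 * M) : n < W := by
  have := h.lt_D hn; have := h.le_W; omega

theorem D_le (h : Bounds D W M k) : D ≤ W := by have := h.le_W; omega

theorem W_gt (h : Bounds D W M k) : 16 < W := h.lt_W (by have := h.le_M; omega)

end Bounds

/-- The list `L` contains the top trees that have been built. The dag that consists of them is in
memory, and it can be accessed by the dictionary. -/
structure Inv (M : ℕ) (s : St) (L : List (TopTree (Fin k))) : Prop where
  modulus : s.v .modulus = M
  zero : s.v .zero = 0
  one : s.v .one = 1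
  two : s.v .two = 2
  three : s.v .three = 3
  four : s.v .four = 4
  count : s.v .count = L.length
  count_le : L.length ≤ s.clk
  cells_le : s.v .cells ≤ s.clk
  nil : s.m .cpw 0 = M
  nodup : L.Nodup
  record : ∀ i T, L[i]? = some T → ∃ w0 w1 w2 w3, Words L T w0 w1 w2 w3 ∧
    s.m .out (2 + 4 * i) = w0 ∧ s.m .out (2 + 4 * i + 1) = w1 ∧ s.m .out (2 + 4 * i + 2) = w2 ∧
    s.m .out (2 + 4 * i + 3) = w3 ∧ s.m .dict (dictKey M w0 w1 w2 w3) = i + 1 ∧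
    s.m .sz i = T.size ∧ s.m .pw i = T.pw
  dict : ∀ n, s.m .dict n ≠ 0 → ∃ i T w0 w1 w2 w3, s.m .dict n = i + 1 ∧ L[i]? = some T ∧
    Words L T w0 w1 w2 w3 ∧ n = dictKey M w0 w1 w2 w3

theorem prefix_getElem? {L L' : List (TopTree (Fin k))} (h : L <+: L') {i : ℕ}
    {x : TopTree (Fin k)} (hx : L[i]? = some x) : L'[i]? = some x := by
  obtain ⟨R, rfl⟩ := h
  rw [List.getElem?_append_left (List.getElem?_eq_some_iff.1 hx).1, hx]

theorem Words.mono {L L' : List (TopTree (Fin k))} (h : L <+: L') {T : TopTree (Fin k)}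
    {w0 w1 w2 w3 : ℕ} (hT : Words L T w0 w1 w2 w3) : Words L' T w0 w1 w2 w3 := by
  cases T with
  | leaf => exact hT
  | vert | horiz => exact ⟨hT.1, prefix_getElem? h hT.2.1, prefix_getElem? h hT.2.2.1, hT.2.2.2⟩

theorem Words.bounds {L : List (TopTree (Fin k))} {M : ℕ} (hk : k ≤ M) (hL : L.length ≤ M)
    {T : TopTree (Fin k)} {w0 w1 w2 w3 : ℕ} (hT : Words L T w0 w1 w2 w3) :
    w0 ≤ 2 ∧ w1 < M ∧ w2 < M ∧ 3 * w3 + w0 ≤ 3 := by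
  cases T with
  | leaf a b r =>
    obtain ⟨rfl, rfl, rfl, rfl⟩ := hT
    have := a.2; have := b.2; have := r.toNat_lt
    omega
  | vert | horiz =>
    obtain ⟨rfl, h1, h2, rfl⟩ := hT
    have := (List.getElem?_eq_some_iff.1 h1).1
    have := (List.getElem?_eq_some_iff.1 h2).1
    omega

theorem Words.unique {L : List (TopTree (Fin k))} {T T' : TopTree (Fin k)} {w0 w1 w2 w3 : ℕ}
    (h : Words L T w0 w1 w2 w3) (h' : Words L T' w0 w1 w2 w3) : T = T' := by
  cases T with
  | leaf a b r =>
    obtain ⟨rfl, rfl, rfl, rfl⟩ := h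
    cases T' with
    | leaf a' b' r' =>
      obtain ⟨-, h1, h2, h3⟩ := h'
      have hr : r = r' := by revert h3; cases r <;> cases r' <;> simp
      rw [Fin.ext h1, Fin.ext h2, hr]
    | vert | horiz => exact absurd h'.1 (by norm_num)
  | vert x y =>
    obtain ⟨rfl, h1, h2, rfl⟩ := h
    cases T' with
    | vert x' y' =>
      obtain ⟨-, h3, h4, -⟩ := h'
      rw [h1] at h3; rw [h2] at h4
      rw [Option.some.inj h3, Option.some.inj h4]
    | leaf | horiz => exact absurd h'.1 (by norm_num)
  | horiz x y =>
    obtain ⟨rfl, h1, h2, rfl⟩ := h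
    cases T' with
    | horiz x' y' =>
      obtain ⟨-, h3, h4, -⟩ := h'
      rw [h1] at h3; rw [h2] at h4
      rw [Option.some.inj h3, Option.some.inj h4]
    | leaf | vert => exact absurd h'.1 (by norm_num)

theorem Words.unique_words {L : List (TopTree (Fin k))} (hL : L.Nodup) {T : TopTree (Fin k)}
    {w0 w1 w2 w3 v0 v1 v2 v3 : ℕ}
    (h : Words L T w0 w1 w2 w3) (h' : Words L T v0 v1 v2 v3) :
    w0 = v0 ∧ w1 = v1 ∧ w2 = v2 ∧ w3 = v3 := by
  have key : ∀ {i j : ℕ} {x : TopTree (Fin k)}, L[i]? = some x → L[j]? = some x → i = j :=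
    fun hi hj => (List.getElem?_inj (List.getElem?_eq_some_iff.1 hi).1 hL).1 (hi.trans hj.symm)
  cases T with
  | leaf =>
    obtain ⟨rfl, rfl, rfl, rfl⟩ := h; obtain ⟨rfl, rfl, rfl, rfl⟩ := h'; simp
  | vert | horiz =>
    exact ⟨h.1.trans h'.1.symm, key h.2.1 h'.2.1, key h.2.2.1 h'.2.2.1,
      h.2.2.2.trans h'.2.2.2.symm⟩

theorem dictKey_inj {M w0 w1 w2 w3 v0 v1 v2 v3 : ℕ} (hw0 : w0 ≤ 2) (hw1 : w1 < M) (hw2 : w2 < M)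
    (hv0 : v0 ≤ 2) (hv1 : v1 < M) (hv2 : v2 < M)
    (h : dictKey M w0 w1 w2 w3 = dictKey M v0 v1 v2 v3) :
    w0 = v0 ∧ w1 = v1 ∧ w2 = v2 ∧ w3 = v3 := by
  have hM : 0 < M := by omega
  have key : ∀ {p q r t : ℕ}, r < M → t < M → p * M + r = q * M + t → p = q ∧ r = t := by
    intro p q r t hr ht he
    have h1 := congrArg (· / M) he
    simp only [mul_comm _ M, Nat.mul_add_div hM, Nat.div_eq_of_lt hr, Nat.div_eq_of_lt ht,
      add_zero] at h1
    subst h1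
    exact ⟨rfl, by omega⟩
  obtain ⟨h1, rfl⟩ := key hw2 hv2 h
  obtain ⟨h1, rfl⟩ := key hw1 hv1 h1
  omega

theorem dictKey_lt {D W M : ℕ} (h : Bounds D W M k) {w0 w1 w2 w3 : ℕ} (h1 : w1 < M) (h2 : w2 < M)
    (h3 : 3 * w3 + w0 ≤ 3) : (3 * w3 + w0) * M + w1 < 4 * M ∧ dictKey M w0 w1 w2 w3 < D ∧
      ((3 * w3 + w0) * M + w1) * M < D := by
  have e1 : (3 * w3 + w0) * M ≤ 3 * M := Nat.mul_le_mul_right M h3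
  have e2 : ((3 * w3 + w0) * M + w1 + 1) * M ≤ (4 * M) * M := Nat.mul_le_mul_right M (by omega)
  rw [add_mul _ 1, one_mul] at e2
  have := h.D_eq
  unfold dictKey
  omega

/-- The state `s'` arises from `s` by building further clusters and by changing variables in the list
`mods`. The input, the pending entries and the existing cells of linked lists are left alone. -/
structure Step (M : ℕ) (mods : List Var) (s : St) (L : List (TopTree (Fin k))) (s' : St)
    (L' : List (TopTree (Fin k))) : Prop where
  inv : Inv M s' L'
  pre : L <+: L'
  cells : s.v .cells ≤ s'.v .cells
  cid : ∀ p ≤ s.v .cells, s'.m .cid p = s.m .cid p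
  cpw : ∀ p ≤ s.v .cells, s'.m .cpw p = s.m .cpw p
  cnext : ∀ p ≤ s.v .cells, s'.m .cnext p = s.m .cnext p
  var : ∀ x ∉ mods, s'.v x = s.v x
  inp : s'.m .inp = s.m .inp
  plab : s'.m .plab = s.m .plab
  psz : s'.m .psz = s.m .psz
  pstk : s'.m .pstk = s.m .pstk

theorem Step.trans {M : ℕ} {mods mods' : List Var} {s s' s'' : St}
    {L L' L'' : List (TopTree (Fin k))}
    (h : Step M mods s L s' L') (h' : Step M mods' s' L' s'' L'') :
    Step M (mods ++ mods') s L s'' L'' where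
  inv := h'.inv
  pre := h.pre.trans h'.pre
  cells := h.cells.trans h'.cells
  cid p hp := (h'.cid p (hp.trans h.cells)).trans (h.cid p hp)
  cpw p hp := (h'.cpw p (hp.trans h.cells)).trans (h.cpw p hp)
  cnext p hp := (h'.cnext p (hp.trans h.cells)).trans (h.cnext p hp)
  var x hx := (h'.var x fun hx' => hx (by simp [hx'])).trans (h.var x fun hx' => hx (by simp [hx']))
  inp := h'.inp.trans h.inp
  plab := h'.plab.trans h.plab
  psz := h'.psz.trans h.psz
  pstk := h'.pstk.trans h.pstk

theorem Step.mono {M : ℕ} {mods mods' : List Var} {s s' : St} {L L' : List (TopTree (Fin k))}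
    (h : Step M mods s L s' L') (hm : mods ⊆ mods') : Step M mods' s L s' L' :=
  { h with var := fun x hx => h.var x fun hx' => hx (hm hx') }

/-- The variables that the invariant depends on. -/
def core : List Var := [.modulus, .zero, .one, .two, .three, .four, .count, .cells]

theorem Inv.congr {M : ℕ} {s s' : St} {L : List (TopTree (Fin k))} (h : Inv M s L)
    (hv : ∀ x ∈ core, s'.v x = s.v x) (hout : s'.m .out = s.m .out) (hdict : s'.m .dict = s.m .dict)
    (hsz : s'.m .sz = s.m .sz) (hpw : s'.m .pw = s.m .pw) (hcpw : s'.m .cpw 0 = s.m .cpw 0)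
    (hclk : s.clk ≤ s'.clk) : Inv M s' L where
  modulus := (hv _ (by simp [core])).trans h.modulus
  zero := (hv _ (by simp [core])).trans h.zero
  one := (hv _ (by simp [core])).trans h.one
  two := (hv _ (by simp [core])).trans h.two
  three := (hv _ (by simp [core])).trans h.three
  four := (hv _ (by simp [core])).trans h.four
  count := (hv _ (by simp [core])).trans h.count
  count_le := h.count_le.trans hclk
  cells_le := by rw [hv _ (by simp [core])]; exact h.cells_le.trans hclk
  nil := hcpw.trans h.nil
  nodup := h.nodup
  record := by rw [hout, hdict, hsz, hpw]; exact h.record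
  dict := by rw [hdict]; exact h.dict

/-- Changing variables only. -/
theorem Inv.step {M : ℕ} {s s' : St} {L : List (TopTree (Fin k))} (h : Inv M s L) (mods : List Var)
    (hm : s'.m = s.m) (hclk : s.clk ≤ s'.clk) (hv : ∀ x ∉ mods, s'.v x = s.v x)
    (hcore : ∀ x ∈ core, s'.v x = s.v x) : Step M mods s L s' L where
  inv := h.congr hcore (by rw [hm]) (by rw [hm]) (by rw [hm]) (by rw [hm])
    (by rw [hm]) hclk
  pre := List.prefix_rfl
  cells := (hcore _ (by simp [core])).ge
  cid _ _ := by rw [hm]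
  cpw _ _ := by rw [hm]
  cnext _ _ := by rw [hm]
  var := hv
  inp := by rw [hm]
  plab := by rw [hm]
  psz := by rw [hm]
  pstk := by rw [hm]

/-- Find the number of the top tree with the record `w0`, `w1`, `w2`, `w3`. If there is none, append
it to the dag; its size and the power of two below it are given. -/
def getNode : Prog :=
  mul .key .three .w3 ;; add .key .key .w0 ;; mul .key .key .modulus ;; add .key .key .w1 ;;
  mul .key .key .modulus ;; add .key .key .w2 ;; ld .id .dict .key ;;
  cond (.eq .id .zero)
    (mov .id .count ;;
      mul .tmp .four .count ;; add .tmp .tmp .two ;; st .out .tmp .w0 ;;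
      add .tmp .tmp .one ;; st .out .tmp .w1 ;; add .tmp .tmp .one ;; st .out .tmp .w2 ;;
      add .tmp .tmp .one ;; st .out .tmp .w3 ;; st .sz .count .size ;; st .pw .count .power ;;
      add .count .count .one ;; st .dict .key .count)
    (sub .id .id .one)

variable {D W M : ℕ} {s : St} {Q : St → Prop} {L : List (TopTree (Fin k))}

theorem getNode_spec (hB : Bounds D W M k) (hI : Inv M s L) {T : TopTree (Fin k)}
    (hw : Words L T (s.v .w0) (s.v .w1) (s.v .w2) (s.v .w3)) (hz : s.v .size = T.size)
    (hp : s.v .power = T.pw) (hclk : s.clk + 60 ≤ M)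
    (hQ : ∀ s' L', Step M [.key, .id, .tmp, .count] s L s' L' →
      (∀ X ∈ L', X ∈ L ∨ X = T) → L'[s'.v .id]? = some T → s'.clk ≤ s.clk + 60 → Q s') :
    WP D W getNode s Q := by
  obtain ⟨b0, b1, b2, b3⟩ := hw.bounds hB.k_le (by have := hI.count_le; omega)
  obtain ⟨k1, k2, k3⟩ := dictKey_lt hB b1 b2 b3
  have h16 := hB.le_M
  have hcl := hI.count_le
  have hDW := hB.D_le
  refine .seq (.mul _ (by rw [hI.three]) (hB.lt_W (by omega)) ?_)
  refine .seq (.add (3 * s.v .w3 + s.v .w0) (by simp) (hB.lt_W (by omega)) ?_)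
  refine .seq (.mul ((3 * s.v .w3 + s.v .w0) * M) (by simp [hI.modulus]) (hB.lt_W (by omega)) ?_)
  refine .seq (.add ((3 * s.v .w3 + s.v .w0) * M + s.v .w1) (by simp) (hB.lt_W (by omega)) ?_)
  refine .seq (.mul (((3 * s.v .w3 + s.v .w0) * M + s.v .w1) * M) (by simp [hI.modulus])
    (by omega) ?_)
  set K := dictKey M (s.v .w0) (s.v .w1) (s.v .w2) (s.v .w3) with hK
  refine .seq (.add K (by simp [hK, dictKey]) (by omega) ?_)
  refine .seq (.ld hB.le_W hB.W_gt K _ (by simp) k2 rfl ?_)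
  refine .cond (fun hc => ?_) (fun hc => ?_)
  · -- a new node
    replace hc : s.m .dict K = 0 := by simpa [Cond.Holds, hI.zero] using hc
    have hnew : T ∉ L := by
      intro hT
      obtain ⟨i, hi⟩ := List.mem_iff_getElem?.1 hT
      obtain ⟨w0, w1, w2, w3, h1, -, -, -, -, h2, -⟩ := hI.record i T hi
      obtain ⟨e0, e1, e2, e3⟩ := h1.unique_words hI.nodup hw
      rw [e0, e1, e2, e3, ← hK, hc] at h2
      omega
    refine .seq (.mov L.length (by simp [hI.zero]) (by simp [hI.count]) ?_)
    refine .seq (.mul (4 * L.length) (by simp [hI.four, hI.count]) (hB.lt_W (by omega)) ?_)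
    refine .seq (.add (2 + 4 * L.length) (by simp [hI.two, add_comm]) (hB.lt_W (by omega)) ?_)
    refine .seq (.st hB.le_W hB.W_gt (2 + 4 * L.length) (s.v .w0) (by simp) (hB.lt_D (by omega))
      (by simp) ?_)
    refine .seq (.add (2 + 4 * L.length + 1) (by simp [hI.one]) (hB.lt_W (by omega)) ?_)
    refine .seq (.st hB.le_W hB.W_gt (2 + 4 * L.length + 1) (s.v .w1) (by simp) (hB.lt_D (by omega))
      (by simp) ?_)
    refine .seq (.add (2 + 4 * L.length + 2) (by simp [hI.one]) (hB.lt_W (by omega)) ?_)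
    refine .seq (.st hB.le_W hB.W_gt (2 + 4 * L.length + 2) (s.v .w2) (by simp) (hB.lt_D (by omega))
      (by simp) ?_)
    refine .seq (.add (2 + 4 * L.length + 3) (by simp [hI.one]) (hB.lt_W (by omega)) ?_)
    refine .seq (.st hB.le_W hB.W_gt (2 + 4 * L.length + 3) (s.v .w3) (by simp) (hB.lt_D (by omega))
      (by simp) ?_)
    refine .seq (.st hB.le_W hB.W_gt L.length T.size (by simp [hI.count]) (hB.lt_D (by omega))
      (by simp [hz]) ?_)
    refine .seq (.st hB.le_W hB.W_gt L.length T.pw (by simp [hI.count]) (hB.lt_D (by omega))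
      (by simp [hp]) ?_)
    refine .seq (.add (L.length + 1) (by simp [hI.count, hI.one]) (hB.lt_W (by omega)) ?_)
    refine .st hB.le_W hB.W_gt K (L.length + 1) (by simp) k2 (by simp) ?_
    have hpre : L <+: L ++ [T] := List.prefix_append _ _
    refine hQ _ (L ++ [T]) ?_ ?_ ?_ ?_
    · refine ⟨⟨?_, ?_, ?_, ?_, ?_, ?_, ?_, ?_, ?_, ?_, ?_, ?_, ?_⟩, hpre, ?_, ?_, ?_, ?_, ?_, ?_, ?_,
        ?_, ?_⟩
      · simp [hI.modulus]
      · simp [hI.zero]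
      · simp [hI.one]
      · simp [hI.two]
      · simp [hI.three]
      · simp [hI.four]
      · simp
      · simp; omega
      · have := hI.cells_le; simp; omega
      · simp [hI.nil]
      · exact List.nodup_append.2 ⟨hI.nodup, by simp, by
          rintro x hx y hy rfl
          exact hnew (by simpa using (List.mem_singleton.1 hy) ▸ hx)⟩
      · intro i X hi
        rcases Nat.lt_or_ge i L.length with hlt | hge
        · rw [List.getElem?_append_left hlt] at hi
          obtain ⟨w0, w1, w2, w3, h1, h2, h3, h4, h5, h6, h7, h8⟩ := hI.record i X hi
          have hKne : dictKey M w0 w1 w2 w3 ≠ K := by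
            intro he; rw [he, hc] at h6; omega
          refine ⟨w0, w1, w2, w3, h1.mono hpre, ?_⟩
          simp [Function.update_apply, hKne, h6]
          refine ⟨?_, ?_, ?_, ?_, ?_, ?_⟩
          · rw [if_neg (by omega), if_neg (by omega), if_neg (by omega), if_neg (by omega), h2]
          · rw [if_neg (by omega), if_neg (by omega), if_neg (by omega), if_neg (by omega), h3]
          · rw [if_neg (by omega), if_neg (by omega), if_neg (by omega), if_neg (by omega), h4]
          · rw [if_neg (by omega), if_neg (by omega), if_neg (by omega), if_neg (by omega), h5]
          · rw [if_neg (by omega), h7]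
          · rw [if_neg (by omega), h8]
        · rw [List.getElem?_append_right hge] at hi
          obtain ⟨h0, h0'⟩ : i = L.length ∧ X = T := by
            obtain ⟨hlt, hX⟩ := List.getElem?_eq_some_iff.1 hi
            simp at hlt hX
            exact ⟨by omega, hX.symm⟩
          subst h0 h0'
          refine ⟨_, _, _, _, hw.mono hpre, ?_, ?_, ?_, ?_, ?_, ?_, ?_⟩
          · simp
          · simp
          · simp
          · simp
          · simp [← hK]
          · simp
          · simp
      · intro n hn
        by_cases hnK : n = K
        · refine ⟨L.length, T, _, _, _, _, ?_, ?_, hw.mono hpre, hnK.trans hK⟩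
          · simp [hnK]
          · simp
        · simp [hnK] at hn
          obtain ⟨i, X, w0, w1, w2, w3, h1, h2, h3, h4⟩ := hI.dict n hn
          exact ⟨i, X, w0, w1, w2, w3, by simp [hnK, h1], prefix_getElem? hpre h2, h3.mono hpre, h4⟩
      · simp
      · simp
      · simp
      · simp
      · intro x hx
        simp at hx
        simp [hx]
      · simp
      · simp
      · simp
      · simp
    · intro X hX; simpa using hX
    · simp
    · simp
  · -- the top tree is in the dag already
    replace hc : s.m .dict K ≠ 0 := by simpa [Cond.Holds, hI.zero] using hc
    obtain ⟨i, X, w0, w1, w2, w3, h1, h2, h3, h4⟩ := hI.dict K hc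
    have hX : X = T := by
      obtain ⟨c0, c1, c2, c3⟩ := h3.bounds hB.k_le (by omega : L.length ≤ M)
      obtain ⟨rfl, rfl, rfl, rfl⟩ := dictKey_inj b0 b1 b2 c0 c1 c2 h4
      exact h3.unique hw
    subst hX
    have hi := (List.getElem?_eq_some_iff.1 h2).1
    refine .sub i (by simp [hI.one, h1]) (hB.lt_W (by omega)) ?_
    refine hQ _ L (Inv.step hI _ rfl (by simp; omega) ?_ (by simp [core])) (fun X hX => Or.inl hX) ?_ (by simp)
    · intro x hx
      simp at hx
      simp [hx]
    · simp [h2]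

end Ram

namespace Ram

open TopTree

variable {k : ℕ} {D W M : ℕ} {s s' : St} {Q : St → Prop} {L L' L'' : List (TopTree (Fin k))}

/-! ### The stack operations on linked lists -/

/-- The cell number `p` is the first one of a linked list that holds the stack `S`; the number zero
stands for the empty list. -/
def Linked (s : St) (L : List (TopTree (Fin k))) : ℕ → List (TopTree (Fin k)) → Prop
  | p, [] => p = 0
  | p, c :: S => p ≠ 0 ∧ p ≤ s.v .cells ∧ L[s.m .cid p]? = some c ∧ s.m .cpw p = c.pw ∧
      Linked s L (s.m .cnext p) S

/-- All top trees that are new in `L'` are subtrees of elements of `out`. -/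
def New (L L' out : List (TopTree (Fin k))) : Prop :=
  ∀ X ∈ L', X ∈ L ∨ ∃ d ∈ out, X ∈ d.subtrees

theorem New.refl (L out : List (TopTree (Fin k))) : New L L out := fun _ hX => Or.inl hX

theorem New.trans {out out' : List (TopTree (Fin k))} (h : New L L' out) (h' : New L' L'' out')
    (hk : Keeps out out') : New L L'' out' := fun X hX => by
  rcases h' X hX with hX | hX
  · rcases h X hX with hX | ⟨d, hd, hX⟩
    · exact Or.inl hX
    · exact Or.inr (hk d hd X hX)
  · exact Or.inr hX

theorem New.mono {out out' : List (TopTree (Fin k))} (h : New L L' out) (hk : Keeps out out') :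
    New L L' out' := h.trans (New.refl L' out') hk

theorem Linked.step {mods : List Var} (h : Step M mods s L s' L') {p : ℕ}
    {S : List (TopTree (Fin k))} (hp : Linked s L p S) : Linked s' L' p S := by
  induction S generalizing p with
  | nil => exact hp
  | cons c S ih =>
    obtain ⟨h1, h2, h3, h4, h5⟩ := hp
    refine ⟨h1, h2.trans h.cells, ?_, ?_, ?_⟩
    · rw [h.cid p h2]; exact prefix_getElem? h.pre h3
    · rw [h.cpw p h2]; exact h4
    · rw [h.cnext p h2]; exact ih h5

theorem Linked.le_cells {p : ℕ} {S : List (TopTree (Fin k))} (hp : Linked s L p S) :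
    p ≤ s.v .cells := by
  cases S with
  | nil => have : p = 0 := hp; omega
  | cons c S => exact hp.2.1

theorem Linked.cpw_nil (hI : Inv M s L) {p : ℕ} (hp : Linked s L p []) : s.m .cpw p = M := by
  have : p = 0 := hp
  rw [this, hI.nil]

theorem Linked.eq_zero_iff {p : ℕ} {S : List (TopTree (Fin k))} (hp : Linked s L p S) :
    p = 0 ↔ S = [] := by
  cases S with
  | nil =>
    have : p = 0 := hp
    simp [this]
  | cons c S => simpa using hp.1

/-- The number that stands for a merge operation in the records. -/
def opCode (o : Bool) : ℕ := if o then 1 else 2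

theorem words_merge {o : Bool} {x y : TopTree (Fin k)} {i j : ℕ} (hi : L[i]? = some x)
    (hj : L[j]? = some y) : Words L (merge o x y) (opCode o) i j 0 := by
  cases o <;> exact ⟨rfl, hi, hj, rfl⟩

/-- Find or create the node for the merge of the nodes `w1` and `w2`. -/
def mergeNode : Prog :=
  ld .size .sz .w1 ;; ld .tmp .sz .w2 ;; add .size .size .tmp ;;
  ld .power .pw .w1 ;; ld .tmp .pw .w2 ;;
  cond (.lt .power .tmp) (mov .power .tmp) .skip ;;
  add .tmp .power .power ;;
  cond (.lt .size .tmp) .skip (mov .power .tmp) ;;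
  mov .w0 .oper ;; setc .w3 0 ;; getNode

theorem mergeNode_spec (hB : Bounds D W M k) (hI : Inv M s L) {o : Bool} {x y : TopTree (Fin k)}
    (hx : L[s.v .w1]? = some x) (hy : L[s.v .w2]? = some y) (ho : s.v .oper = opCode o)
    (hsz : x.size + y.size < M) (hclk : s.clk + 90 ≤ M)
    (hQ : ∀ s' L', Step M [.size, .power, .w0, .w3, .key, .id, .tmp, .count] s L s' L' →
      New L L' [merge o x y] → L'[s'.v .id]? = some (merge o x y) → s'.clk ≤ s.clk + 90 → Q s') :
    WP D W mergeNode s Q := by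
  have hxl := (List.getElem?_eq_some_iff.1 hx).1
  have hyl := (List.getElem?_eq_some_iff.1 hy).1
  have hcl := hI.count_le
  obtain ⟨-, -, -, -, -, -, -, -, -, -, hx1, hx2⟩ := hI.record _ _ hx
  obtain ⟨-, -, -, -, -, -, -, -, -, -, hy1, hy2⟩ := hI.record _ _ hy
  have hpx := x.pw_le_size
  have hpy := y.pw_le_size
  refine .seq (.ld hB.le_W hB.W_gt (s.v .w1) x.size rfl (hB.lt_D (by omega)) hx1 ?_)
  refine .seq (.ld hB.le_W hB.W_gt (s.v .w2) y.size (by simp) (hB.lt_D (by omega)) hy1 ?_)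
  refine .seq (.add (x.size + y.size) (by simp) (hB.lt_W (by omega)) ?_)
  refine .seq (.ld hB.le_W hB.W_gt (s.v .w1) x.pw (by simp) (hB.lt_D (by omega)) hx2 ?_)
  refine .seq (.ld hB.le_W hB.W_gt (s.v .w2) y.pw (by simp) (hB.lt_D (by omega)) hy2 ?_)
  refine .seq (.cond_mov (max x.pw y.pw) (by simp [hI.zero])
    (by simp [Cond.Holds]; omega) (by simp [Cond.Holds]) ?_)
  refine .seq (.add (2 * max x.pw y.pw) (by simp; omega) (hB.lt_W (by omega)) ?_)
  refine .seq (.cond_not_mov (merge o x y).pw (by simp [hI.zero])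
    (by simp only [Cond.Holds]; rw [pw_merge]; simp; omega)
    (by simp only [Cond.Holds]; rw [pw_merge]; simp; omega) ?_)
  refine .seq (.mov (opCode o) (by simp [hI.zero]) (by simp [ho]) ?_)
  refine .seq (.setc (hB.lt_W (by omega)) ?_)
  have h1 := Inv.step (s' := (((((((((((((((((((s.set .size x.size).tick 4).set .tmp y.size).tick 4).set
    .size (x.size + y.size)).tick 1).set .power x.pw).tick 4).set .tmp y.pw).tick 4).set .power
    (max x.pw y.pw)).tick 2).set .tmp (2 * max x.pw y.pw)).tick 1).set .power
    (merge o x y).pw).tick 2).set .w0 (opCode o)).tick 1).set .w3 0).tick 1) hI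
    [.size, .power, .w0, .w3, .tmp] rfl (by simp; omega) (by intro v hv; simp at hv; simp [hv])
    (by simp [core])
  refine getNode_spec hB h1.inv (T := merge o x y) ?_ (by simp) (by simp) (by simp; omega) ?_
  · simpa using words_merge hx hy
  · intro s' L' h2 h3 h4 h5
    refine hQ s' L' ((h1.trans h2).mono (by decide)) ?_ h4 (by simp at h5; omega)
    intro X hX
    rcases h3 X hX with hX | rfl
    · exact Or.inl hX
    · exact Or.inr ⟨_, by simp, self_mem_subtrees _⟩

/-- Pop an element from the list `stk` and merge the top tree in the variable `x` with it. -/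
def popMerge (x : Var) : Prog :=
  mov .w1 x ;; ld .w2 .cid .stk ;; mergeNode ;; mov x .id ;; ld .stk .cnext .stk ;;
  ld .head .cpw .stk

/-- The variables that are changed by building clusters. -/
def temps : List Var :=
  [.w0, .w1, .w2, .w3, .size, .power, .tmp, .key, .id, .count, .head, .acc, .stk, .bound]

theorem popMerge_spec (hB : Bounds D W M k) (hI : Inv M s L) {v : Var} (hv : v = .acc ∨ v = .item)
    {o : Bool} {x c : TopTree (Fin k)} {S : List (TopTree (Fin k))}
    (hx : L[s.v v]? = some x) (hS : Linked s L (s.v .stk) (c :: S)) (ho : s.v .oper = opCode o)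
    (hsz : x.size + c.size < M) (hclk : s.clk + 110 ≤ M)
    (hQ : ∀ s' L', Step M [.w0, .w1, .w2, .w3, .size, .power, .tmp, .key, .id, .count, .head, .stk, v]
        s L s' L' →
      New L L' [merge o x c] → L'[s'.v v]? = some (merge o x c) → Linked s' L' (s'.v .stk) S →
      s'.v .head = s'.m .cpw (s'.v .stk) → s'.clk ≤ s.clk + 110 → Q s') :
    WP D W (popMerge v) s Q := by
  have hcl := hI.count_le
  have hce := hI.cells_le
  have hp := hS.2.1
  have hvv : v ≠ .w1 ∧ v ≠ .w2 ∧ v ≠ .stk ∧ v ≠ .zero ∧ v ≠ .cells ∧ v ∉ core := by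
    rcases hv with rfl | rfl <;> decide
  refine .seq (.mov (s.v v) hI.zero rfl ?_)
  refine .seq (.ld hB.le_W hB.W_gt (s.v .stk) (s.m .cid (s.v .stk)) (by simp)
    (hB.lt_D (by omega)) rfl ?_)
  have h1 := Inv.step (s' := (((s.set .w1 (s.v v)).tick 1).set .w2 (s.m .cid (s.v .stk))).tick 4)
    hI [.w1, .w2] rfl (by simp; omega) (by intro v hv; simp at hv; simp [hv])
    (by simp [core])
  refine .seq (mergeNode_spec hB h1.inv (o := o) (x := x) (y := c) (by simpa using hx)
    (by simpa using hS.2.2.1) (by simpa using ho) hsz (by simp; omega) ?_)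
  intro s2 L2 h2 hn hid hc2
  have h12 := h1.trans h2
  have hstk : s2.v .stk = s.v .stk := h12.var _ (by decide)
  have hS2 := Linked.step h12 hS
  have hcl2 := h2.inv.cells_le
  simp only [St.tick_clk, St.set_clk] at hc2
  refine .seq (.mov (s2.v .id) h2.inv.zero rfl ?_)
  refine .seq (.ld hB.le_W hB.W_gt (s.v .stk) (s2.m .cnext (s.v .stk))
    (by simp [hstk, hvv.2.2.1.symm]) (hB.lt_D (by omega)) (by simp) ?_)
  have hle := hS2.2.2.2.2.le_cells
  refine .ld hB.le_W hB.W_gt (s2.m .cnext (s.v .stk)) (s2.m .cpw (s2.m .cnext (s.v .stk)))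
    (by simp) (hB.lt_D (by omega)) (by simp) ?_
  have h3 := Inv.step (s' := ((((((s2.set v (s2.v .id)).tick 1).set .stk
    (s2.m .cnext (s.v .stk))).tick 4).set .head (s2.m .cpw (s2.m .cnext (s.v .stk)))).tick 4))
    h2.inv [v, .stk, .head] rfl (by simp; omega) (by intro v hv; simp at hv; simp [hv])
    (by
      intro y hy
      have hyv : y ≠ v := fun h => hvv.2.2.2.2.2 (h ▸ hy)
      have hys : y ≠ .stk ∧ y ≠ .head := by revert hy; cases y <;> simp [core]
      simp [hyv, hys])
  refine hQ _ L2 ((h12.trans h3).mono (by intro y; simp; tauto)) hn ?_ ?_ (by simp) (by simp; omega)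
  · have : v ≠ .head := by rcases hv with rfl | rfl <;> decide
    simp [hvv, this, hid]
  · simpa using Linked.step h3 hS2.2.2.2.2

theorem absorb_loop_spec (hB : Bounds D W M k) {o : Bool} {b : ℕ} (hbM : b ≤ M)
    {S : List (TopTree (Fin k))} : ∀ {s : St} {L : List (TopTree (Fin k))} {x : TopTree (Fin k)},
    Inv M s L → L[s.v .acc]? = some x → Linked s L (s.v .stk) S → s.v .oper = opCode o →
    s.v .bound = b → s.v .head = s.m .cpw (s.v .stk) → x.size + total S < M →
    s.clk + 120 * S.length ≤ M →
    (∀ s' L', Step M [.w0, .w1, .w2, .w3, .size, .power, .tmp, .key, .id, .count, .head, .stk, .acc]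
        s L s' L' →
      New L L' ((absorb o b x S).1 :: (absorb o b x S).2) →
      L'[s'.v .acc]? = some (absorb o b x S).1 → Linked s' L' (s'.v .stk) (absorb o b x S).2 →
      s'.v .head = s'.m .cpw (s'.v .stk) →
      s'.clk + 120 * (absorb o b x S).2.length ≤ s.clk + 120 * S.length + 1 → Q s') →
    WP D W (loop (.lt .head .bound) (popMerge .acc)) s Q := by
  induction S with
  | nil =>
    intro s L x hI hx hS ho hb hh hsz hclk hQ
    have hM := hS.cpw_nil hI
    refine .loop_false (by simp only [Cond.Holds]; omega) ?_
    have h1 := Inv.step (s' := s.tick 1) hI [] rfl (by simp) (fun _ _ => rfl) (fun _ _ => rfl)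
    exact hQ _ L (h1.mono (by decide)) (New.refl _ _) hx (Linked.step h1 hS) hh (by simp [absorb])
  | cons c S ih =>
    intro s L x hI hx hS ho hb hh hsz hclk hQ
    rw [total_cons] at hsz
    rw [List.length_cons] at hclk
    have hc : s.v .head = c.pw := hh.trans hS.2.2.2.1
    have h1 := Inv.step (s' := s.tick 1) hI [] rfl (by simp) (fun _ _ => rfl) (fun _ _ => rfl)
    by_cases hlt : c.pw < b
    · rw [absorb, if_pos hlt] at hQ
      refine .loop_true (by simp only [Cond.Holds]; omega) ?_
      refine popMerge_spec hB h1.inv (Or.inl rfl) hx (Linked.step h1 hS) ho (by omega)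
        (by simp; omega) ?_
      intro s2 L2 h2 hn hx2 hS2 hh2 hc2
      simp only [St.tick_clk] at hc2
      refine ih h2.inv hx2 hS2 ((h2.var _ (by decide)).trans ho) ((h2.var _ (by decide)).trans hb) hh2
        (by rw [size_merge]; omega) (by omega) ?_
      intro s3 L3 h3 hn3 hx3 hS3 hh3 hc3
      refine hQ s3 L3 ((h1.trans (h2.trans h3)).mono (by decide)) ?_ hx3 hS3 hh3
        (by rw [List.length_cons]; omega)
      exact hn.trans hn3 (Keeps.trans (Keeps.of_subset (by simp)) (keeps_absorb o b _ S))
    · rw [absorb, if_neg hlt] at hQ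
      refine .loop_false (by simp only [Cond.Holds]; omega) ?_
      exact hQ _ L (h1.mono (by decide)) (New.refl _ _) hx (Linked.step h1 hS) hh (by simp; omega)

/-- The loop for `carry`. -/
def carryLoop : Prog :=
  loop (.lt .head .bound) (popMerge .item ;; ld .bound .pw .item ;; add .bound .bound .one)

theorem carryLoop_spec (hB : Bounds D W M k) {o : Bool}
    {S : List (TopTree (Fin k))} : ∀ {s : St} {L : List (TopTree (Fin k))} {x : TopTree (Fin k)},
    Inv M s L → L[s.v .item]? = some x → Linked s L (s.v .stk) S → s.v .oper = opCode o →
    s.v .bound = x.pw + 1 → s.v .head = s.m .cpw (s.v .stk) → x.size + total S < M →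
    s.clk + 120 * S.length ≤ M →
    (∀ s' L' y S', Step M [.w0, .w1, .w2, .w3, .size, .power, .tmp, .key, .id, .count, .head, .stk,
        .item, .bound] s L s' L' →
      carry o x S = y :: S' → New L L' (carry o x S) →
      L'[s'.v .item]? = some y → Linked s' L' (s'.v .stk) S' →
      s'.clk + 120 * S'.length ≤ s.clk + 120 * S.length + 1 → Q s') →
    WP D W carryLoop s Q := by
  induction S with
  | nil =>
    intro s L x hI hx hS ho hb hh hsz hclk hQ
    have hM := hS.cpw_nil hI
    have := x.pw_le_size
    refine .loop_false (by simp only [Cond.Holds]; omega) ?_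
    have h1 := Inv.step (s' := s.tick 1) hI [] rfl (by simp) (fun _ _ => rfl) (fun _ _ => rfl)
    exact hQ _ L x [] (h1.mono (by decide)) rfl (New.refl _ _) hx (Linked.step h1 hS) (by simp)
  | cons c S ih =>
    intro s L x hI hx hS ho hb hh hsz hclk hQ
    rw [total_cons] at hsz
    rw [List.length_cons] at hclk
    have hc : s.v .head = c.pw := hh.trans hS.2.2.2.1
    have h1 := Inv.step (s' := s.tick 1) hI [] rfl (by simp) (fun _ _ => rfl) (fun _ _ => rfl)
    by_cases hlt : c.pw ≤ x.pw
    · rw [carry, if_pos hlt] at hQ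
      refine .loop_true (by simp only [Cond.Holds]; omega) (.seq ?_)
      refine popMerge_spec hB h1.inv (Or.inr rfl) hx (Linked.step h1 hS) ho (by omega)
        (by simp; omega) ?_
      intro s2 L2 h2 hn hx2 hS2 hh2 hc2
      simp only [St.tick_clk] at hc2
      have hcl2 := h2.inv.count_le
      have hxl := (List.getElem?_eq_some_iff.1 hx2).1
      obtain ⟨-, -, -, -, -, -, -, -, -, -, -, hp⟩ := h2.inv.record _ _ hx2
      have hple := (merge o x c).pw_le_size
      rw [size_merge] at hple
      refine .seq (.ld hB.le_W hB.W_gt (s2.v .item) (merge o x c).pw rfl (hB.lt_D (by omega)) hp ?_)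
      refine .add ((merge o x c).pw + 1) (by simp [h2.inv.one]) (hB.lt_W (by omega)) ?_
      have h3 := Inv.step (s' := (((s2.set .bound (merge o x c).pw).tick 4).set .bound
        ((merge o x c).pw + 1)).tick 1)
        h2.inv [.bound] rfl (by simp; omega) (by intro v hv; simp at hv; simp [hv])
        (by simp [core])
      have h123 := h1.trans (h2.trans h3)
      refine ih h3.inv (by simpa using hx2) (by simpa using Linked.step h3 hS2)
        ((h123.var _ (by decide)).trans ho) (by simp) (by simpa using hh2)
        (by rw [size_merge]; omega) (by simp; omega) ?_
      intro s4 L4 y S' h4 hcar hn4 hx4 hS4 hc4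
      simp only [St.tick_clk, St.set_clk] at hc4
      refine hQ s4 L4 y S' ((h123.trans h4).mono (by decide)) hcar ?_ hx4 hS4
        (by rw [List.length_cons]; omega)
      exact hn.trans hn4 (Keeps.trans (Keeps.of_subset (by simp)) (keeps_carry o _ S))
    · rw [carry, if_neg hlt] at hQ
      refine .loop_false (by simp only [Cond.Holds]; omega) ?_
      exact hQ _ L x (c :: S) (h1.mono (by decide)) rfl (New.refl _ _) hx (Linked.step h1 hS)
        (by simp; omega)

/-- Push the top tree `item` on the list `stk`. -/
def pushProg : Prog :=
  ld .bound .pw .item ;; ld .head .cpw .stk ;;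
  cond (.lt .head .bound)
    (ld .acc .cid .stk ;; ld .stk .cnext .stk ;; ld .head .cpw .stk ;;
      loop (.lt .head .bound) (popMerge .acc) ;;
      mov .w1 .item ;; mov .w2 .acc ;; mergeNode ;; mov .item .id) .skip ;;
  ld .bound .pw .item ;; add .bound .bound .one ;; carryLoop ;;
  add .cells .cells .one ;; st .cid .cells .item ;; ld .tmp .pw .item ;; st .cpw .cells .tmp ;;
  st .cnext .cells .stk ;; mov .stk .cells

/-- The first part of `push`: elements smaller than the item are absorbed. -/
theorem push_eq (o : Bool) (x c : TopTree (Fin k)) (S : List (TopTree (Fin k)))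
    (h : c.pw < x.pw) : push o x (c :: S) =
      carry o (merge o x (absorb o x.pw c S).1) (absorb o x.pw c S).2 := by
  rw [push, if_pos h]

/-- The last part of `push`: a new cell. -/
theorem newCell_spec (hB : Bounds D W M k) (hI : Inv M s L) {y : TopTree (Fin k)}
    {S : List (TopTree (Fin k))} (hy : L[s.v .item]? = some y) (hS : Linked s L (s.v .stk) S)
    (hclk : s.clk + 30 ≤ M)
    (hQ : ∀ s', Step M [.tmp, .cells, .stk] s L s' L → Linked s' L (s'.v .stk) (y :: S) →
      s'.clk ≤ s.clk + 30 → Q s') :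
    WP D W (add .cells .cells .one ;; st .cid .cells .item ;; ld .tmp .pw .item ;;
      st .cpw .cells .tmp ;; st .cnext .cells .stk ;; mov .stk .cells) s Q := by
  have hcl := hI.count_le
  have hce := hI.cells_le
  have hyl := (List.getElem?_eq_some_iff.1 hy).1
  obtain ⟨-, -, -, -, -, -, -, -, -, -, -, hp⟩ := hI.record _ _ hy
  refine .seq (.add (s.v .cells + 1) (by simp [hI.one]) (hB.lt_W (by omega)) ?_)
  refine .seq (.st hB.le_W hB.W_gt (s.v .cells + 1) (s.v .item) (by simp) (hB.lt_D (by omega))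
    (by simp) ?_)
  refine .seq (.ld hB.le_W hB.W_gt (s.v .item) y.pw (by simp) (hB.lt_D (by omega)) (by simp [hp]) ?_)
  refine .seq (.st hB.le_W hB.W_gt (s.v .cells + 1) y.pw (by simp) (hB.lt_D (by omega))
    (by simp) ?_)
  refine .seq (.st hB.le_W hB.W_gt (s.v .cells + 1) (s.v .stk) (by simp) (hB.lt_D (by omega))
    (by simp) ?_)
  refine .mov (s.v .cells + 1) (by simp [hI.zero]) (by simp) ?_
  have hstep : Step M [.tmp, .cells, .stk] s L
      ((((((((((((s.set .cells (s.v .cells + 1)).tick 1).put .cid (s.v .cells + 1) (s.v .item)).tick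
      4).set .tmp y.pw).tick 4).put .cpw (s.v .cells + 1) y.pw).tick 4).put .cnext
      (s.v .cells + 1) (s.v .stk)).tick 4).set .stk (s.v .cells + 1)).tick 1) L := by
    refine ⟨⟨?_, ?_, ?_, ?_, ?_, ?_, ?_, ?_, ?_, ?_, hI.nodup, ?_, ?_⟩, List.prefix_rfl,
      ?_, ?_, ?_, ?_, ?_, ?_, ?_, ?_, ?_⟩
    · simp [hI.modulus]
    · simp [hI.zero]
    · simp [hI.one]
    · simp [hI.two]
    · simp [hI.three]
    · simp [hI.four]
    · simp [hI.count]
    · simp; omega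
    · simp; omega
    · simp [hI.nil]
    · simpa using hI.record
    · simpa using hI.dict
    · simp
    · intro p hp
      simp [Function.update_apply]; omega
    · intro p hp
      simp [Function.update_apply]; omega
    · intro p hp
      simp [Function.update_apply]; omega
    · intro v hv
      simp at hv; simp [hv]
    · simp
    · simp
    · simp
    · simp
  refine hQ _ hstep ⟨by simp, by simp, by simpa using hy, by simp, ?_⟩ (by simp)
  simpa using Linked.step hstep hS

/-- The second part of `push`: merging with elements that are not larger. -/
theorem pushRest_spec (hB : Bounds D W M k) {o : Bool} {z : TopTree (Fin k)}
    {R : List (TopTree (Fin k))} (hI : Inv M s L) (hz : L[s.v .item]? = some z)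
    (hR : Linked s L (s.v .stk) R) (ho : s.v .oper = opCode o)
    (hh : s.v .head = s.m .cpw (s.v .stk)) (hsz : z.size + total R < M)
    (hclk : s.clk + 120 * R.length + 60 ≤ M)
    (hQ : ∀ s' L', Step M (temps ++ [.cells, .item]) s L s' L' → New L L' (carry o z R) →
      Linked s' L' (s'.v .stk) (carry o z R) →
      s'.clk + 120 * (carry o z R).length ≤ s.clk + 120 * R.length + 160 → Q s') :
    WP D W (ld .bound .pw .item ;; add .bound .bound .one ;; carryLoop ;;
        add .cells .cells .one ;; st .cid .cells .item ;; ld .tmp .pw .item ;;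
        st .cpw .cells .tmp ;; st .cnext .cells .stk ;; mov .stk .cells) s Q := by
  have hcl1 := hI.count_le
  have hzl := (List.getElem?_eq_some_iff.1 hz).1
  have hpz := z.pw_le_size
  obtain ⟨-, -, -, -, -, -, -, -, -, -, -, hp1⟩ := hI.record _ _ hz
  refine .seq (.ld hB.le_W hB.W_gt (s.v .item) z.pw rfl (hB.lt_D (by omega)) hp1 ?_)
  refine .seq (.add (z.pw + 1) (by simp [hI.one]) (hB.lt_W (by omega)) ?_)
  have h2 := Inv.step (s' := (((s.set .bound z.pw).tick 4).set .bound (z.pw + 1)).tick 1)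
    hI [.bound] rfl (by simp; omega) (by intro v hv; simp at hv; simp [hv]) (by simp [core])
  refine .seq (carryLoop_spec hB (o := o) (x := z) h2.inv (by simpa using hz)
    (by simpa using Linked.step h2 hR) ((h2.var _ (by decide)).trans ho) (by simp)
    (by simpa using hh) (by omega) (by simp; omega) ?_)
  intro s3 L3 y S' h3 hcar hn3 hy hS3 hc3
  simp only [St.tick_clk, St.set_clk] at hc3
  refine newCell_spec hB h3.inv hy hS3 (by omega) ?_
  intro s4 h4 hS4 hc4
  refine hQ s4 L3 (((h2.trans h3).trans h4).mono (by decide)) hn3 ?_ ?_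
  · rwa [hcar]
  · rw [hcar, List.length_cons]; omega

/-- The first part of `push` if the top of the stack is smaller than the item. -/
theorem pushAbsorb_spec (hB : Bounds D W M k) (hI : Inv M s L) {o : Bool} {x c : TopTree (Fin k)}
    {S : List (TopTree (Fin k))}
    (hx : L[s.v .item]? = some x) (hS : Linked s L (s.v .stk) (c :: S))
    (ho : s.v .oper = opCode o) (hb : s.v .bound = x.pw)
    (hsz : x.size + (c.size + total S) < M) (hclk : s.clk + 120 * S.length + 130 ≤ M)
    (hQ : ∀ s' L', Step M (temps ++ [.cells, .item]) s L s' L' →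
      New L L' (merge o x (absorb o x.pw c S).1 :: (absorb o x.pw c S).2) →
      L'[s'.v .item]? = some (merge o x (absorb o x.pw c S).1) →
      Linked s' L' (s'.v .stk) (absorb o x.pw c S).2 →
      s'.v .head = s'.m .cpw (s'.v .stk) →
      s'.clk + 120 * (absorb o x.pw c S).2.length ≤ s.clk + 120 * S.length + 110 → Q s') :
    WP D W (ld .acc .cid .stk ;; ld .stk .cnext .stk ;; ld .head .cpw .stk ;;
      loop (.lt .head .bound) (popMerge .acc) ;;
      mov .w1 .item ;; mov .w2 .acc ;; mergeNode ;; mov .item .id) s Q := by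
  have hcl := hI.count_le
  have hce := hI.cells_le
  have hle := hS.le_cells
  have hle2 := hS.2.2.2.2.le_cells
  have hpx := x.pw_le_size
  refine .seq (.ld hB.le_W hB.W_gt (s.v .stk) (s.m .cid (s.v .stk)) rfl
    (hB.lt_D (by omega)) rfl ?_)
  refine .seq (.ld hB.le_W hB.W_gt (s.v .stk) (s.m .cnext (s.v .stk)) rfl
    (hB.lt_D (by omega)) rfl ?_)
  refine .seq (.ld hB.le_W hB.W_gt (s.m .cnext (s.v .stk)) (s.m .cpw (s.m .cnext (s.v .stk)))
    rfl (hB.lt_D (by omega)) rfl ?_)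
  have h2 := Inv.step (s' := (((((s.set .acc (s.m .cid (s.v .stk))).tick 4).set .stk
    (s.m .cnext (s.v .stk))).tick 4).set .head
    (s.m .cpw (s.m .cnext (s.v .stk)))).tick 4) hI [.head, .acc, .stk] rfl
    (by simp; omega) (by intro v hv; simp at hv; simp [hv]) (by simp [core])
  refine .seq (absorb_loop_spec hB (o := o) (b := x.pw) (by omega) (x := c) (S := S) h2.inv
    hS.2.2.1 (Linked.step h2 hS.2.2.2.2) ho hb rfl (by omega) (by simp; omega) ?_)
  intro s3 L3 h3 hn3 hacc hS3 hh3 hc3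
  simp only [St.tick_clk, St.set_clk] at hc3
  have h23 := h2.trans h3
  have htot := absorb_total o x.pw c S
  refine .seq (.mov (s.v .item) h3.inv.zero (h23.var _ (by decide)) ?_)
  refine .seq (.mov (s3.v .acc) h3.inv.zero rfl ?_)
  have h4 := Inv.step (s' := (((s3.set .w1 (s.v .item)).tick 1).set .w2 (s3.v .acc)).tick 1)
    h3.inv [.w1, .w2] rfl (by simp; omega) (by intro v hv; simp at hv; simp [hv])
    (by simp [core])
  have h24 := h23.trans h4
  refine .seq (mergeNode_spec hB h4.inv (o := o) (x := x) (y := (absorb o x.pw c S).1)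
    (prefix_getElem? h23.pre hx) hacc
    ((h24.var _ (by decide)).trans ho) (by omega) (by simp; omega) ?_)
  intro s5 L5 h5 hn5 hid hc5
  simp only [St.tick_clk, St.set_clk] at hc5
  refine .mov (s5.v .id) h5.inv.zero rfl ?_
  have h6 := Inv.step (s' := (s5.set .item (s5.v .id)).tick 1)
    h5.inv [.item] rfl (by simp) (by intro v hv; simp at hv; simp [hv]) (by simp [core])
  have h46 := h4.trans (h5.trans h6)
  have h36 := h23.trans h46
  have hstk : ((s5.set .item (s5.v .id)).tick 1).v .stk = s3.v .stk := h46.var _ (by decide)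
  have hhd : ((s5.set .item (s5.v .id)).tick 1).v .head = s3.v .head := h46.var _ (by decide)
  refine hQ _ L5 (h36.mono (by decide)) ?_ hid ?_ ?_ ?_
  · exact (hn3.mono (Keeps.of_subset (List.subset_cons_self x _))).trans
      (hn5.mono (Keeps.of_subset (S' := merge o x (absorb o x.pw c S).1 ::
        (absorb o x.pw c S).2) (by simp))) (keeps_merge o x _ _)
  · rw [hstk]
    exact Linked.step h46 hS3
  · rw [hstk, hhd, hh3]
    exact (h46.cpw (s3.v .stk) hS3.le_cells).symm
  · simp only [St.tick_clk, St.set_clk]; omega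

theorem pushProg_spec (hB : Bounds D W M k) (hI : Inv M s L) {o : Bool} {x : TopTree (Fin k)}
    {S : List (TopTree (Fin k))}
    (hx : L[s.v .item]? = some x) (hS : Linked s L (s.v .stk) S) (ho : s.v .oper = opCode o)
    (hsz : x.size + total S < M) (hclk : s.clk + 120 * S.length + 300 ≤ M)
    (hQ : ∀ s' L', Step M (temps ++ [.cells, .item]) s L s' L' → New L L' (push o x S) →
      Linked s' L' (s'.v .stk) (push o x S) →
      s'.clk + 120 * (push o x S).length ≤ s.clk + 120 * S.length + 300 → Q s') :
    WP D W pushProg s Q := by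
  have hcl := hI.count_le
  have hce := hI.cells_le
  have hxl := (List.getElem?_eq_some_iff.1 hx).1
  have hle := hS.le_cells
  obtain ⟨-, -, -, -, -, -, -, -, -, -, -, hp⟩ := hI.record _ _ hx
  refine .seq (.ld hB.le_W hB.W_gt (s.v .item) x.pw rfl (hB.lt_D (by omega)) hp ?_)
  refine .seq (.ld hB.le_W hB.W_gt (s.v .stk) (s.m .cpw (s.v .stk)) rfl
    (hB.lt_D (by omega)) rfl ?_)
  have hpx := x.pw_le_size
  have h1 := Inv.step (s' := ((((s.set .bound x.pw).tick 4).set .head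
    (s.m .cpw (s.v .stk))).tick 4).tick 1) hI [.bound, .head] rfl (by simp; omega)
    (by intro v hv; simp at hv; simp [hv]) (by simp [core])
  refine .seq (.cond (fun hc => ?_) (fun hc => .skip ?_))
  · -- the top of the stack is smaller than the item
    have hc' : s.m .cpw (s.v .stk) < x.pw := hc
    cases S with
    | nil => have := hS.cpw_nil hI; omega
    | cons c S =>
      have hcp : s.m .cpw (s.v .stk) = c.pw := hS.2.2.2.1
      rw [hcp] at hc'
      rw [total_cons] at hsz
      rw [List.length_cons] at hclk
      have htot := absorb_total o x.pw c S
      refine pushAbsorb_spec hB h1.inv (o := o) (x := x) (c := c) (S := S) hx (Linked.step h1 hS)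
        ho rfl hsz (by simp; omega) ?_
      intro s2 L2 h2 hn2 hi2 hS2 hh2 hc2
      simp only [St.tick_clk, St.set_clk] at hc2
      refine pushRest_spec hB h2.inv hi2 hS2 (((h1.trans h2).var _ (by decide)).trans ho) hh2
        (by rw [size_merge]; omega) (by omega) ?_
      intro s3 L3 h3 hn3 hS3 hc3
      rw [← push_eq o x c S hc'] at hn3 hS3 hc3
      refine hQ s3 L3 ((h1.trans (h2.trans h3)).mono (by decide)) ?_ hS3
        (by rw [List.length_cons]; omega)
      rw [push_eq o x c S hc'] at hn3 ⊢
      exact hn2.trans hn3 (keeps_carry o _ _)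
  · -- nothing to absorb
    have hc' : ¬ s.m .cpw (s.v .stk) < x.pw := hc
    have hpush : push o x S = carry o x S := by
      cases S with
      | nil => rfl
      | cons c S =>
        rw [hS.2.2.2.1] at hc'
        rw [push, if_neg hc']
    have h2 := h1.trans (Inv.step (s' := (((((s.set .bound x.pw).tick 4).set .head
      (s.m .cpw (s.v .stk))).tick 4).tick 1).tick 1) h1.inv [] rfl (by simp) (fun _ _ => rfl)
      (fun _ _ => rfl))
    refine pushRest_spec hB h2.inv (o := o) (z := x) (R := S) hx (Linked.step h2 hS) ho rfl hsz
      (by simp; omega) ?_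
    intro s3 L3 h3 hn3 hS3 hc3
    simp only [St.tick_clk, St.set_clk] at hc3
    rw [← hpush] at hn3 hS3 hc3
    exact hQ s3 L3 ((h2.trans h3).mono (by decide)) hn3 hS3 (by omega)

/-- Merge all elements of the nonempty list `stk` to a top tree `acc`. -/
def collapseProg : Prog :=
  ld .acc .cid .stk ;; ld .stk .cnext .stk ;; ld .head .cpw .stk ;; mov .bound .modulus ;;
  loop (.lt .head .bound) (popMerge .acc)

theorem collapseProg_spec (hB : Bounds D W M k) (hI : Inv M s L) {o : Bool} {c : TopTree (Fin k)}
    {S : List (TopTree (Fin k))} (hS : Linked s L (s.v .stk) (c :: S)) (ho : s.v .oper = opCode o)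
    (hsz : c.size + total S < M) (hclk : s.clk + 120 * S.length + 20 ≤ M)
    (hQ : ∀ s' L', Step M temps s L s' L' → New L L' [collapse o c S] →
      L'[s'.v .acc]? = some (collapse o c S) → s'.clk ≤ s.clk + 120 * S.length + 20 → Q s') :
    WP D W collapseProg s Q := by
  have hce := hI.cells_le
  have hle := hS.le_cells
  have hle2 := hS.2.2.2.2.le_cells
  refine .seq (.ld hB.le_W hB.W_gt (s.v .stk) (s.m .cid (s.v .stk)) rfl (hB.lt_D (by omega)) rfl ?_)
  refine .seq (.ld hB.le_W hB.W_gt (s.v .stk) (s.m .cnext (s.v .stk)) (by simp)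
    (hB.lt_D (by omega)) (by simp) ?_)
  refine .seq (.ld hB.le_W hB.W_gt (s.m .cnext (s.v .stk)) (s.m .cpw (s.m .cnext (s.v .stk)))
    (by simp) (hB.lt_D (by omega)) (by simp) ?_)
  refine .seq (.mov M (by simp [hI.zero]) (by simp [hI.modulus]) ?_)
  have h2 := Inv.step (s' := ((((((((s.set .acc (s.m .cid (s.v .stk))).tick 4).set .stk
    (s.m .cnext (s.v .stk))).tick 4).set .head (s.m .cpw (s.m .cnext (s.v .stk)))).tick 4).set
    .bound M).tick 1)) hI [.bound, .head, .acc, .stk] rfl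
    (by simp; omega) (by intro v hv; simp at hv; simp [hv]) (by simp [core])
  refine absorb_loop_spec hB (o := o) (b := M) le_rfl (x := c) (S := S) h2.inv
    (by simpa using hS.2.2.1) (by simpa using Linked.step h2 hS.2.2.2.2) (by simpa using ho)
    (by simp) (by simp) (by omega) (by simp; omega) ?_
  intro s3 L3 h3 hn3 hacc hS3 hh3 hc3
  have hb : ∀ d ∈ S, d.pw < M := by
    intro d hd
    have h4 : d.size ≤ total S := List.single_le_sum (by simp) _ (List.mem_map_of_mem hd)
    have := d.pw_le_size
    omega
  rw [absorb_eq_collapse hb] at hn3 hacc hc3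
  simp only [St.tick_clk, St.set_clk, List.length_nil] at hc3
  exact hQ s3 L3 ((h2.trans h3).mono (by decide)) hn3 hacc (by omega)

/-- Find or create the node for the edge between the labels `lab` and `clab`, with the rank
`w3`. -/
def leafNode : Prog :=
  setc .w0 0 ;; mov .w1 .lab ;; mov .w2 .clab ;; setc .size 1 ;; setc .power 1 ;; getNode ;;
  mov .item .id

theorem leafNode_spec (hB : Bounds D W M k) (hI : Inv M s L) {a b : Fin k} {r : Bool}
    (ha : s.v .lab = a) (hb : s.v .clab = b) (hr : s.v .w3 = r.toNat) (hclk : s.clk + 70 ≤ M)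
    (hQ : ∀ s' L', Step M (temps ++ [.item]) s L s' L' → New L L' [.leaf a b r] →
      L'[s'.v .item]? = some (.leaf a b r) → s'.v .stk = s.v .stk → s'.clk ≤ s.clk + 70 → Q s') :
    WP D W leafNode s Q := by
  have h16 := hB.le_M
  refine .seq (.setc (hB.lt_W (by omega)) ?_)
  refine .seq (.mov (a : ℕ) (by simp [hI.zero]) (by simp [ha]) ?_)
  refine .seq (.mov (b : ℕ) (by simp [hI.zero]) (by simp [hb]) ?_)
  refine .seq (.setc (hB.lt_W (by omega)) ?_)
  refine .seq (.setc (hB.lt_W (by omega)) ?_)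
  have h1 := Inv.step (s' := ((((((((((s.set .w0 0).tick 1).set .w1 (a : ℕ)).tick 1).set .w2
    (b : ℕ)).tick 1).set .size 1).tick 1).set .power 1).tick 1)) hI [.w0, .w1, .w2, .size, .power]
    rfl (by simp; omega) (by intro v hv; simp at hv; simp [hv]) (by simp [core])
  refine .seq (getNode_spec hB h1.inv (T := .leaf a b r) ⟨by simp, by simp, by simp, by simp [hr]⟩
    (by simp [size]) (by simp [pw, cls, size]) (by simp; omega) ?_)
  intro s2 L2 h2 hn hid hc2
  simp only [St.tick_clk, St.set_clk] at hc2
  refine .mov (s2.v .id) h2.inv.zero rfl ?_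
  have h3 := Inv.step (s' := (s2.set .item (s2.v .id)).tick 1)
    h2.inv [.item] rfl (by simp) (by intro v hv; simp at hv; simp [hv]) (by simp [core])
  have h13 := h1.trans (h2.trans h3)
  refine hQ _ L2 (h13.mono (by decide)) ?_ (by simpa using hid) (h13.var _ (by decide))
    (by simp; omega)
  intro X hX
  rcases hn X hX with hX | rfl
  · exact Or.inl hX
  · exact Or.inr ⟨_, by simp, TopTree.self_mem_subtrees _⟩

end Ram

/-! ### The items of a node and their sizes -/

namespace Entry

variable {α : Type}

open TopTree

/-- The number of clusters that are merged for the light items of a list of children, where the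
heavy child is the one with the position `h`. -/
def charge (h : ℕ) : List (Entry α) → ℕ
  | [] => 0
  | e :: es => (if es.length = h then 0 else e.stack.length) + charge h es

theorem charge_of_length_le {h : ℕ} {es : List (Entry α)} (hh : es.length ≤ h) :
    charge h es = (es.map fun e => e.stack.length).sum := by
  induction es with
  | nil => rfl
  | cons e es ih =>
    rw [List.length_cons] at hh
    rw [charge, if_neg (by omega), ih (by omega)]; rfl

theorem heaviest_pos_lt {es : List (Entry α)} (hes : es ≠ []) : (heaviest es).2.1 < es.length := by
  induction es with
  | nil => exact absurd rfl hes
  | cons e es ih =>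
    rw [heaviest]
    split_ifs with h
    · simp
    · have : es ≠ [] := by rintro rfl; exact h (Nat.succ_pos _)
      have := ih this
      rw [List.length_cons]; omega

/-- The light items use up all stacks but the one of the heavy child. -/
theorem charge_heaviest (es : List (Entry α)) :
    charge (heaviest es).2.1 es + (heaviest es).2.2.length =
      (es.map fun e => e.stack.length).sum := by
  induction es with
  | nil => rfl
  | cons e es ih =>
    rw [heaviest, List.map_cons, List.sum_cons]
    split_ifs with h
    · rw [charge, if_pos rfl, charge_of_length_le le_rfl]; simp only; omega
    · have hes : es ≠ [] := by rintro rfl; exact h (Nat.succ_pos _)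
      have := heaviest_pos_lt hes
      rw [charge, if_neg (by omega)]; omega

theorem keeps_light (a : α) (e : Entry α) : Keeps e.stack [e.light a] := by
  rcases e with ⟨b, n, _ | ⟨c, S⟩⟩
  · intro c hc; simp at hc
  · exact (keeps_collapse true c S).trans
      ((Keeps.of_subset (S' := [_, _]) (by simp)).trans (keeps_merge true (.leaf a b true) _ []))

theorem keeps_foldr_push (o : Bool) (Y : List (TopTree α)) : Keeps Y (Y.foldr (push o) []) := by
  induction Y with
  | nil => exact Keeps.refl _
  | cons y Y ih => exact ((Keeps.refl [y]).append ih).trans (keeps_push o y _)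

theorem keeps_map_light (a : α) (l : List (Entry α)) :
    Keeps (l.flatMap stack) (l.map (light a)) := by
  induction l with
  | nil => exact Keeps.refl _
  | cons e l ih => exact (keeps_light a e).append ih

/-- No cluster of a child gets lost. -/
theorem keeps_nodeStack (a : α) (es : List (Entry α)) :
    Keeps (es.flatMap stack) (nodeStack a es) := by
  rcases eq_or_ne es [] with rfl | hes
  · exact Keeps.refl _
  obtain ⟨l, e, r, c, S, rfl, -, h1, h2⟩ := nodeStack_spec a hes
  have h3 : Keeps ((l ++ e :: r).flatMap stack)
      ((l.map (light a) ++ heavy a e :: r.map (light a)) ++ e.stack) := by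
    intro d hd X hX
    simp only [List.flatMap_append, List.flatMap_cons, List.mem_append] at hd
    rcases hd with hd | hd | hd
    · obtain ⟨y, hy, hXy⟩ := keeps_map_light a l d hd X hX
      exact ⟨y, by simp [List.mem_append, hy], hXy⟩
    · exact ⟨d, by simp [hd], hX⟩
    · obtain ⟨y, hy, hXy⟩ := keeps_map_light a r d hd X hX
      exact ⟨y, by simp [List.mem_append, hy], hXy⟩
  have h4 := (keeps_foldr_push false (l.map (light a) ++ heavy a e :: r.map (light a)))
  rw [h1] at h4
  rw [h2]
  exact h3.trans (((h4.trans (keeps_collapse false c S)).append (Keeps.refl _)).trans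
    (keeps_push true _ _))

theorem total_items_le (a : α) (h : ℕ) {es : List (Entry α)}
    (hes : ∀ e ∈ es, total e.stack = e.size) :
    total (items a h es) ≤ (es.map fun e => e.size + 1).sum := by
  induction es with
  | nil => simp [items]
  | cons e es ih =>
    have h1 := ih fun f hf => hes f (by simp [hf])
    have h2 := hes e (by simp)
    have h3 : (e.heavy a).size = 1 := rfl
    have h4 := size_light a e
    rw [items, total_cons, List.map_cons, List.sum_cons]
    split_ifs <;> omega

theorem total_heaviest_le {es : List (Entry α)} (hes : ∀ e ∈ es, total e.stack = e.size) :
    total (heaviest es).2.2 ≤ (es.map fun e => e.size + 1).sum := by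
  induction es with
  | nil => simp [heaviest]
  | cons e es ih =>
    have h1 := ih fun f hf => hes f (by simp [hf])
    have h2 := hes e (by simp)
    rw [heaviest, List.map_cons, List.sum_cons]
    split_ifs
    · simp only; omega
    · omega

end Entry

namespace Ram

open TopTree

variable {k : ℕ} {D W M : ℕ} {s s' : St} {Q : St → Prop} {L L' L'' : List (TopTree (Fin k))}

/-! ### The program for a node -/

/-- Build the item of the pending entry `child` below a node with the label `lab`. -/
def itemProg : Prog :=
  ld .clab .plab .child ;; ld .stk .pstk .child ;;
  cond (.eq .stk .zero) (setc .w3 0 ;; leafNode)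
    (setc .w3 1 ;; leafNode ;; cond (.eq .child .hpos) .skip
      (setc .oper 1 ;; collapseProg ;; mov .w1 .item ;; mov .w2 .acc ;; mergeNode ;; mov .item .id))

theorem itemProg_spec (hB : Bounds D W M k) (hI : Inv M s L) {a : Fin k} {e : Entry (Fin k)}
    {p : Prop} [Decidable p] (hp : p ↔ s.v .child = s.v .hpos)
    (ha : s.v .lab = a) (hl : s.m .plab (s.v .child) = e.label)
    (hS : Linked s L (s.m .pstk (s.v .child)) e.stack) (hch : s.v .child < M)
    (hsz : total e.stack + 1 < M)
    (hclk : s.clk + 120 * (if p then 0 else e.stack.length) + 220 ≤ M)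
    (hQ : ∀ s' L', Step M (temps ++ [.item, .clab, .oper]) s L s' L' →
      New L L' [if p then e.heavy a else e.light a] →
      L'[s'.v .item]? = some (if p then e.heavy a else e.light a) →
      s'.clk ≤ s.clk + 120 * (if p then 0 else e.stack.length) + 220 → Q s') :
    WP D W itemProg s Q := by
  have h16 := hB.le_M
  refine .seq (.ld hB.le_W hB.W_gt (s.v .child) (e.label : ℕ) rfl (hB.lt_D (by omega)) hl ?_)
  refine .seq (.ld hB.le_W hB.W_gt (s.v .child) (s.m .pstk (s.v .child)) rfl (hB.lt_D (by omega))
    rfl ?_)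
  have hclk' : s.clk + 220 ≤ M := by omega
  refine .cond (fun hc => ?_) (fun hc => ?_)
  · -- a child without children: the light and the heavy item are the same
    have hnil : e.stack = [] := by
      refine hS.eq_zero_iff.1 ?_
      simpa [Cond.Holds, hI.zero] using hc
    refine .seq (.setc (hB.lt_W (by omega)) ?_)
    have h1 := Inv.step (s' := ((((((s.set .clab (e.label : ℕ)).tick 4).set .stk
      (s.m .pstk (s.v .child))).tick 4).tick 1).set .w3 0).tick 1) hI [.clab, .stk, .w3] rfl
      (by simp; omega) (by intro v hv; simp at hv; simp [hv]) (by simp [core])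
    have hite : (if p then e.heavy a else e.light a) = .leaf a e.label false := by
      simp [Entry.heavy, Entry.light, hnil]
    refine leafNode_spec hB h1.inv (a := a) (b := e.label) (r := false) ha rfl rfl
      (by simp; omega) ?_
    intro s2 L2 h2 hn hi _ hc2
    simp only [St.tick_clk, St.set_clk] at hc2
    rw [hite] at hQ
    exact hQ s2 L2 ((h1.trans h2).mono (by decide)) hn hi (by omega)
  · have hne : e.stack ≠ [] := by
      intro hnil
      refine hc ?_
      have := hS.eq_zero_iff.2 hnil
      simpa [Cond.Holds, hI.zero] using this
    obtain ⟨c, S, hcS⟩ := List.exists_cons_of_ne_nil hne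
    refine .seq (.setc (hB.lt_W (by omega)) ?_)
    have h1 := Inv.step (s' := ((((((s.set .clab (e.label : ℕ)).tick 4).set .stk
      (s.m .pstk (s.v .child))).tick 4).tick 1).set .w3 1).tick 1) hI [.clab, .stk, .w3] rfl
      (by simp; omega) (by intro v hv; simp at hv; simp [hv]) (by simp [core])
    refine .seq (leafNode_spec hB h1.inv (a := a) (b := e.label) (r := true) ha rfl rfl
      (by simp; omega) ?_)
    intro s2 L2 h2 hn hi hstk hc2
    simp only [St.tick_clk, St.set_clk] at hc2
    have h12 := h1.trans h2
    have hc12 : s2.v .child = s.v .child := h12.var _ (by decide)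
    have hp12 : s2.v .hpos = s.v .hpos := h12.var _ (by decide)
    refine .cond (fun hc => .skip ?_) (fun hc => ?_)
    · -- the heavy child
      have hpt : p := hp.2 (by simpa [Cond.Holds, hc12, hp12] using hc)
      have h3 := Inv.step (s' := (s2.tick 1).tick 1) h2.inv [] rfl (by simp only [St.tick_clk]; omega) (fun _ _ => rfl)
        (fun _ _ => rfl)
      rw [if_pos hpt, if_pos hpt] at hQ
      have hhe : e.heavy a = .leaf a e.label true := by simp [Entry.heavy, hcS]
      rw [hhe] at hQ
      exact hQ _ L2 ((h12.trans h3).mono (by decide)) hn hi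
        (by simp only [St.tick_clk]; omega)
    · -- a light child
      have hpf : ¬ p := fun h => hc (by simpa [Cond.Holds, hc12, hp12] using hp.1 h)
      rw [if_neg hpf] at hQ
      rw [if_neg hpf] at hQ hclk
      have hli : e.light a = merge true (.leaf a e.label true) (collapse true c S) := by
        rw [Entry.light, hcS]; rfl
      rw [hcS, List.length_cons] at hclk hQ
      rw [hcS, total_cons] at hsz
      refine .seq (.setc (hB.lt_W (by omega)) ?_)
      have h3 := Inv.step (s' := ((s2.tick 1).set .oper 1).tick 1) h2.inv [.oper] rfl (by simp; omega)
        (by intro v hv; simp at hv; simp [hv]) (by simp [core])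
      have hS3 := Linked.step (h12.trans h3) hS
      rw [hcS] at hS3
      have hstk3 : (((s2.tick 1).set .oper 1).tick 1).v .stk = s.m .pstk (s.v .child) := by
        simp [hstk]
      rw [← hstk3] at hS3
      refine .seq (collapseProg_spec hB h3.inv (o := true) hS3 rfl (by omega) (by simp; omega) ?_)
      intro s4 L4 h4 hn4 hacc hc4
      simp only [St.tick_clk, St.set_clk] at hc4
      have h34 := h3.trans h4
      have hi4 : L4[s4.v .item]? = some (.leaf a e.label true) := by
        rw [h34.var _ (by decide)]
        exact prefix_getElem? h34.pre hi
      refine .seq (.mov (s4.v .item) h4.inv.zero rfl ?_)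
      refine .seq (.mov (s4.v .acc) h4.inv.zero rfl ?_)
      have h5 := Inv.step (s' := (((s4.set .w1 (s4.v .item)).tick 1).set .w2 (s4.v .acc)).tick 1)
        h4.inv [.w1, .w2] rfl (by simp; omega) (by intro v hv; simp at hv; simp [hv])
        (by simp [core])
      refine .seq (mergeNode_spec hB h5.inv (o := true) hi4 hacc ((h4.trans h5).var _ (by decide))
        (by rw [collapse_size]; simp only [TopTree.size]; omega) (by simp; omega) ?_)
      intro s6 L6 h6 hn6 hid hc6
      simp only [St.tick_clk, St.set_clk] at hc6
      refine .mov (s6.v .id) h6.inv.zero rfl ?_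
      have h7 := Inv.step (s' := (s6.set .item (s6.v .id)).tick 1)
        h6.inv [.item] rfl (by simp) (by intro v hv; simp at hv; simp [hv]) (by simp [core])
      rw [hli] at hQ
      refine hQ _ L6 (((h12.trans h34).trans (h5.trans (h6.trans h7))).mono (by decide)) ?_
        hid (by simp; omega)
      have hk := keeps_merge true (.leaf a e.label true) (collapse true c S) []
      exact ((hn.mono (Keeps.of_subset (by simp))).trans (hn4.mono (Keeps.of_subset (by simp)))
        (Keeps.refl [.leaf a e.label true, collapse true c S])).trans hn6 hk

/-- Push the item of the pending entry `child` on the list `row` and proceed to the next child. -/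
def childBody : Prog :=
  itemProg ;; setc .oper 2 ;; mov .stk .row ;; pushProg ;; mov .row .stk ;; add .child .child .one

theorem childBody_spec (hB : Bounds D W M k) (hI : Inv M s L) {a : Fin k} {e : Entry (Fin k)}
    {p : Prop} [Decidable p] (hp : p ↔ s.v .child = s.v .hpos)
    (ha : s.v .lab = a) (hl : s.m .plab (s.v .child) = e.label)
    (hS : Linked s L (s.m .pstk (s.v .child)) e.stack) {R : List (TopTree (Fin k))}
    (hR : Linked s L (s.v .row) R) (hch : s.v .child < M)
    (hsz : total e.stack + 1 + total R < M)
    (hclk : s.clk + 120 * R.length + 120 * (if p then 0 else e.stack.length) + 600 ≤ M)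
    (hQ : ∀ s' L', Step M (temps ++ [.item, .cells, .clab, .oper, .row, .child]) s L s' L' →
      New L L' (push false (if p then e.heavy a else e.light a) R) →
      Linked s' L' (s'.v .row) (push false (if p then e.heavy a else e.light a) R) →
      s'.v .child = s.v .child + 1 →
      s'.clk + 120 * (push false (if p then e.heavy a else e.light a) R).length ≤
        s.clk + 120 * R.length + 120 * (if p then 0 else e.stack.length) + 600 → Q s') :
    WP D W childBody s Q := by
  have h16 := hB.le_M
  refine .seq (itemProg_spec hB hI hp ha hl hS hch (by omega) (by omega) ?_)
  intro s1 L1 h1 hn1 hi1 hc1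
  set x := if p then e.heavy a else e.light a with hx
  have hxs : x.size ≤ total e.stack + 1 := by
    have h3 : (e.heavy a).size = 1 := rfl
    have h4 := Entry.size_light a e
    rw [hx]; split_ifs <;> omega
  have hrow1 : s1.v .row = s.v .row := h1.var _ (by decide)
  refine .seq (.setc (hB.lt_W (by omega)) ?_)
  refine .seq (.mov (s.v .row) h1.inv.zero hrow1 ?_)
  have h2 := Inv.step (s' := (((s1.set .oper 2).tick 1).set .stk (s.v .row)).tick 1)
    h1.inv [.oper, .stk] rfl (by simp; omega) (by intro v hv; simp at hv; simp [hv])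
    (by simp [core])
  refine .seq (pushProg_spec hB h2.inv (o := false) hi1 (Linked.step (h1.trans h2) hR) rfl
    (by omega) (by simp; omega) ?_)
  intro s3 L3 h3 hn3 hS3 hc3
  simp only [St.tick_clk, St.set_clk] at hc3
  have h13 := (h1.trans h2).trans h3
  have hch3 : s3.v .child = s.v .child := h13.var _ (by decide)
  refine .seq (.mov (s3.v .stk) h3.inv.zero rfl ?_)
  refine .add (s.v .child + 1) (by simp [hch3, h3.inv.one]) (hB.lt_W (by omega)) ?_
  have h4 := Inv.step (s' := (((s3.set .row (s3.v .stk)).tick 1).set .child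
    (s.v .child + 1)).tick 1)
    h3.inv [.row, .child] rfl (by simp; omega) (by intro v hv; simp at hv; simp [hv])
    (by simp [core])
  refine hQ _ L3 ((h13.trans h4).mono (by decide)) ?_ (Linked.step h4 hS3) rfl 
    (by simp only [St.tick_clk, St.set_clk]; omega)
  exact (hn1.mono (Keeps.of_subset (by simp))).trans hn3 (keeps_push false x R)

/-- The entries `P` are pending: the arrays hold their labels, sizes and stacks, the last element of
`P` at position zero. -/
def Pending (s : St) (L : List (TopTree (Fin k))) : List (Entry (Fin k)) → Prop
  | [] => True
  | e :: P => s.m .plab P.length = e.label ∧ s.m .psz P.length = e.size ∧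
      Linked s L (s.m .pstk P.length) e.stack ∧ Pending s L P

theorem Pending.step {mods : List Var} (h : Step M mods s L s' L') {P : List (Entry (Fin k))}
    (hP : Pending s L P) : Pending s' L' P := by
  induction P with
  | nil => trivial
  | cons e P ih =>
    obtain ⟨h1, h2, h3, h4⟩ := hP
    exact ⟨by rw [h.plab, h1], by rw [h.psz, h2], by rw [h.pstk]; exact Linked.step h h3, ih h4⟩

theorem Pending.of_append {es P : List (Entry (Fin k))} (h : Pending s L (es ++ P)) :
    Pending s L P := by
  induction es with
  | nil => exact h
  | cons e es ih => exact ih h.2.2.2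

/-- Compare the pending entry `child` with the largest one so far. -/
def heavyBody : Prog :=
  ld .tmp .psz .child ;; add .tmp .tmp .one ;; add .total .total .tmp ;;
  cond (.lt .hmax .tmp) (mov .hmax .tmp ;; mov .hpos .child ;; ld .hstk .pstk .child) .skip ;;
  add .child .child .one

theorem heavyLoop_spec (hB : Bounds D W M k) (hI : Inv M s L) {P : List (Entry (Fin k))}
    (h1 : s.v .child = P.length) (h2 : s.v .hmax = 0) (h3 : s.v .hpos = P.length)
    (h4 : s.v .hstk = 0) (h5 : s.v .total = 0) (htop : s.v .top < M)
    {es : List (Entry (Fin k))} (hP : Pending s L (es ++ P))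
    (hle : es.length + P.length ≤ s.v .top) (hsz : (es.map fun e => e.size + 1).sum < M)
    (hQ : ∀ s', Step M [.tmp, .hmax, .hpos, .hstk, .total, .child] s L s' L →
      s'.v .child = es.length + P.length → s'.v .hmax = (Entry.heaviest es).1 →
      s'.v .hpos = (Entry.heaviest es).2.1 + P.length →
      Linked s' L (s'.v .hstk) (Entry.heaviest es).2.2 →
      s'.v .total = (es.map fun e => e.size + 1).sum → s'.clk ≤ s.clk + 20 * es.length →
      WP D W (loop (.lt .child .top) heavyBody) s' Q) :
    WP D W (loop (.lt .child .top) heavyBody) s Q := by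
  induction es with
  | nil =>
    exact hQ s ((Inv.step hI [] rfl le_rfl (fun _ _ => rfl) (fun _ _ => rfl)).mono (by decide))
      (by simpa using h1) h2 (by simpa [Entry.heaviest] using h3) h4 h5 (by simp)
  | cons e es ih =>
    rw [List.length_cons] at hle
    rw [List.map_cons, List.sum_cons] at hsz
    refine ih hP.2.2.2 (by omega) (by omega) ?_
    intro s1 hs1 c1 c2 c3 c4 c5 c6
    obtain ⟨d1, d2, d3, -⟩ := Pending.step hs1 hP
    have hlen : (es.append P).length = es.length + P.length := List.length_append
    rw [hlen] at d1 d2 d3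
    have ht1 : s1.v .top = s.v .top := hs1.var _ (by decide)
    have hI1 := hs1.inv
    refine .loop_true (by simp only [Cond.Holds]; omega) ?_
    refine .seq (.ld hB.le_W hB.W_gt (es.length + P.length) e.size c1 (hB.lt_D (by omega)) d2 ?_)
    refine .seq (.add (e.size + 1) (by simp [hI1.one]) (hB.lt_W (by omega)) ?_)
    refine .seq (.add (e.size + 1 + (es.map fun e => e.size + 1).sum) (by simp [c5, add_comm])
      (hB.lt_W (by omega)) ?_)
    refine .seq (.cond (fun hc => .seq ?_) (fun hc => .skip ?_))
    · have hc' : s1.v .hmax < e.size + 1 := by simpa [Cond.Holds] using hc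
      refine .mov (e.size + 1) (by simp [hI1.zero]) (by simp) (.seq ?_)
      refine .mov (es.length + P.length) (by simp [hI1.zero]) (by simp [c1]) ?_
      refine .ld hB.le_W hB.W_gt (es.length + P.length) (s1.m .pstk (es.length + P.length))
        (by simp [c1]) (hB.lt_D (by omega)) rfl ?_
      refine .add (es.length + P.length + 1) (by simp [c1, hI1.one]) (hB.lt_W (by omega)) ?_
      have hs2 := Inv.step (s' := (((((((((((((((s1.tick 1).set .tmp e.size).tick 4).set .tmp
        (e.size + 1)).tick 1).set .total (e.size + 1 + (es.map fun e => e.size + 1).sum)).tick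
        1).tick 1).set .hmax (e.size + 1)).tick 1).set .hpos (es.length + P.length)).tick 1).set
        .hstk (s1.m .pstk (es.length + P.length))).tick 4).set .child
        (es.length + P.length + 1)).tick 1) hI1 [.tmp, .total, .hmax, .hpos, .hstk, .child]
        rfl (by simp; omega) (by intro v hv; simp at hv; simp [hv]) (by simp [core])
      have hh : Entry.heaviest (e :: es) = (e.size + 1, es.length, e.stack) := by
        rw [Entry.heaviest, if_pos (by omega)]
      rw [hh] at hQ
      refine hQ _ ((hs1.trans hs2).mono (by decide)) ?_ rfl rfl (Linked.step hs2 d3) rfl ?_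
      · simp; omega
      · simp; omega
    · have hc' : ¬ s1.v .hmax < e.size + 1 := by simpa [Cond.Holds] using hc
      refine .add (es.length + P.length + 1) (by simp [c1, hI1.one]) (hB.lt_W (by omega)) ?_
      have hs2 := Inv.step (s' := ((((((((((s1.tick 1).set .tmp e.size).tick 4).set .tmp
        (e.size + 1)).tick 1).set .total (e.size + 1 + (es.map fun e => e.size + 1).sum)).tick
        1).tick 1).tick 1).set .child (es.length + P.length + 1)).tick 1) hI1 [.tmp, .total, .child]
        rfl (by simp; omega) (by intro v hv; simp at hv; simp [hv]) (by simp [core])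
      have hh : Entry.heaviest (e :: es) = Entry.heaviest es := by
        rw [Entry.heaviest, if_neg (by omega)]
      rw [hh] at hQ
      refine hQ _ ((hs1.trans hs2).mono (by decide)) ?_ c2 c3 (Linked.step hs2 c4) rfl ?_
      · simp; omega
      · simp; omega

set_option maxRecDepth 4000 in
theorem childLoop_spec (hB : Bounds D W M k) (hI : Inv M s L) {P : List (Entry (Fin k))} {a : Fin k}
    {h : ℕ} (h1 : s.v .child = P.length) (h2 : s.v .row = 0) (h3 : s.v .hpos = h + P.length)
    (h4 : s.v .lab = a) (htop : s.v .top < M)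
    {es : List (Entry (Fin k))} (hP : Pending s L (es ++ P))
    (hes : ∀ e ∈ es, total e.stack = e.size)
    (hle : es.length + P.length ≤ s.v .top) (hsz : (es.map fun e => e.size + 1).sum < M)
    (hclk : s.clk + 120 * Entry.charge h es + 700 * es.length ≤ M)
    (hQ : ∀ s' L', Step M (temps ++ [.item, .cells, .clab, .oper, .row, .child]) s L s' L' →
      New L L' ((Entry.items a h es).foldr (push false) []) →
      s'.v .child = es.length + P.length →
      Linked s' L' (s'.v .row) ((Entry.items a h es).foldr (push false) []) →
      s'.clk + 120 * ((Entry.items a h es).foldr (push false) []).length ≤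
        s.clk + 120 * Entry.charge h es + 700 * es.length →
      WP D W (loop (.lt .child .top) childBody) s' Q) :
    WP D W (loop (.lt .child .top) childBody) s Q := by
  induction es with
  | nil =>
    exact hQ s L ((Inv.step hI [] rfl le_rfl (fun _ _ => rfl) (fun _ _ => rfl)).mono (by decide))
      (New.refl _ _) (by simpa using h1) h2 (by simp [Entry.items])
  | cons e es ih =>
    have hes' : ∀ e ∈ es, total e.stack = e.size := fun f hf => hes f (by simp [hf])
    have hti := Entry.total_items_le a h hes'
    have hte := hes e (by simp)
    rw [List.length_cons] at hle hclk
    rw [Entry.charge] at hclk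
    rw [List.map_cons, List.sum_cons] at hsz
    refine ih hP.2.2.2 hes' (by omega) (by omega) (by omega) ?_
    intro s1 L1 hs1 hn1 c1 c2 c3
    obtain ⟨d1, -, d3, -⟩ := Pending.step hs1 hP
    have hlen : (es.append P).length = es.length + P.length := List.length_append
    rw [hlen, ← c1] at d1 d3
    have ht1 : s1.v .top = s.v .top := hs1.var _ (by decide)
    have hp1 : s1.v .hpos = s.v .hpos := hs1.var _ (by decide)
    have hl1 : s1.v .lab = s.v .lab := hs1.var _ (by decide)
    refine .loop_true (by simp only [Cond.Holds]; omega) ?_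
    have hs2 := Inv.step (s' := s1.tick 1) hs1.inv [] rfl (by simp) (fun _ _ => rfl) (fun _ _ => rfl)
    refine childBody_spec hB hs2.inv (a := a) (e := e) (p := es.length = h)
      (by simp [c1, hp1, h3]) (hl1.trans h4) d1 (Linked.step hs2 d3) (Linked.step hs2 c2)
      (by simp; omega) (by rw [total_foldr_push]; omega) (by simp only [St.tick_clk]; omega) ?_
    intro s3 L3 h3 hn3 e1 e2 e3
    simp only [St.tick_clk, St.tick_v] at e2 e3
    refine hQ s3 L3 ((hs1.trans (hs2.trans h3)).mono (by decide)) ?_ ?_ e1 ?_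
    · refine hn1.trans hn3 ((Keeps.of_subset (by simp)).trans (keeps_push false _ _))
    · rw [e2, c1, List.length_cons]; omega
    · rw [Entry.items, List.foldr_cons, Entry.charge, List.length_cons]; omega

end Ram

namespace Ram

open TopTree

variable {k : ℕ} {D W M : ℕ} {s s' : St} {Q : St → Prop} {L L' L'' : List (TopTree (Fin k))}

/-- Merge the clusters in the list `row` horizontally, if there are any, and push the result on the
list `hstk`. -/
def mergeRow : Prog :=
  cond (.eq .row .zero) .skip
    (mov .stk .row ;; setc .oper 2 ;; collapseProg ;; mov .item .acc ;; setc .oper 1 ;;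
      mov .stk .hstk ;; pushProg ;; mov .hstk .stk)

theorem mergeRow_spec (hB : Bounds D W M k) (hI : Inv M s L) {R H O : List (TopTree (Fin k))}
    (hR : Linked s L (s.v .row) R) (hH : Linked s L (s.v .hstk) H) (h0 : R = [] → H = [] ∧ O = [])
    (h1 : ∀ c S, R = c :: S → O = push true (collapse false c S) H)
    (hsz : total R + total H < M)
    (hclk : s.clk + 120 * R.length + 120 * H.length + 400 ≤ M)
    (hQ : ∀ s' L', Step M (temps ++ [.item, .cells, .oper, .hstk]) s L s' L' → New L L' O →
      Linked s' L' (s'.v .hstk) O →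
      s'.clk + 120 * O.length ≤ s.clk + 120 * R.length + 120 * H.length + 400 → Q s') :
    WP D W mergeRow s Q := by
  have h16 := hB.le_M
  cases R with
  | nil =>
    obtain ⟨rfl, rfl⟩ := h0 rfl
    have hrow : s.v .row = 0 := hR
    refine .cond (fun hc => .skip ?_) (fun hc => absurd ?_ hc)
    · have h2 := Inv.step (s' := (s.tick 1).tick 1) hI [] rfl
        (by simp only [St.tick_clk]; omega) (fun _ _ => rfl) (fun _ _ => rfl)
      exact hQ _ L (h2.mono (by decide)) (New.refl _ _) (Linked.step h2 hH)
        (by simp only [St.tick_clk]; omega)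
    · simp only [Cond.Holds]; rw [hrow, hI.zero]
  | cons c S =>
    obtain rfl := h1 c S rfl
    have hrow : s.v .row ≠ 0 := hR.1
    rw [total_cons] at hsz
    rw [List.length_cons] at hclk
    refine .cond (fun hc => absurd ?_ hrow) (fun hc => ?_)
    · simp only [Cond.Holds] at hc; rw [hc, hI.zero]
    refine .seq (.mov (s.v .row) hI.zero rfl ?_)
    refine .seq (.setc (hB.lt_W (by omega)) ?_)
    have h2 := Inv.step (s' := ((((s.tick 1).set .stk (s.v .row)).tick 1).set .oper 2).tick 1)
      hI [.stk, .oper] rfl (by simp; omega) (by intro v hv; simp at hv; simp [hv])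
      (by simp [core])
    refine .seq (collapseProg_spec hB h2.inv (o := false) (Linked.step h2 hR) rfl (by omega)
      (by simp; omega) ?_)
    intro s3 L3 h3 hn3 hacc hc3
    simp only [St.tick_clk, St.set_clk] at hc3
    have h23 := h2.trans h3
    refine .seq (.mov (s3.v .acc) h3.inv.zero rfl ?_)
    refine .seq (.setc (hB.lt_W (by omega)) ?_)
    refine .seq (.mov (s.v .hstk) h3.inv.zero (h23.var .hstk (by decide)) ?_)
    have h4 := Inv.step (s' := (((((s3.set .item (s3.v .acc)).tick 1).set .oper 1).tick 1).set .stk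
      (s.v .hstk)).tick 1) h3.inv [.item, .stk, .oper] rfl (by simp; omega)
      (by intro v hv; simp at hv; simp [hv]) (by simp [core])
    refine .seq (pushProg_spec hB h4.inv (o := true) hacc (Linked.step (h23.trans h4) hH) rfl
      (by rw [collapse_size]; omega) (by simp; omega) ?_)
    intro s5 L5 h5 hn5 hS5 hc5
    simp only [St.tick_clk, St.set_clk] at hc5
    refine .mov (s5.v .stk) h5.inv.zero rfl ?_
    have h6 := Inv.step (s' := (s5.set .hstk (s5.v .stk)).tick 1) h5.inv [.hstk] rfl (by simp)
      (by intro v hv; simp at hv; simp [hv]) (by simp [core])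
    refine hQ _ L5 ((h23.trans (h4.trans (h5.trans h6))).mono (by decide)) ?_ (Linked.step h6 hS5)
      (by rw [List.length_cons]; simp only [St.tick_clk, St.set_clk]; omega)
    exact hn3.trans hn5 ((Keeps.of_subset (by simp)).trans (keeps_push true _ H))

/-- Replace the pending entries of the children by the entry of the node. -/
def putEntry : Prog :=
  mov .top .base ;; st .plab .top .lab ;; st .psz .top .total ;; st .pstk .top .hstk ;;
  add .top .top .one

theorem putEntry_spec (hB : Bounds D W M k) (hI : Inv M s L) {P : List (Entry (Fin k))}
    {e : Entry (Fin k)} (hP : Pending s L P) (h1 : s.v .base = P.length) (h2 : s.v .lab = e.label)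
    (h3 : s.v .total = e.size) (h4 : Linked s L (s.v .hstk) e.stack) (hb : P.length < M)
    (hQ : ∀ s', Inv M s' L → Pending s' L (e :: P) → s'.v .top = P.length + 1 →
      s'.v .node = s.v .node → s'.m .inp = s.m .inp → s'.clk ≤ s.clk + 20 → Q s') :
    WP D W putEntry s Q := by
  refine .seq (.mov P.length hI.zero h1 ?_)
  refine .seq (.st hB.le_W hB.W_gt P.length (e.label : ℕ) rfl (hB.lt_D (by omega)) h2 ?_)
  refine .seq (.st hB.le_W hB.W_gt P.length e.size rfl (hB.lt_D (by omega)) h3 ?_)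
  refine .seq (.st hB.le_W hB.W_gt P.length (s.v .hstk) rfl (hB.lt_D (by omega)) rfl ?_)
  refine .add (P.length + 1) (by simp [hI.one]) (hB.lt_W (by omega)) ?_
  set s1 := ((((((((((s.set .top P.length).tick 1).put .plab P.length (e.label : ℕ)).tick 4).put
    .psz P.length e.size).tick 4).put .pstk P.length (s.v .hstk)).tick 4).set .top
    (P.length + 1)).tick 1) with hs1
  have hlink : ∀ {S : List (TopTree (Fin k))} {p : ℕ}, Linked s L p S → Linked s1 L p S := by
    intro S
    induction S with
    | nil => exact fun h => h
    | cons c S ih =>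
      rintro p ⟨e1, e2, e3, e4, e5⟩
      exact ⟨e1, by simpa [hs1] using e2, by simpa [hs1] using e3, by simpa [hs1] using e4,
        by simpa [hs1] using ih e5⟩
  have hpend : ∀ R : List (Entry (Fin k)), R.length ≤ P.length → Pending s L R →
      Pending s1 L R := by
    intro R
    induction R with
    | nil => exact fun _ _ => trivial
    | cons f R ih =>
      rintro hle ⟨e1, e2, e3, e4⟩
      rw [List.length_cons] at hle
      have hne : R.length ≠ P.length := by omega
      exact ⟨by simpa [hs1, hne] using e1, by simpa [hs1, hne] using e2,
        by simpa [hs1, hne] using hlink e3, ih (by omega) e4⟩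
  refine hQ s1 (hI.congr (by simp [core, hs1]) (by simp [hs1]) (by simp [hs1]) (by simp [hs1])
    (by simp [hs1]) (by simp [hs1]) (by simp [hs1]; omega)) ?_ (by simp [hs1]) (by simp [hs1])
    (by simp [hs1]) (by simp [hs1])
  exact ⟨by simp [hs1], by simp [hs1], by simpa [hs1] using hlink h4, hpend P le_rfl hP⟩

/-- Process the node number `node - 1`, whose children are the last pending entries. -/
def nodeProg : Prog :=
  sub .node .node .one ;; mul .tmp .two .node ;; add .tmp .tmp .two ;; ld .lab .inp .tmp ;;
  add .tmp .tmp .one ;; ld .deg .inp .tmp ;; sub .base .top .deg ;;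
  mov .child .base ;; setc .hmax 0 ;; mov .hpos .base ;; setc .hstk 0 ;; setc .total 0 ;;
  loop (.lt .child .top) heavyBody ;; mov .child .base ;; setc .row 0 ;;
  loop (.lt .child .top) childBody ;; mergeRow ;; putEntry

theorem nodeProg_spec (hB : Bounds D W M k) (hI : Inv M s L) {P es : List (Entry (Fin k))}
    {a : Fin k} {i : ℕ} (hP : Pending s L (es ++ P)) (htop : s.v .top = es.length + P.length)
    (hnode : s.v .node = i + 1) (hlab : s.m .inp (2 + 2 * i) = a)
    (hdeg : s.m .inp (2 + 2 * i + 1) = es.length)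
    (hes : ∀ e ∈ es, total e.stack = e.size)
    (hsz : 2 * (es.map fun e => e.size + 1).sum < M) (hi : i < M) (htM : es.length + P.length < M)
    (hclk : s.clk + 120 * (es.map fun e => e.stack.length).sum + 750 * es.length + 500 ≤ M)
    (hQ : ∀ s' L', Inv M s' L' → Pending s' L' (Entry.node a es :: P) →
      s'.v .top = P.length + 1 → s'.v .node = i → s'.m .inp = s.m .inp →
      New L L' (Entry.nodeStack a es) →
      s'.clk + 120 * (Entry.nodeStack a es).length ≤
        s.clk + 120 * (es.map fun e => e.stack.length).sum + 750 * es.length + 500 → Q s') :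
    WP D W nodeProg s Q := by
  have h16 := hB.le_M
  have hch := Entry.charge_heaviest es
  set h := (Entry.heaviest es).2.1 with hh
  refine .seq (.sub i (by simp [hnode, hI.one]) (hB.lt_W (by omega)) ?_)
  refine .seq (.mul (2 * i) (by simp [hI.two]) (hB.lt_W (by omega)) ?_)
  refine .seq (.add (2 + 2 * i) (by simp [hI.two, add_comm]) (hB.lt_W (by omega)) ?_)
  refine .seq (.ld hB.le_W hB.W_gt (2 + 2 * i) (a : ℕ) rfl (hB.lt_D (by omega)) hlab ?_)
  refine .seq (.add (2 + 2 * i + 1) (by simp [hI.one]) (hB.lt_W (by omega)) ?_)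
  refine .seq (.ld hB.le_W hB.W_gt (2 + 2 * i + 1) es.length rfl (hB.lt_D (by omega)) hdeg ?_)
  refine .seq (.sub P.length (by simp [htop]) (hB.lt_W (by omega)) ?_)
  refine .seq (.mov P.length hI.zero rfl ?_)
  refine .seq (.setc (hB.lt_W (by omega)) ?_)
  refine .seq (.mov P.length hI.zero rfl ?_)
  refine .seq (.setc (hB.lt_W (by omega)) ?_)
  refine .seq (.setc (hB.lt_W (by omega)) ?_)
  have h1 := Inv.step (s' := ((((((((((((((((((((((((s.set .node i).tick 1).set .tmp
    (2 * i)).tick 1).set .tmp (2 + 2 * i)).tick 1).set .lab (a : ℕ)).tick 4).set .tmp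
    (2 + 2 * i + 1)).tick 1).set .deg es.length).tick 4).set .base P.length).tick 1).set .child
    P.length).tick 1).set .hmax 0).tick 1).set .hpos P.length).tick 1).set .hstk 0).tick 1).set
    .total 0).tick 1)) hI [.node, .tmp, .lab, .deg, .base, .child, .hmax, .hpos, .hstk, .total]
    rfl (by simp only [St.tick_clk, St.set_clk]; omega)
    (by intro v hv; simp at hv; simp [hv]) (by simp [core])
  refine .seq (heavyLoop_spec hB h1.inv (P := P) (es := es) rfl rfl rfl rfl rfl
    (by simp only [St.tick_v, St.set_v, reduceCtorEq, if_false]; omega) (Pending.step h1 hP)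
    htop.ge (by omega) ?_)
  intro s2 h2 c1 _ c3 c4 c5 c6
  simp only [St.tick_clk, St.set_clk] at c6
  have htop2 : s2.v .top = s.v .top := (h1.trans h2).var _ (by decide)
  have hbase2 : s2.v .base = P.length := h2.var _ (by decide)
  have hlab2 : s2.v .lab = a := h2.var _ (by decide)
  have hnode2 : s2.v .node = i := h2.var _ (by decide)
  refine .loop_false (by simp only [Cond.Holds]; omega) ?_
  refine .seq (.mov P.length h2.inv.zero hbase2 ?_)
  refine .seq (.setc (hB.lt_W (by omega)) ?_)
  have h3 := Inv.step (s' := ((((s2.tick 1).set .child P.length).tick 1).set .row 0).tick 1) h2.inv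
    [.child, .row] rfl (by simp only [St.tick_clk, St.set_clk]; omega)
    (by intro v hv; simp at hv; simp [hv]) (by simp [core])
  have h13 := h1.trans (h2.trans h3)
  refine .seq (childLoop_spec hB h3.inv (P := P) (es := es) (a := a) (h := h) rfl rfl c3 hlab2
    (by simp only [St.tick_v, St.set_v, reduceCtorEq, if_false]; omega) (Pending.step h13 hP)
    hes (by simp only [St.tick_v, St.set_v, reduceCtorEq, if_false]; omega) (by omega)
    (by simp only [St.tick_clk, St.set_clk]; omega) ?_)
  intro s4 L4 h4 hn4 d1 d2 d3
  simp only [St.tick_clk, St.set_clk] at d3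
  have h34 := h3.trans h4
  have h14 := h13.trans h4
  have htop4 : s4.v .top = s2.v .top := h34.var _ (by decide)
  have hbase4 : s4.v .base = P.length := (h34.var _ (by decide)).trans hbase2
  have hlab4 : s4.v .lab = a := (h34.var _ (by decide)).trans hlab2
  have hnode4 : s4.v .node = i := (h34.var _ (by decide)).trans hnode2
  have htot4 : s4.v .total = s2.v .total := h34.var _ (by decide)
  have hhst4 : s4.v .hstk = s2.v .hstk := h34.var _ (by decide)
  refine .loop_false (by simp only [Cond.Holds]; omega) ?_
  have h5 := Inv.step (s' := s4.tick 1) h4.inv [] rfl (by simp) (fun _ _ => rfl) (fun _ _ => rfl)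
  have hti := Entry.total_items_le a h hes
  have hth := Entry.total_heaviest_le hes
  have hrow0 : (Entry.items a h es).foldr (push false) [] = [] → es = [] := by
    intro h0
    cases es with
    | nil => rfl
    | cons e es => exact absurd h0 (push_ne_nil _ _ _)
  have hH4 : Linked s4 L4 (s4.v .hstk) (Entry.heaviest es).2.2 := by
    rw [hhst4]; exact Linked.step h34 c4
  refine .seq (mergeRow_spec hB h5.inv (H := (Entry.heaviest es).2.2) (O := Entry.nodeStack a es)
    (Linked.step h5 d2) (Linked.step h5 hH4) ?_ ?_ (by rw [total_foldr_push]; omega)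
    (by simp only [St.tick_clk]; omega) ?_)
  · intro h0
    obtain rfl := hrow0 h0
    exact ⟨rfl, rfl⟩
  · intro c S hcS
    rw [Entry.nodeStack, ← hh, hcS]
  intro s6 L6 h6 hn6 hS6 e1
  simp only [St.tick_clk] at e1
  have h46 := h5.trans h6
  have hall := h14.trans h46
  refine putEntry_spec hB h6.inv (e := Entry.node a es) (Pending.step hall hP.of_append)
    ((h46.var _ (by decide)).trans hbase4) ((h46.var _ (by decide)).trans hlab4)
    ((h46.var _ (by decide)).trans (htot4.trans c5)) hS6 (by omega) ?_
  intro s7 f1 f2 f3 f4 f5 f6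
  refine hQ s7 L6 f1 f2 f3 (f4.trans ((h46.var _ (by decide)).trans hnode4)) (f5.trans hall.inp) ?_
    (by omega)
  cases hR : (Entry.items a h es).foldr (push false) [] with
  | nil =>
    rw [hR] at hn4
    exact (hn4.mono (fun c hc => by simp at hc)).trans hn6 (Keeps.refl _)
  | cons c S =>
    have hns : Entry.nodeStack a es = push true (collapse false c S) (Entry.heaviest es).2.2 := by
      rw [Entry.nodeStack, ← hh, hR]
    rw [hR] at hn4
    refine (hn4.mono ((keeps_collapse false c S).trans ?_)).trans hn6 (Keeps.refl _)
    rw [hns]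
    exact (Keeps.of_subset (by simp)).trans (keeps_push true _ (Entry.heaviest es).2.2)

end Ram

namespace Ram

open TopTree LTree

variable {k : ℕ} {D W M : ℕ} {s s' : St} {Q : St → Prop} {L L' L'' : List (TopTree (Fin k))}

/-! ### The loop over all nodes -/

/-- The array `f` holds, from the record number `i` on, the labels and degrees of the roots of the
trees in the list `l`. -/
def InputAt (f : ℕ → ℕ) (i : ℕ) (l : List (LTree (Fin k))) : Prop :=
  ∀ j u, l[j]? = some u → f (2 + 2 * (i + j)) = u.label ∧ f (2 + 2 * (i + j) + 1) = u.degree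

theorem InputAt.left {f : ℕ → ℕ} {i : ℕ} {l r : List (LTree (Fin k))} (h : InputAt f i (l ++ r)) :
    InputAt f i l := fun j u hu => h j u (by
  rw [List.getElem?_append_left (List.getElem?_eq_some_iff.1 hu).1, hu])

theorem InputAt.right {f : ℕ → ℕ} {i : ℕ} {l r : List (LTree (Fin k))} (h : InputAt f i (l ++ r)) :
    InputAt f (i + l.length) r := fun j u hu => by
  have := h (l.length + j) u (by rw [List.getElem?_append_right (by omega)]; simpa using hu)
  rwa [← add_assoc] at this

/-- Process all nodes, in the order of decreasing numbers. -/
def nodeLoop : Prog := loop (.ne .node .zero) nodeProg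

/-- The loop, run up to the point where a forest is processed, provided that this is possible for
every tree of the forest. -/
theorem forest_spec {c : ℕ} {ts : List (LTree (Fin k))}
    (htree : ∀ t ∈ ts, ∀ {s : St} {L : List (TopTree (Fin k))} {P : List (Entry (Fin k))} {i : ℕ},
      Inv M s L → Pending s L P → s.v .top = P.length → s.v .node = i + t.numEdges + 1 →
      InputAt (s.m .inp) i t.subtrees → 2 * (i + t.numEdges + P.length + 1) < M →
      s.clk + (c * t.numEdges + 600) ≤ M →
      (∀ s' L', Inv M s' L' → Pending s' L' (t.entry :: P) → s'.v .top = P.length + 1 →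
        s'.v .node = i → s'.m .inp = s.m .inp → New L L' t.entry.stack →
        s'.clk + 120 * t.entry.stack.length ≤ s.clk + (c * t.numEdges + 600) →
        WP D W nodeLoop s' Q) →
      WP D W nodeLoop s Q) {P : List (Entry (Fin k))} {i : ℕ}
    (hI : Inv M s L) (hP : Pending s L P) (htop : s.v .top = P.length)
    (hnode : s.v .node = i + (ts.map fun t => t.numEdges + 1).sum)
    (hin : InputAt (s.m .inp) i (ts.flatMap fun t => t.subtrees))
    (hM : 2 * (i + (ts.map fun t => t.numEdges + 1).sum + P.length) < M)
    (hclk : s.clk + (ts.map fun t => c * t.numEdges + 600).sum ≤ M)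
    (hQ : ∀ s' L', Inv M s' L' → Pending s' L' (ts.map entry ++ P) →
      s'.v .top = ts.length + P.length → s'.v .node = i → s'.m .inp = s.m .inp →
      New L L' ((ts.map entry).flatMap Entry.stack) →
      s'.clk + 120 * ((ts.map entry).map fun e => e.stack.length).sum ≤
        s.clk + (ts.map fun t => c * t.numEdges + 600).sum → WP D W nodeLoop s' Q) :
    WP D W nodeLoop s Q := by
  induction ts generalizing i with
  | nil => exact hQ s L hI hP (by simpa using htop) (by simpa using hnode) rfl (New.refl _ _) (by simp)
  | cons t ts ih =>
    rw [List.flatMap_cons] at hin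
    simp only [List.map_cons, List.sum_cons, List.length_cons] at hnode hM hclk hQ
    have hlen : ts.length ≤ (ts.map fun t => t.numEdges + 1).sum := by
      clear * -
      induction ts with
      | nil => simp
      | cons t ts ih => simp only [List.map_cons, List.sum_cons, List.length_cons]; omega
    have hin2 := hin.right
    rw [LTree.length_subtrees] at hin2
    refine ih (fun u hu => htree u (by simp [hu])) (i := i + (t.numEdges + 1)) (by omega) hin2
      (by omega) (by omega) ?_
    intro s1 L1 h1 h2 h3 h4 h5 h6 h7
    refine htree t (by simp) h1 h2 (by simp [h3]) (by omega) (by rw [h5]; exact hin.left)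
      (by simp; omega) (by omega) ?_
    intro s2 L2 e1 e2 e3 e4 e5 e6 e7
    refine hQ s2 L2 e1 e2 (by rw [e3]; simp; omega) e4 (e5.trans h5) ?_ (by omega)
    exact (h6.mono (Keeps.of_subset (by simp))).trans (e6.mono (Keeps.of_subset (by simp)))
      (Keeps.refl _)

/-- The loop, run up to the point where a tree is processed. The time is linear in the number of
edges, even if the length of the resulting stack is paid for. -/
theorem tree_spec (hB : Bounds D W M k) (t : LTree (Fin k)) : ∀ {s : St}
    {L : List (TopTree (Fin k))} {P : List (Entry (Fin k))} {i : ℕ},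
    Inv M s L → Pending s L P → s.v .top = P.length → s.v .node = i + t.numEdges + 1 →
    InputAt (s.m .inp) i t.subtrees → 2 * (i + t.numEdges + P.length + 1) < M →
    s.clk + (1400 * t.numEdges + 600) ≤ M →
    (∀ s' L', Inv M s' L' → Pending s' L' (t.entry :: P) → s'.v .top = P.length + 1 →
      s'.v .node = i → s'.m .inp = s.m .inp → New L L' t.entry.stack →
      s'.clk + 120 * t.entry.stack.length ≤ s.clk + (1400 * t.numEdges + 600) →
      WP D W nodeLoop s' Q) →
    WP D W nodeLoop s Q := by
  induction t using LTree.induct with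
  | h a ts ih =>
    intro s L P i hI hP htop hnode hin hM hclk hQ
    have hcost : (ts.map fun t => 1400 * t.numEdges + 600).sum + 800 * ts.length =
        1400 * (node a ts).numEdges := by
      rw [numEdges_node]
      clear * -
      induction ts with
      | nil => simp
      | cons t ts ih => simp only [List.map_cons, List.sum_cons, List.length_cons]; omega
    have hlen : ts.length ≤ (node a ts).numEdges := by
      rw [numEdges_node]
      clear * -
      induction ts with
      | nil => simp
      | cons t ts ih => simp only [List.map_cons, List.sum_cons, List.length_cons]; omega
    rw [subtrees_node] at hin
    have hroot := hin 0 _ rfl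
    have hin2 : InputAt (s.m .inp) (i + 1) (ts.flatMap fun c => c.subtrees) :=
      InputAt.right (l := [node a ts]) hin
    have hsum := numEdges_node a ts
    refine forest_spec (P := P) (i := i + 1) (c := 1400) ih hI hP htop (by omega) hin2 (by omega)
      (by omega) ?_
    intro s1 L1 h1 h2 h3 h4 h5 h6 h7
    refine .loop_true (by simp only [Cond.Holds]; rw [h4, h1.zero]; omega) ?_
    have h8 := Inv.step (s' := s1.tick 1) h1 [] rfl (by simp) (fun _ _ => rfl) (fun _ _ => rfl)
    have hsz : ((ts.map entry).map fun e => e.size + 1).sum = (node a ts).numEdges := by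
      rw [numEdges_node, List.map_map]
      congr 1
      exact List.map_congr_left fun t _ => by simp
    refine nodeProg_spec hB h8.inv (P := P) (es := ts.map entry) (a := a) (i := i)
      (Pending.step h8 h2) (by rw [List.length_map]; exact h3) h4 (by rw [St.tick_m, h5]; exact hroot.1)
      (by rw [St.tick_m, h5, List.length_map]; exact hroot.2) ?_ (by rw [hsz]; omega) (by omega)
      (by rw [List.length_map]; omega)
      (by rw [St.tick_clk, List.length_map]; linarith) ?_
    · intro e he
      obtain ⟨t, -, rfl⟩ := List.mem_map.1 he
      rw [entry_total, entry_size]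
    intro s2 L2 e1 e2 e3 e4 e5 e6 e7
    rw [← entry_node] at e2
    have hst : (node a ts).entry.stack = Entry.nodeStack a (ts.map entry) := by
      rw [entry_node]; rfl
    simp only [St.tick_clk, List.length_map] at e7
    refine hQ s2 L2 e1 e2 e3 e4 (e5.trans h5) ?_ ?_
    · rw [hst]
      exact (h6.mono (Entry.keeps_nodeStack a _)).trans e6 (Keeps.refl _)
    · rw [hst]; linarith

/-! ### The whole program -/

/-- A list of top trees that contains the children of its elements contains all their subtrees. -/
theorem subtrees_subset (h : ∀ o x y, merge o x y ∈ L → x ∈ L ∧ y ∈ L) {T : TopTree (Fin k)}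
    (hT : T ∈ L) : ∀ X ∈ T.subtrees, X ∈ L := by
  induction T using merge_induct with
  | hl a b r => intro X hX; rw [List.mem_singleton.1 hX]; exact hT
  | hm o x y hx hy =>
    intro X hX
    rw [subtrees_merge, List.mem_cons, List.mem_append] at hX
    rcases hX with rfl | hX | hX
    · exact hT
    · exact hx (h o x y hT).1 X hX
    · exact hy (h o x y hT).2 X hX

theorem Inv.closed (hI : Inv M s L) (o : Bool) (x y : TopTree (Fin k)) (h : merge o x y ∈ L) :
    x ∈ L ∧ y ∈ L := by
  obtain ⟨i, hi⟩ := List.mem_iff_getElem?.1 h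
  obtain ⟨w0, w1, w2, w3, hw, -⟩ := hI.record i _ hi
  cases o <;> exact ⟨List.mem_of_getElem? hw.2.1, List.mem_of_getElem? hw.2.2.1⟩

/-- Process all nodes, merge the stack of the root, and complete the output. -/
def mainProg : Prog :=
  setc .one 1 ;; setc .two 2 ;; setc .three 3 ;; setc .four 4 ;; st .cpw .zero .modulus ;;
  nodeLoop ;; ld .stk .pstk .zero ;; setc .oper 1 ;; collapseProg ;;
  st .out .zero .count ;; st .out .one .acc

theorem mainProg_spec (hB : Bounds D W M k) {t : LTree (Fin k)} (h1 : 1 ≤ t.numEdges)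
    (hM : 1400 * t.numEdges + 1000 + s.clk ≤ M)
    (hmod : s.v .modulus = M) (hnode : s.v .node = t.numEdges + 1)
    (hv : ∀ x, x ≠ .modulus → x ≠ .node → s.v x = 0)
    (hin : InputAt (s.m .inp) 0 t.subtrees) (hdict : ∀ i, s.m .dict i = 0)
    (hQ : ∀ s' : St, s'.clk ≤ s.clk + 1400 * t.numEdges + 700 →
      ∀ L : List (TopTree (Fin k)), L.Nodup → (∀ X, X ∈ L ↔ X ∈ t.topTree.subtrees) →
        s'.m .out 0 = L.length → L[s'.m .out 1]? = some t.topTree →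
        (∀ i X, L[i]? = some X → i < M ∧
          Words L X (s'.m .out (2 + 4 * i)) (s'.m .out (2 + 4 * i + 1))
            (s'.m .out (2 + 4 * i + 2)) (s'.m .out (2 + 4 * i + 3))) → Q s') :
    WP D W mainProg s Q := by
  have h16 := hB.le_M
  refine .seq (.setc (hB.lt_W (by omega)) ?_)
  refine .seq (.setc (hB.lt_W (by omega)) ?_)
  refine .seq (.setc (hB.lt_W (by omega)) ?_)
  refine .seq (.setc (hB.lt_W (by omega)) ?_)
  refine .seq (.st hB.le_W hB.W_gt 0 M (by simp [hv]) (hB.lt_D (by omega)) (by simp [hmod]) ?_)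
  set s0 := ((((((((((s.set .one 1).tick 1).set .two 2).tick 1).set .three 3).tick 1).set .four
    4).tick 1).put .cpw 0 M).tick 4) with hs0
  have hI : Inv M s0 ([] : List (TopTree (Fin k))) := by
    refine ⟨?_, ?_, ?_, ?_, ?_, ?_, ?_, ?_, ?_, ?_, List.nodup_nil, ?_, ?_⟩
    · simp [hs0, hmod]
    · simp [hs0, hv]
    · simp [hs0]
    · simp [hs0]
    · simp [hs0]
    · simp [hs0]
    · simp [hs0, hv]
    · simp
    · simp [hs0, hv]
    · simp [hs0]
    · intro i T hT; simp at hT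
    · intro n hn; simp [hs0, hdict] at hn
  have hc0 : s0.clk = s.clk + 8 := by simp [hs0]
  refine .seq (tree_spec hB t (P := []) (i := 0) hI trivial (by simp [hs0, hv])
    (by simp [hs0, hnode]) (by simpa [hs0] using hin) (by simp; omega) (by omega) ?_)
  intro s1 L1 e1 e2 _ e4 _ e6 e7
  obtain ⟨c, S, hcS⟩ := exists_stack h1
  obtain ⟨-, -, hS1, -⟩ := e2
  have htot := entry_total t
  rw [hcS] at hS1 e6 e7 htot
  rw [total_cons] at htot
  rw [List.length_cons] at e7
  refine .loop_false (by simp only [Cond.Holds, not_not]; rw [e4, e1.zero]) ?_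
  refine .seq (.ld hB.le_W hB.W_gt 0 (s1.m .pstk 0) e1.zero (hB.lt_D (by omega)) rfl ?_)
  refine .seq (.setc (hB.lt_W (by omega)) ?_)
  have h2 := Inv.step (s' := ((((s1.tick 1).set .stk (s1.m .pstk 0)).tick 4).set .oper 1).tick 1)
    e1 [.stk, .oper] rfl (by simp; omega) (by intro v hv; simp at hv; simp [hv]) (by simp [core])
  refine .seq (collapseProg_spec hB h2.inv (o := true) (Linked.step h2 hS1) rfl (by omega)
    (by simp; omega) ?_)
  intro s3 L3 h3 hn3 hacc hc3
  simp only [St.tick_clk, St.set_clk] at hc3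
  rw [← topTree_eq hcS] at hn3 hacc
  have hcl := h3.inv.count_le
  refine .seq (.st hB.le_W hB.W_gt 0 L3.length h3.inv.zero (hB.lt_D (by omega)) h3.inv.count ?_)
  refine .st hB.le_W hB.W_gt 1 (s3.v .acc) h3.inv.one (hB.lt_D (by omega)) rfl ?_
  have hnew : New [] L3 [t.topTree] := by
    refine (e6.mono ?_).trans hn3 (Keeps.refl _)
    rw [topTree_eq hcS]
    exact keeps_collapse true c S
  refine hQ _ (by simp; omega) L3 h3.inv.nodup (fun X => ⟨fun hX => ?_, ?_⟩) (by simp)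
    (by simpa using hacc) ?_
  · rcases hnew X hX with hX | ⟨d, hd, hX⟩
    · simp at hX
    · rwa [List.mem_singleton.1 hd] at hX
  · exact subtrees_subset h3.inv.closed (List.mem_of_getElem? hacc) X
  · intro i X hX
    have hi := (List.getElem?_eq_some_iff.1 hX).1
    obtain ⟨w0, w1, w2, w3, hw, g0, g1, g2, g3, -⟩ := h3.inv.record i X hX
    refine ⟨by omega, ?_⟩
    have u0 : (2 + 4 * i ≠ 1 ∧ 2 + 4 * i ≠ 0) ∧ (2 + 4 * i + 1 ≠ 1 ∧ 2 + 4 * i + 1 ≠ 0) ∧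
      (2 + 4 * i + 2 ≠ 1 ∧ 2 + 4 * i + 2 ≠ 0) ∧ (2 + 4 * i + 3 ≠ 1 ∧ 2 + 4 * i + 3 ≠ 0) := by omega
    simpa only [St.tick_m, St.put_m, if_true, ne_eq, u0, not_false_eq_true, Function.update_of_ne,
      g0, g1, g2, g3] using hw

/-- Read the alphabet size and the number of nodes, and compute the distance of the arrays. -/
def setup : Prog :=
  .load 1 1 ;; .const 2 1 ;; .load Var.node.reg 2 ;; .const 2 2000 ;;
  .arith .mul 2 2 Var.node.reg ;; .arith .add Var.modulus.reg 2 1 ;; .const 2 4 ;;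
  .arith .mul 0 2 Var.modulus.reg ;; .arith .mul 0 0 Var.modulus.reg

/-- The abstract state after the setup. -/
def start (t : LTree (Fin k)) : St where
  v x := if x = .modulus then 2000 * (t.numEdges + 1) + k else if x = .node then t.numEdges + 1 else 0
  m A i := if A = .inp then (inputWords t).getD i 0 else 0
  clk := 9

theorem inputAt_flatMap (l : List (LTree (Fin k))) (j : ℕ) (u : LTree (Fin k)) (hu : l[j]? = some u) :
    (l.flatMap fun u => [(u.label : ℕ), u.degree])[2 * j]? = some (u.label : ℕ) ∧
    (l.flatMap fun u => [(u.label : ℕ), u.degree])[2 * j + 1]? = some u.degree := by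
  induction l generalizing j with
  | nil => simp at hu
  | cons w l ih =>
    cases j with
    | zero =>
      simp only [List.getElem?_cons_zero, Option.some.injEq] at hu
      subst hu
      simp
    | succ j =>
      have := ih j (by simpa using hu)
      simpa [mul_add] using this

theorem inputAt_start (t : LTree (Fin k)) : InputAt ((start t).m .inp) 0 t.subtrees := by
  intro j u hu
  obtain ⟨h1, h2⟩ := inputAt_flatMap _ j u hu
  have e1 : 2 + 2 * (0 + j) = 2 * j + 1 + 1 := by ring
  have e2 : 2 + 2 * (0 + j) + 1 = 2 * j + 1 + 1 + 1 := by ring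
  simp only [start, if_true, inputWords, e2, List.getD_eq_getElem?_getD, List.getElem?_cons_succ]
  rw [e1]
  simp [h1, h2]

theorem length_inputWords (t : LTree (Fin k)) :
    (inputWords t).length = 2 + 2 * (t.numEdges + 1) := by
  simp [inputWords, LTree.length_subtrees, List.length_flatMap]
  omega

theorem degree_le_numEdges (t : LTree (Fin k)) : ∀ u ∈ t.subtrees, u.degree ≤ t.numEdges := by
  induction t using LTree.induct with
  | h a ts ih =>
    intro u hu
    rw [subtrees_node, List.mem_cons, List.mem_flatMap] at hu
    rw [numEdges_node]
    rcases hu with rfl | ⟨t, ht, hu⟩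
    · simp [LTree.degree, List.sum_map_add]
    · have h1 := ih t ht u hu
      have h2 : t.numEdges + 1 ≤ (ts.map fun c => c.numEdges + 1).sum :=
        List.single_le_sum (by simp) _ (List.mem_map_of_mem ht)
      omega

theorem mem_inputWords_le (t : LTree (Fin k)) : ∀ w ∈ inputWords t, w ≤ t.numEdges + 1 + k := by
  intro w hw
  simp only [inputWords, List.mem_cons, List.mem_flatMap, LTree.length_subtrees, List.not_mem_nil,
    or_false] at hw
  rcases hw with rfl | rfl | ⟨u, hu, rfl | rfl⟩
  · omega
  · omega
  · have := u.label.2; omega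
  · have := degree_le_numEdges t u hu; omega

theorem getD_inputWords_le (t : LTree (Fin k)) (i : ℕ) :
    (inputWords t).getD i 0 ≤ t.numEdges + 1 + k := by
  rw [List.getD_eq_getElem?_getD]
  cases h : (inputWords t)[i]? with
  | none => simp
  | some w => exact mem_inputWords_le t w (List.mem_of_getElem? h)

theorem setup_spec {t : LTree (Fin k)} (hM : 2000 * (t.numEdges + 1) + k = M)
    (hB : Bounds D W M k) : ∃ τ, Exec W setup (initStore t) τ 9 ∧ Repr D W (start t) τ := by
  have hMW := hB.lt_W (n := M) (by have := hB.le_M; omega)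
  have hDW := hB.D_le
  have h64 : 16 * D ≤ W := hB.le_W
  have hD0 : 0 < D := hB.lt_D (by have := hB.le_M; omega)
  have hDeq := hB.D_eq
  have hD4 := hB.lt_D (n := 4 * M) (by have := hB.le_M; omega)
  have hk : (initStore t).mem 0 = k := rfl
  have hN : (initStore t).mem 1 = t.numEdges + 1 := by
    rw [← LTree.length_subtrees]; rfl
  have r1 : Var.modulus.reg = 3 := rfl
  have r2 : Var.node.reg = 11 := rfl
  have e1 := Exec.load (W := W) (initStore t) 1 1
    (by change (initStore t).mem 0 < W; rw [hk]; omega)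
  rw [show (initStore t).reg 1 = 0 from rfl, hk] at e1
  refine ⟨⟨Function.update (Function.update (Function.update (Function.update (Function.update
    (Function.update (Function.update (Function.update (Function.update (initStore t).reg 1 k) 2 1)
    11 (t.numEdges + 1)) 2 2000) 2 (2000 * (t.numEdges + 1))) 3 M) 2 4) 0 (4 * M)) 0 D,
    (initStore t).mem⟩, ?_, ?_⟩
  · refine .seq (k := 1) (l := 8) e1 (.seq (k := 1) (l := 7) (.const _ 2 1 (by omega))
      (.seq (k := 1) (l := 6) (τ := ⟨Function.update (Function.update (Function.update
        (initStore t).reg 1 k) 2 1) 11 (t.numEdges + 1), (initStore t).mem⟩) ?_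
      (.seq (k := 1) (l := 5) (.const _ 2 2000 (by omega))
      (.seq (k := 1) (l := 4) (τ := ⟨Function.update (Function.update (Function.update
        (Function.update (Function.update
        (initStore t).reg 1 k) 2 1) 11 (t.numEdges + 1)) 2 2000) 2 (2000 * (t.numEdges + 1)),
        (initStore t).mem⟩) ?_
      (.seq (k := 1) (l := 3) (τ := ⟨Function.update (Function.update (Function.update
        (Function.update (Function.update (Function.update
        (initStore t).reg 1 k) 2 1) 11 (t.numEdges + 1)) 2 2000) 2 (2000 * (t.numEdges + 1))) 3 M,
        (initStore t).mem⟩) ?_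
      (.seq (k := 1) (l := 2) (.const _ 2 4 (by omega))
      (.seq (k := 1) (l := 1) (τ := ⟨Function.update (Function.update (Function.update
        (Function.update (Function.update (Function.update (Function.update (Function.update
        (initStore t).reg 1 k) 2 1) 11 (t.numEdges + 1)) 2 2000) 2 (2000 * (t.numEdges + 1))) 3 M)
        2 4) 0 (4 * M), (initStore t).mem⟩) ?_ ?_)))))))
    · have := Exec.load (W := W) ⟨Function.update (Function.update (initStore t).reg 1 k) 2 1,
        (initStore t).mem⟩ 11 2 (by simp [hN]; omega)
      simpa [hN, r2] using this
    · have := Exec.arith (W := W) ⟨Function.update (Function.update (Function.update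
        (Function.update (initStore t).reg 1 k) 2 1) 11 (t.numEdges + 1)) 2 2000,
        (initStore t).mem⟩ .mul 2 2 11 (by simp [ArithOp.eval]; omega)
      simpa [ArithOp.eval, r2] using this
    · have := Exec.arith (W := W) ⟨Function.update (Function.update (Function.update (Function.update
        (Function.update (initStore t).reg 1 k) 2 1) 11 (t.numEdges + 1)) 2 2000) 2
        (2000 * (t.numEdges + 1)), (initStore t).mem⟩ .add 3 2 1 (by simp [ArithOp.eval]; omega)
      simpa [ArithOp.eval, r1, hM] using this
    · have := Exec.arith (W := W) ⟨Function.update (Function.update (Function.update (Function.update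
        (Function.update (Function.update (Function.update (initStore t).reg 1 k) 2 1) 11
        (t.numEdges + 1)) 2 2000) 2 (2000 * (t.numEdges + 1))) 3 M) 2 4, (initStore t).mem⟩ .mul
        0 2 3 (by simp [ArithOp.eval]; omega)
      simpa [ArithOp.eval, r1] using this
    · have := Exec.arith (W := W) ⟨Function.update (Function.update (Function.update (Function.update
        (Function.update (Function.update (Function.update (Function.update (initStore t).reg 1 k)
        2 1) 11 (t.numEdges + 1)) 2 2000) 2 (2000 * (t.numEdges + 1))) 3 M) 2 4) 0 (4 * M),
        (initStore t).mem⟩ .mul 0 0 3 (by simp [ArithOp.eval, hDeq]; omega)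
      simpa [ArithOp.eval, r1, hDeq] using this
  · refine ⟨by simp, fun x => ?_, fun x => ?_, fun A i hi => ?_, fun A i hi => ?_⟩
    · cases x <;> simp [Var.reg, Var.ctorIdx, start, initStore, hM]
    · simp only [start]
      split_ifs <;> omega
    · simp only [start, initStore]
      split_ifs with hA
      · subst hA
        simp [Arr.idx, Arr.ctorIdx]
      · have h1 : 1 ≤ A.idx := by
          refine Nat.pos_of_ne_zero fun h => hA (Arr.idx_inj ?_)
          rw [h]; rfl
        have h2 := Nat.mul_le_mul_right D h1
        rw [List.getD_eq_getElem?_getD, List.getElem?_eq_none]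
        · rfl
        · rw [length_inputWords]; omega
    · simp only [start]
      split_ifs
      · have := getD_inputWords_le t i; omega
      · omega

/-- The algorithm. -/
def algorithm : Prog := setup ;; mainProg

theorem algorithm_spec {t : LTree (Fin k)} (h1 : 1 ≤ t.numEdges)
    (hM : 2000 * (t.numEdges + 1) + k = M) (hB : Bounds D W M k) :
    ∃ l τ, Exec W algorithm (initStore t) τ l ∧ l ≤ 2200 * t.numEdges ∧
      HoldsTopDag τ.mem (τ.reg 0) t.topTree := by
  obtain ⟨σ, he, hσ⟩ := setup_spec hM hB
  have hwp : WP D W mainProg (start t) fun s' => s'.clk ≤ 2200 * t.numEdges ∧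
      ∃ L : List (TopTree (Fin k)), L.Nodup ∧ (∀ X, X ∈ L ↔ X ∈ t.topTree.subtrees) ∧
        s'.m .out 0 = L.length ∧ L[s'.m .out 1]? = some t.topTree ∧
        (∀ i X, L[i]? = some X → i < M ∧
          Words L X (s'.m .out (2 + 4 * i)) (s'.m .out (2 + 4 * i + 1))
            (s'.m .out (2 + 4 * i + 2)) (s'.m .out (2 + 4 * i + 3))) := by
    have hclk : (start t).clk = 9 := rfl
    refine mainProg_spec hB h1 (by omega) (by simp [start, hM]) (by simp [start]) ?_
      (inputAt_start t) (by simp [start]) ?_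
    · intro x hx1 hx2; simp [start, hx1, hx2]
    · intro s' hs' L a1 a2 a3 a4 a5
      exact ⟨by omega, L, a1, a2, a3, a4, a5⟩
  obtain ⟨s', ⟨-, hrun⟩, hc, L, a1, a2, a3, a4, a5⟩ := hwp
  obtain ⟨τ, l, he', hl, hτ⟩ := hrun σ hσ
  have hclk : (start t).clk = 9 := rfl
  have h16 := hB.le_M
  have hout : ∀ i, i < 8 * M → τ.mem (D + i) = s'.m .out i := fun i hi => by
    have := hτ.arr .out i (hB.lt_D hi)
    rwa [show Arr.out.idx * D = D from one_mul D] at this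
  refine ⟨9 + l, τ, .seq he he', by omega, ?_⟩
  rw [hτ.dist]
  refine ⟨L, a1, a2, (hout 0 (by omega)).trans a3, by rw [hout 1 (by omega)]; exact a4, ?_⟩
  intro i X hX
  obtain ⟨hi, hw⟩ := a5 i X hX
  rw [← hout _ (by omega), ← hout _ (by omega), ← hout _ (by omega), ← hout _ (by omega)] at hw
  simp only [← add_assoc] at hw
  cases X with
  | leaf a b r => exact hw
  | vert x y | horiz x y => exact ⟨hw.1, hw.2.1, hw.2.2.1⟩

end Ram

end TopDag

/-- There are one word RAM program `P` and one constant `C` such that, for every alphabet size `s`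
and every tree `t` over the alphabet `{0, …, s - 1}` with `n ≥ 1` edges, `P` halts on input `t` after
at most `C * n` steps, using words of at most `C * log (n + s)` bits, and then the memory holds (from
the address in register `0` on) the minimal dag of a top tree `T` for `t`, with the stated bounds. -/
theorem theorem1 :
    ∃ (P : TopDag.Prog) (C : ℕ),
      ∀ (s : ℕ) (t : TopDag.LTree (Fin s)) (n : ℕ), t.numEdges = n → 1 ≤ n →
        ∃ (k : ℕ) (τ : TopDag.Store) (T : TopDag.TopTree (Fin s)),
          TopDag.Exec ((n + s) ^ C) P (TopDag.initStore t) τ k ∧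
          k ≤ C * n ∧
          TopDag.HoldsTopDag τ.mem (τ.reg 0) T ∧
          T.IsTopTreeFor t ∧
          (T.height : ℝ) ≤ C * Real.log n ∧
          (2 ≤ n →
            (T.dagSize : ℝ) ≤ C * (n / Real.logb (max s 2 : ℕ) n) ∧
            (T.dagSize : ℝ) ≤ C * (t.dagSize * Real.log n)) := by
  obtain ⟨C, hC⟩ : ∃ C : ℕ, 2200 ≤ C := ⟨_, le_rfl⟩
  refine ⟨TopDag.Ram.algorithm, C, fun s t n hn h1 => ?_⟩
  have hCR : (2200 : ℝ) ≤ C := by exact_mod_cast hC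
  subst hn
  have hs : 1 ≤ s := Fin.pos t.label
  have hB : TopDag.Ram.Bounds (4 * (2000 * (t.numEdges + 1) + s) * (2000 * (t.numEdges + 1) + s))
      ((t.numEdges + s) ^ C) (2000 * (t.numEdges + 1) + s) s := by
    refine ⟨by omega, by omega, rfl, ?_⟩
    set b := t.numEdges + s with hb
    have h2 : 2000 * (t.numEdges + 1) + s ≤ 4000 * b := by omega
    calc 16 * (4 * (2000 * (t.numEdges + 1) + s) * (2000 * (t.numEdges + 1) + s))
        ≤ 16 * (4 * (4000 * b) * (4000 * b)) := by gcongr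
      _ = 1024000000 * b ^ 2 := by ring
      _ ≤ 2 ^ 30 * b ^ 2 := by gcongr; norm_num
      _ ≤ b ^ 30 * b ^ 2 := by gcongr; omega
      _ = b ^ 32 := by rw [← pow_add]
      _ ≤ b ^ C := Nat.pow_le_pow_right (by omega) (by omega)
  obtain ⟨l, τ, he, hl, hd⟩ := TopDag.Ram.algorithm_spec h1 rfl hB
  have hlog : 0 ≤ Real.log t.numEdges := Real.log_natCast_nonneg _
  refine ⟨l, τ, t.topTree, he, hl.trans (Nat.mul_le_mul_right _ hC), hd, TopDag.LTree.topTree_isTopTreeFor h1, ?_, fun h2 => ⟨?_, ?_⟩⟩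
  · exact (TopDag.LTree.topTree_height_le_log h1).trans
      (mul_le_mul_of_nonneg_right (by linarith) hlog)
  · have h3 : (1 : ℝ) < (max s 2 : ℕ) := by exact_mod_cast (by omega : 1 < max s 2)
    exact (TopDag.LTree.topTree_dagSize_le_logb h2).trans (mul_le_mul_of_nonneg_right (by linarith)
      (div_nonneg (Nat.cast_nonneg _) (Real.logb_nonneg h3 (by exact_mod_cast h1))))
  · exact (TopDag.LTree.topTree_dagSize_le_dagSize h2).trans
      (mul_le_mul_of_nonneg_right (by linarith) (by positivity))
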